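/- Let $B$ be a connected smooth manifold of dimension $g$ and $\Lambda\subset T^*B$ a Lagrangian covering, i.e. a family of lattices $\Lambda_b\subset T^*_bB$ such that around every point of $B$ there are smooth coordinates $(x^1,\dots,x^g)$ (action coordinates) with $\Lambda_b=\bigoplus_j\mathbb Z\,(dx^j)_b$. Let $f\colon X=T^*B/\Lambda\to B$ be the associated Lagrangian torus fibration, with symplectic form $\omega=\sum_j dx^j\wedge dy_j$ in action-angle coordinates $(x,y)$, where $y$ denotes the class of the covector $\sum_j y_j\,dx^j$ (up to isomorphism these are the fibrations in Lagrangian tori that have a Lagrangian section). Let $\hat f\colon\hat X=R^1f_*\mathbb R/R^1f_*\mathbb Z=TB/\Lambda^\vee\to B$ be the dual family, where $\Lambda_b^\vee=\{v\in T_bB:\lambda(v)\in\mathbb Z\ \forall\lambda\in\Lambda_b\}$, with the complex structure for which $z^j=x^j+iw^j$ are holomorphic coordinates, $(x,w)$ being the class of the vector $\sum_j w^j\,\partial/\partial x^j$. The Gauss–Manin connection is the flat connection on $T^*B\simeq\mathrm{Vert}\,TX$ for which the $dx^j$ are parallel. Let $\mathcal P$ be the Poincaré bundle on $X\times_B\hat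 X$, with connection form $2\pi i\sum_j w^j\,dy_j$. Let $S\subset X$ be a closed embedded submanifold such that (C1) $S$ is Lagrangian; (C2) for every $b\in B$ the intersection $S_b=S\cap X_b$, when nonempty, is an affine subtorus of $X_b=T_b^*B/\Lambda_b$, i.e. a translate of $W/(W\cap\Lambda_b)$ for a linear subspace $W\subset T^*_bB$ such that $W\cap\Lambda_b$ has rank $\dim W$, and its dimension $m$ does not depend on $b$; and such that $f|_S\colon S\to f(S)$ is a submersion, in the sense that $T_sS\cap\ker d_sf=T_sS_{f(s)}$ for every $s\in S$. Let $(\mathcal L,\nabla)$ be a $U(1)$ local system on $S$ (a line bundle with a flat unitary connection), let $p_S,\hat p_S$ be the projections of $Z_S=S\times_B\hat X$ to $S$ and $\hat X$, let $\mathcal P_S=\mathcal P|_{Z_S}$, and let $\nabla_r$ be the part of the connection of $p_S^*\mathcal L\otimes\mathcal P_S$ along the fibres of $\hat p_S$. Let $\hat{\mathcal L}=R^m\hat p_{S,*}\ker\nabla_r$, the $m$-th cohomology sheaf of the complex $\hat p_{S,*}(p_S^*\mathcal L\otimes\mathcal P_S\otimes\Omega^\bullet_{\rm rel})$ of relative forms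 with differential $\nabla_r$, and let $\hat S=\{\xi\in\hat X:\hat{\mathcal L}_\xi\neq0\}$ be its support. Then the condition (C3) the vertical tangent spaces of the family of subtori $\{S_b\}_{b\in f(S)}$ are carried into each other by Gauss–Manin parallel transport along paths in $f(S)$ holds if and only if $\hat S$ is a complex submanifold of $\hat X$. -/

import Mathlib

open Set Filter Topology
open scoped Manifold ContDiff

noncomputable section

namespace TorusFibration

/-! ### Submanifolds of a vector space -/

section Submanifold

/-- Velocities at `p` of curves contained in `M`. For a submanifold `M` this is `T_p M`. -/
def tangentVectors {V : Type*} [AddCommGroup V] [Module ℝ V] [TopologicalSpace V]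
    [ContinuousSMul ℝ V] (M : Set V) (p : V) : Set V :=
  {v | ∃ γ : ℝ → V, γ 0 = p ∧ (∀ᶠ t in 𝓝 (0 : ℝ), γ t ∈ M) ∧ HasDerivAt γ v 0}

/-- `M` is an embedded `d`-dimensional submanifold of class `C^n` over `𝕜` of the vector space `V`:
around each of its points there is a `C^n` chart of `V` that straightens `M` into a linear
subspace of dimension `d`. For `𝕜 = ℂ` these are the complex submanifolds. -/
def IsSubmanifold (𝕜 : Type*) [NontriviallyNormedField 𝕜] {V : Type*} [NormedAddCommGroup V]
    [NormedSpace 𝕜 V] (n : WithTop ℕ∞) (d : ℕ) (M : Set V) : Prop :=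
  ∀ p ∈ M, ∃ (Φ : OpenPartialHomeomorph V V) (F : Submodule 𝕜 V),
    p ∈ Φ.source ∧ ContDiffOn 𝕜 n Φ Φ.source ∧ ContDiffOn 𝕜 n Φ.symm Φ.target ∧
    Module.finrank 𝕜 F = d ∧ Φ '' (M ∩ Φ.source) = Φ.target ∩ (F : Set V)

end Submanifold

/-! ### Unitary local systems of rank one -/

/-- A `U(1)` local system (a line bundle with flat unitary connection) on a subset `S` of a
topological space, presented by local flat unitary frames over an open cover: the frames over two
members of the cover differ by a locally constant function with values in `U(1)`. -/
structure LocalSystem {Y : Type*} [TopologicalSpace Y] (S : Set Y) where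
  /-- the index set of the cover -/
  ι : Type*
  /-- the open cover of `S` -/
  cover : ι → Set Y
  isOpen_cover : ∀ i, IsOpen (cover i)
  subset_cover : S ⊆ ⋃ i, cover i
  /-- the transition functions -/
  trans : ι → ι → Y → Circle
  locallyConstant : ∀ i j, ∀ p ∈ S ∩ (cover i ∩ cover j),
    ∀ᶠ q in 𝓝[S] p, trans i j q = trans i j p
  cocycle : ∀ i j k, ∀ p ∈ S ∩ (cover i ∩ cover j ∩ cover k),
    trans i j p * trans j k p = trans i k p

/-! ### Lagrangian torus fibrations and their duals -/

section Fibration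

/-- The coordinate space `ℝ^g`. -/
abbrev Coord (g : ℕ) : Type := EuclideanSpace ℝ (Fin g)

variable {g : ℕ} {B : Type*} [TopologicalSpace B] [ChartedSpace (Coord g) B]

variable (g) in
/-- The tangent space `T_b B`. -/
abbrev Tan (b : B) : Type := TangentSpace (𝓡 g) b

variable (g) in
/-- The cotangent space `T*_b B`. -/
abbrev Cot (b : B) : Type := Tan g b →L[ℝ] ℝ

/-- The covector `∑ y_j dx^j` at `b`, where `(x^1, …, x^g)` are the components of `φ`. -/
def cot (φ : OpenPartialHomeomorph B (Coord g)) (b : B) (y : Coord g) : Cot g b :=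
  ContinuousLinearMap.comp (innerSL ℝ y : Coord g →L[ℝ] ℝ)
    (mfderiv (𝓡 g) 𝓘(ℝ, Coord g) φ b : Tan g b →L[ℝ] Coord g)

/-- The vector `∑ w^j ∂/∂x^j` at the point with coordinates `x`. -/
def tan (φ : OpenPartialHomeomorph B (Coord g)) (x w : Coord g) : Tan g (φ.symm x) :=
  mfderiv 𝓘(ℝ, Coord g) (𝓡 g) φ.symm x w

/-- Action coordinates: smooth coordinates `(x^1, …, x^g)` on `B` such that
`Λ_b = ⨁ ℤ (dx^j)_b` at each point `b` of the domain. -/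
def IsActionChart (Λ : ∀ b : B, AddSubgroup (Cot g b)) (φ : OpenPartialHomeomorph B (Coord g)) :
    Prop :=
  φ ∈ IsManifold.maximalAtlas (𝓡 g) ∞ B ∧
  ∀ b ∈ φ.source, ∀ α : Cot g b,
    α ∈ Λ b ↔ ∃ n : Fin g → ℤ, α = cot φ b (WithLp.toLp 2 fun j => (n j : ℝ))

variable (g B) in
/-- A Lagrangian covering `Λ ⊂ T*B`: a family of lattices in the cotangent spaces of `B`, locally
spanned over `ℤ` by the differentials of a system of coordinates. -/
structure LagrangianCovering where
  /-- the lattice in `T*_b B` -/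
  lattice : ∀ b : B, AddSubgroup (Cot g b)
  exists_actionChart : ∀ b : B, ∃ φ, IsActionChart lattice φ ∧ b ∈ φ.source

variable (Λ : LagrangianCovering g B)

/-- The action charts on the base. -/
abbrev ActionChart : Type _ := {φ : OpenPartialHomeomorph B (Coord g) // IsActionChart Λ.lattice φ}

/-- The dual lattice `{v ∈ T_b B | λ(v) ∈ ℤ for all λ ∈ Λ_b} = H^1(X_b, ℤ)` in
`T_b B = Hom(Λ_b, ℝ) = H^1(X_b, ℝ)`. -/
def dualLattice (b : B) : AddSubgroup (Tan g b) where
  carrier := {v | ∀ l ∈ Λ.lattice b, ∃ n : ℤ, l v = n}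
  zero_mem' := fun l _ => ⟨0, by simp⟩
  add_mem' := by
    rintro v w hv hw l hl
    obtain ⟨a, ha⟩ := hv l hl
    obtain ⟨c, hc⟩ := hw l hl
    exact ⟨a + c, by simp [ha, hc]⟩
  neg_mem' := by
    rintro v hv l hl
    obtain ⟨a, ha⟩ := hv l hl
    exact ⟨-a, by simp [ha]⟩

/-- The Lagrangian torus fibration `X = T*B / Λ`, with projection `f = Sigma.fst`. -/
def X : Type _ := Σ b : B, Cot g b ⧸ Λ.lattice b

/-- The dual family `X̂ = TB / Λ^∨ = R¹f_*ℝ / R¹f_*ℤ`, with projection `Sigma.fst`. -/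
def XHat : Type _ := Σ b : B, Tan g b ⧸ dualLattice Λ b

variable {Λ}

/-- The point of `X` defined by a covector. -/
def X.mk {b : B} (α : Cot g b) : X Λ := ⟨b, QuotientAddGroup.mk α⟩

/-- The point of `X̂` defined by a vector. -/
def XHat.mk {b : B} (v : Tan g b) : XHat Λ := ⟨b, QuotientAddGroup.mk v⟩

/-- The projection `f : X → B`. -/
def X.proj (p : X Λ) : B := p.1

/-- The point of `X` with action-angle coordinates `(x, y)`; it is of interest for `x ∈ φ.target`,
and the `y`'s are defined modulo integers. -/
def X.param (φ : ActionChart Λ) (p : Coord g × Coord g) : X Λ :=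
  X.mk (cot φ.1 (φ.1.symm p.1) p.2)

/-- The point of `X̂` with coordinates `(x, w)`, the `w`'s being dual to the `y`'s. -/
def XHat.param (φ : ActionChart Λ) (p : Coord g × Coord g) : XHat Λ :=
  XHat.mk (tan φ.1 p.1 p.2)

/-- The quotient topology, i.e. the final topology for the action-angle parametrizations. -/
instance : TopologicalSpace (X Λ) :=
  ⨆ φ : ActionChart Λ, TopologicalSpace.coinduced
    (fun p : {p : Coord g × Coord g // p.1 ∈ φ.1.target} => X.param φ p.1) inferInstance

/-- The quotient topology, i.e. the final topology for the parametrizations by `(x, w)`. -/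
instance : TopologicalSpace (XHat Λ) :=
  ⨆ φ : ActionChart Λ, TopologicalSpace.coinduced
    (fun p : {p : Coord g × Coord g // p.1 ∈ φ.1.target} => XHat.param φ p.1) inferInstance

/-! ### Conditions on a subset of `X` -/

/-- The part of `S` in an action-angle chart, as a subset of `ℝ^g × ℝ^g` (periodic in `y`). -/
def inChart (S : Set (X Λ)) (φ : ActionChart Λ) : Set (Coord g × Coord g) :=
  {p | p.1 ∈ φ.1.target ∧ X.param φ p ∈ S}

/-- The symplectic form `∑ dx^j ∧ dy_j`. -/
def symplecticForm (u v : Coord g × Coord g) : ℝ :=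
  inner ℝ u.1 v.2 - inner ℝ v.1 u.2

/-- `S` is a closed (embedded) Lagrangian submanifold of `X`. -/
structure IsClosedLagrangian (S : Set (X Λ)) : Prop where
  isClosed : IsClosed S
  isSubmanifold : ∀ φ : ActionChart Λ, IsSubmanifold ℝ ∞ g (inChart S φ)
  isotropic : ∀ φ : ActionChart Λ, ∀ p ∈ inChart S φ,
    ∀ u ∈ tangentVectors (inChart S φ) p, ∀ v ∈ tangentVectors (inChart S φ) p,
      symplecticForm u v = 0

/-- `f` restricts to a submersion `S → f(S)`, in the sense that `ker d(f|_S)` at a point `s` of `S`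
consists of vectors tangent to the fibre `S_b` through `s`. -/
def IsFibrewiseClean (S : Set (X Λ)) : Prop :=
  ∀ φ : ActionChart Λ, ∀ p ∈ inChart S φ, ∀ u ∈ tangentVectors (inChart S φ) p,
    u.1 = 0 → u ∈ tangentVectors (inChart S φ ∩ {q | q.1 = p.1}) p

/-- The preimage in `T*_b B` of the fibre `S_b ⊂ X_b = T*_b B / Λ_b`. -/
def fibre (S : Set (X Λ)) (b : B) : Set (Cot g b) := {α | (X.mk α : X Λ) ∈ S}

/-- A subset of a fibre `X_b = T*_b B / Λ_b` is an affine subtorus of dimension `m` if it is a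
translate of `W / (W ∩ Λ_b)`, where `W` is an `m`-dimensional subspace in which `W ∩ Λ_b` has
full rank. -/
def IsAffineSubtorus {b : B} (m : ℕ) (T : Set (Cot g b ⧸ Λ.lattice b)) : Prop :=
  ∃ (α₀ : Cot g b) (W : Submodule ℝ (Cot g b)), Module.finrank ℝ W = m ∧
    Submodule.span ℝ ((W : Set (Cot g b)) ∩ (Λ.lattice b : Set (Cot g b))) = W ∧
    T = (fun α : Cot g b => (QuotientAddGroup.mk (α₀ + α) : Cot g b ⧸ Λ.lattice b)) '' W

/-- Each nonempty intersection of `S` with a fibre of `X` is an affine subtorus of dimension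
`m`. -/
def FibresAreSubtori (S : Set (X Λ)) (m : ℕ) : Prop :=
  ∀ b : B, (fibre S b).Nonempty →
    IsAffineSubtorus m {q : Cot g b ⧸ Λ.lattice b | (⟨b, q⟩ : X Λ) ∈ S}

/-- The tangent space of `S_b` at `[α]`, as a subset of `Vert T_[α] X = T*_b B`. -/
def vertTangent (S : Set (X Λ)) {b : B} (α : Cot g b) : Set (Cot g b) :=
  tangentVectors (fibre S b) α

variable (Λ) in
/-- A section `α` of `T*B = Vert TX` along the path `c : [0, 1] → B` is parallel for the Gauss-Manin
connection: it has constant components in the frames `dx^1, …, dx^g` given by action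
coordinates. -/
def IsParallelAlong (c : ℝ → B) (α : ∀ t, Cot g (c t)) : Prop :=
  ∀ φ : ActionChart Λ, ∀ t₀ ∈ Icc (0 : ℝ) 1, c t₀ ∈ φ.1.source →
    ∃ y : Coord g, ∀ᶠ t in 𝓝[Icc 0 1] t₀, α t = cot φ.1 (c t) y

/-- The vertical tangent spaces of the family `S_b`, `b ∈ f(S)`, are carried into each other by
parallel transport along paths in `f(S)`. -/
def VerticalTangentsParallel (S : Set (X Λ)) : Prop :=
  ∀ c : ℝ → B, ContMDiffOn 𝓘(ℝ, ℝ) (𝓡 g) ∞ c (Icc 0 1) → (∀ t ∈ Icc (0 : ℝ) 1, c t ∈ X.proj '' S) →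
    ∀ α : ∀ t, Cot g (c t), IsParallelAlong Λ c α →
      ∀ β₀ ∈ fibre S (c 0), ∀ β₁ ∈ fibre S (c 1),
        α 0 ∈ vertTangent S β₀ → α 1 ∈ vertTangent S β₁

/-! ### The Fourier-Mukai transform -/

section Transform

variable {S : Set (X Λ)} (L : LocalSystem S)

/-- Data for a relative `q`-form on `Z_S = S ×_B X̂` over `X̂` with values in
`p_S^* L ⊗ P_S`: for each local frame `i` of `L`, for each `b` and each pair `(α, v)` which lifts a
point of the fibre of `Z_S` over `b`, an alternating form on `Vert T_[α] X = T*_b B`. Only its values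
on vectors tangent to `S_b` matter. -/
abbrev FormData (q : ℕ) : Type _ :=
  L.ι → ∀ b : B, Cot g b → Tan g b → Cot g b [⋀^Fin q]→ₗ[ℝ] ℂ

/-- `τ` is a (smooth) section of `p_S^* L ⊗ P_S ⊗ Ω^q_rel` over the preimage of `U ⊂ X̂` in `Z_S`.
Sections of the Poincaré bundle `P` are functions `s` of `(α, v)` satisfying
`s(α + λ, v + μ) = exp(-2πi μ(α)) s(α, v)` for `λ ∈ Λ_b` and `μ ∈ Λ_b^∨`; this is the gauge in which
its connection form is `2πi ∑ w^j dy_j`. -/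
structure IsRelForm {q : ℕ} (U : Set (XHat Λ)) (τ : FormData L q) : Prop where
  smooth : ∀ (i : L.ι) (φ : ActionChart Λ) (u : Fin q → Coord g),
    ContDiffOn ℝ ∞
      (fun p : Coord g × Coord g × Coord g =>
        τ i (φ.1.symm p.1) (cot φ.1 (φ.1.symm p.1) p.2.1) (tan φ.1 p.1 p.2.2)
          (fun j => cot φ.1 (φ.1.symm p.1) (u j)))
      {p | p.1 ∈ φ.1.target ∧ X.param φ (p.1, p.2.1) ∈ S ∩ L.cover i ∧
        XHat.param φ (p.1, p.2.2) ∈ U}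
  glue : ∀ (i j : L.ι) (b : B) (α : Cot g b) (v : Tan g b),
    X.mk α ∈ S ∩ (L.cover i ∩ L.cover j) → XHat.mk v ∈ U →
    ∀ u : Fin q → Cot g b, (∀ a, u a ∈ vertTangent S α) →
      τ i b α v u = (L.trans i j (X.mk α) : ℂ) * τ j b α v u
  automorphy : ∀ (i : L.ι) (b : B) (α : Cot g b) (v : Tan g b),
    X.mk α ∈ S ∩ L.cover i → XHat.mk v ∈ U →
    ∀ l ∈ Λ.lattice b, ∀ μ ∈ dualLattice Λ b,
    ∀ u : Fin q → Cot g b, (∀ a, u a ∈ vertTangent S α) →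
      τ i b (α + l) (v + μ) u =
        Complex.exp (-(2 * Real.pi * Complex.I * (α μ : ℂ))) * τ i b α v u

variable {L}

/-- The value of `∇_r τ` on the vectors `u 0, …, u q` tangent to `S_b`, where `∇_r` is the relative
part of the connection of `p_S^* L ⊗ P_S`: exterior derivative along `S_b` (with respect to constant
vector fields), plus exterior product with the connection form `2πi ∑ w^j dy_j` of `P`. -/
def relD {q : ℕ} (τ : FormData L q) (i : L.ι) (b : B) (α : Cot g b) (v : Tan g b)
    (u : Fin (q + 1) → Cot g b) : ℂ :=
  ∑ a : Fin (q + 1), (-1 : ℂ) ^ (a : ℕ) *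
    (deriv (fun t : ℝ => τ i b (α + t • u a) v (fun c => u (a.succAbove c))) 0 +
      2 * Real.pi * Complex.I * (u a v : ℂ) * τ i b α v (fun c => u (a.succAbove c)))

/-- `∇_r τ = 0` over `U`. -/
def IsRelClosed {q : ℕ} (U : Set (XHat Λ)) (τ : FormData L q) : Prop :=
  ∀ (i : L.ι) (b : B) (α : Cot g b) (v : Tan g b), X.mk α ∈ S ∩ L.cover i → XHat.mk v ∈ U →
    ∀ u : Fin (q + 1) → Cot g b, (∀ a, u a ∈ vertTangent S α) → relD τ i b α v u = 0

/-- The class of `τ` vanishes over `U`: `τ = 0` in degree `0`, and `τ = ∇_r σ` for a section `σ` of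
`p_S^* L ⊗ P_S ⊗ Ω^{q-1}_rel` over `U` in degree `q ≥ 1`. -/
def IsRelExact : {q : ℕ} → (U : Set (XHat Λ)) → (τ : FormData L q) → Prop
  | 0, U, τ => ∀ (i : L.ι) (b : B) (α : Cot g b) (v : Tan g b),
      X.mk α ∈ S ∩ L.cover i → XHat.mk v ∈ U → ∀ u : Fin 0 → Cot g b, τ i b α v u = 0
  | q + 1, U, τ => ∃ σ : FormData L q, IsRelForm L U σ ∧
      ∀ (i : L.ι) (b : B) (α : Cot g b) (v : Tan g b), X.mk α ∈ S ∩ L.cover i → XHat.mk v ∈ U →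
        ∀ u : Fin (q + 1) → Cot g b, (∀ a, u a ∈ vertTangent S α) →
          τ i b α v u = relD σ i b α v u

variable (L) in
/-- The support of `R^q p̂_{S,*} ker ∇_r`, the `q`-th cohomology sheaf of the complex
`p̂_{S,*}(p_S^* L ⊗ P_S ⊗ Ω^•_rel)` on `X̂`: the set of the points `ξ` at which the stalk is not zero,
i.e. some closed section near `ξ` is not exact on any neighbourhood of `ξ`. -/
def transformSupport (q : ℕ) : Set (XHat Λ) :=
  {ξ | ∃ U : Set (XHat Λ), IsOpen U ∧ ξ ∈ U ∧
    ∃ τ : FormData L q, IsRelForm L U τ ∧ IsRelClosed U τ ∧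
      ∀ U' ⊆ U, IsOpen U' → ξ ∈ U' → ¬ IsRelExact U' τ}

end Transform

/-! ### Complex submanifolds of `X̂` -/

/-- The part of `T ⊂ X̂` in the holomorphic coordinates `z^j = x^j + i w^j`. -/
def inComplexChart (T : Set (XHat Λ)) (φ : ActionChart Λ) : Set (Fin g → ℂ) :=
  {z | WithLp.toLp 2 (fun j => (z j).re) ∈ φ.1.target ∧
    XHat.param φ (WithLp.toLp 2 (fun j => (z j).re), WithLp.toLp 2 (fun j => (z j).im)) ∈ T}

/-- `T` is a complex submanifold of `X̂`. -/
def IsComplexSubmanifold (T : Set (XHat Λ)) : Prop :=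
  ∃ d : ℕ, ∀ φ : ActionChart Λ, IsSubmanifold ℂ ω d (inComplexChart T φ)

end Fibration

end TorusFibration

end

open TorusFibration

/-!
A rational subspace of `ℝ^g` is determined by finitely many integer vectors, so there are only
countably many of them, and a continuous family of rational subspaces is locally constant. Applied
to the vertical tangent spaces of the subtori `S_b`, this gives parallelism along paths in `f(S)`.
Near a point of `S` the vertical tangent space is then a fixed rational `W`; since `S` is
Lagrangian, in action coordinates its image is locally the affine space `x₀ + Wᗮ` and `S` is locally
`{(x, y(x) + w + n) | x ∈ x₀ + Wᗮ, w ∈ W, n ∈ ℤ^g}` for a smooth `y`.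

Over `ξ = (x, w)` the twisted relative complex is the de Rham complex of the torus
`W / (W ∩ ℤ^g)` with values in a flat line bundle, whose holonomy along `l ∈ W ∩ ℤ^g` is a constant
times `exp (2πi ⟨l, w⟩)`. If one of these holonomies is not `1`, integration along the corresponding
loop produces primitives and the stalk of `R^m` vanishes. If all of them are `1`, the parallel
section times the volume form of `W` is not exact, by Stokes' theorem on the torus. Hence the
support is locally cut out by `x ∈ x₀ + Wᗮ` and `w ∈ w₀ + Wᗮ`, which is the translate by
`x₀ + i w₀` of the complex subspace `Wᗮ ⊗ ℂ` in the coordinates `z = x + i w`.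
-/

noncomputable section

namespace TorusFibration

section IntLattice

variable {g : ℕ}

variable (g) in
/-- The standard lattice `ℤ^g` in `ℝ^g`. -/
def intLattice : Submodule ℤ (Coord g) :=
  Submodule.span ℤ (range (EuclideanSpace.basisFun (Fin g) ℝ).toBasis)

theorem mem_intLattice {y : Coord g} : y ∈ intLattice g ↔ ∀ j, ∃ n : ℤ, y j = n := by
  simp only [intLattice, Module.Basis.mem_span_iff_repr_mem, mem_range, eq_comm,
    OrthonormalBasis.coe_toBasis_repr_apply, EuclideanSpace.basisFun_repr, algebraMap_int_eq,
    eq_intCast]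

theorem mem_intLattice_iff_exists_toLp {y : Coord g} :
    y ∈ intLattice g ↔ ∃ n : Fin g → ℤ, y = WithLp.toLp 2 fun j => (n j : ℝ) := by
  rw [mem_intLattice, Classical.skolem]
  exact exists_congr fun n => ⟨fun h => by ext j; exact h j, fun h j => by rw [h]⟩

theorem single_mem_intLattice (j : Fin g) : EuclideanSpace.single j (1 : ℝ) ∈ intLattice g :=
  Submodule.subset_span ⟨j, by simp⟩

theorem exists_int_inner_eq {l n : Coord g} (hl : l ∈ intLattice g) (hn : n ∈ intLattice g) :
    ∃ k : ℤ, inner ℝ l n = k := by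
  obtain ⟨a, rfl⟩ := mem_intLattice_iff_exists_toLp.1 hl
  obtain ⟨c, rfl⟩ := mem_intLattice_iff_exists_toLp.1 hn
  exact ⟨∑ j, c j * a j, by simp [PiLp.inner_apply]⟩

theorem mem_intLattice_of_inner {w : Coord g}
    (h : ∀ l ∈ intLattice g, ∃ k : ℤ, inner ℝ l w = k) : w ∈ intLattice g := by
  refine mem_intLattice.2 fun j => ?_
  obtain ⟨k, hk⟩ := h _ (single_mem_intLattice j)
  exact ⟨k, by simpa [PiLp.inner_apply] using hk⟩

end IntLattice

section Coordinates

variable {g : ℕ} {B : Type*} [TopologicalSpace B] [ChartedSpace (Coord g) B]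

/-- The components of a vector in the frame `∂/∂x^1, …, ∂/∂x^g`. -/
def wcoord (φ : OpenPartialHomeomorph B (Coord g)) (b : B) : Tan g b →L[ℝ] Coord g :=
  mfderiv (𝓡 g) 𝓘(ℝ, Coord g) φ b

/-- The components of a covector in the frame `dx^1, …, dx^g`. -/
def ycoord (φ : OpenPartialHomeomorph B (Coord g)) (b : B) : Cot g b →ₗ[ℝ] Coord g where
  toFun α := (InnerProductSpace.toDual ℝ (Coord g)).symm (α.comp (wcoord φ b).inverse)
  map_add' α α' := by rw [ContinuousLinearMap.add_comp, map_add]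
  map_smul' c α := by
    rw [ContinuousLinearMap.smul_comp, map_smulₛₗ, conj_trivial, RingHom.id_apply]

/-- The map `y ↦ ∑ y_j dx^j`, as a linear map. -/
def cotₗ (φ : OpenPartialHomeomorph B (Coord g)) (b : B) : Coord g →ₗ[ℝ] Cot g b where
  toFun := cot φ b
  map_add' y y' := by
    ext v
    exact inner_add_left y y' (wcoord φ b v)
  map_smul' c y := by
    ext v
    exact inner_smul_left y (wcoord φ b v) c

variable {φ : OpenPartialHomeomorph B (Coord g)}

theorem cot_apply {b : B} (y : Coord g) (v : Tan g b) :
    cot φ b y v = inner ℝ y (wcoord φ b v) := rfl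

theorem cot_add (b : B) (y y' : Coord g) : cot φ b (y + y') = cot φ b y + cot φ b y' :=
  map_add (cotₗ φ b) y y'

theorem cot_smul (b : B) (c : ℝ) (y : Coord g) : cot φ b (c • y) = c • cot φ b y :=
  map_smul (cotₗ φ b) c y

theorem tan_add (x w w' : Coord g) : tan φ x (w + w') = tan φ x w + tan φ x w' :=
  map_add (mfderiv 𝓘(ℝ, Coord g) (𝓡 g) φ.symm x) w w'

theorem hasDerivAt_linearMap_comp {V W : Type*} [NormedAddCommGroup V] [NormedSpace ℝ V]
    [FiniteDimensional ℝ V] [NormedAddCommGroup W] [NormedSpace ℝ W] (f : V →ₗ[ℝ] W) {γ : ℝ → V}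
    {v : V} {t : ℝ} (h : HasDerivAt γ v t) : HasDerivAt (fun s => f (γ s)) (f v) t :=
  (LinearMap.toContinuousLinearMap f).hasFDerivAt.comp_hasDerivAt t h

theorem hasDerivAt_ycoord {b : B} {γ : ℝ → Cot g b} {v : Cot g b} {t : ℝ}
    (h : HasDerivAt γ v t) : HasDerivAt (fun s => ycoord φ b (γ s)) (ycoord φ b v) t :=
  hasDerivAt_linearMap_comp (V := Coord g →L[ℝ] ℝ) (ycoord φ b) h

theorem hasDerivAt_cot {b : B} {γ : ℝ → Coord g} {v : Coord g} {t : ℝ}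
    (h : HasDerivAt γ v t) : HasDerivAt (fun s => cot φ b (γ s)) (cot φ b v) t :=
  hasDerivAt_linearMap_comp (W := Coord g →L[ℝ] ℝ) (cotₗ φ b) h

theorem mdifferentiable_of_mem_maximalAtlas (hφ : φ ∈ IsManifold.maximalAtlas (𝓡 g) ∞ B) :
    φ.MDifferentiable (𝓡 g) 𝓘(ℝ, Coord g) :=
  ⟨(contMDiffOn_of_mem_maximalAtlas hφ).mdifferentiableOn (by simp),
    (contMDiffOn_symm_of_mem_maximalAtlas hφ).mdifferentiableOn (by simp)⟩

theorem wcoord_tan (hφ : φ ∈ IsManifold.maximalAtlas (𝓡 g) ∞ B) {x : Coord g}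
    (hx : x ∈ φ.target) (w : Coord g) : wcoord φ (φ.symm x) (tan φ x w) = w :=
  congrArg (fun f => f w) ((mdifferentiable_of_mem_maximalAtlas hφ).comp_symm_deriv hx)

theorem tan_wcoord (hφ : φ ∈ IsManifold.maximalAtlas (𝓡 g) ∞ B) {x : Coord g}
    (hx : x ∈ φ.target) (v : Tan g (φ.symm x)) : tan φ x (wcoord φ (φ.symm x) v) = v := by
  have h := (mdifferentiable_of_mem_maximalAtlas hφ).symm_comp_deriv (φ.map_target hx)
  rw [φ.right_inv hx] at h
  exact congrArg (fun f => f v) h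

theorem isInvertible_wcoord (hφ : φ ∈ IsManifold.maximalAtlas (𝓡 g) ∞ B) {b : B}
    (hb : b ∈ φ.source) : (wcoord φ b).IsInvertible :=
  ⟨(mdifferentiable_of_mem_maximalAtlas hφ).mfderiv hb, rfl⟩

theorem inner_ycoord (hφ : φ ∈ IsManifold.maximalAtlas (𝓡 g) ∞ B) {b : B} (hb : b ∈ φ.source)
    (α : Cot g b) (v : Tan g b) : inner ℝ (ycoord φ b α) (wcoord φ b v) = α v := by
  refine InnerProductSpace.toDual_symm_apply.trans ?_
  exact congrArg α ((isInvertible_wcoord hφ hb).inverse_apply_eq.2 rfl)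

theorem cot_ycoord (hφ : φ ∈ IsManifold.maximalAtlas (𝓡 g) ∞ B) {b : B} (hb : b ∈ φ.source)
    (α : Cot g b) : cot φ b (ycoord φ b α) = α := by
  ext v
  rw [cot_apply, inner_ycoord hφ hb]

theorem ycoord_cot (hφ : φ ∈ IsManifold.maximalAtlas (𝓡 g) ∞ B) {b : B} (hb : b ∈ φ.source)
    (y : Coord g) : ycoord φ b (cot φ b y) = y := by
  refine ext_inner_right ℝ fun w => ?_
  obtain ⟨v, rfl⟩ := (isInvertible_wcoord hφ hb).bijective.surjective w
  rw [inner_ycoord hφ hb, cot_apply]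

theorem cot_tan (hφ : φ ∈ IsManifold.maximalAtlas (𝓡 g) ∞ B) {x : Coord g} (hx : x ∈ φ.target)
    (y w : Coord g) : cot φ (φ.symm x) y (tan φ x w) = inner ℝ y w := by
  rw [cot_apply, wcoord_tan hφ hx]

end Coordinates

section Fibration

variable {g : ℕ} {B : Type*} [TopologicalSpace B] [ChartedSpace (Coord g) B]
  {Λ : LagrangianCovering g B}

theorem X.mk_eq_mk {b : B} {α α' : Cot g b} :
    (X.mk α : X Λ) = X.mk α' ↔ α' - α ∈ Λ.lattice b := by
  refine (Sigma.mk.inj_iff (β := fun b => Cot g b ⧸ Λ.lattice b)).trans ?_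
  simp [QuotientAddGroup.eq, sub_eq_neg_add]

theorem XHat.mk_eq_mk {b : B} {v v' : Tan g b} :
    (XHat.mk v : XHat Λ) = XHat.mk v' ↔ v' - v ∈ dualLattice Λ b := by
  refine (Sigma.mk.inj_iff (β := fun b => Tan g b ⧸ dualLattice Λ b)).trans ?_
  simp [QuotientAddGroup.eq, sub_eq_neg_add]

theorem mem_lattice_iff (φ : ActionChart Λ) {b : B} (hb : b ∈ φ.1.source) {α : Cot g b} :
    α ∈ Λ.lattice b ↔ ycoord φ.1 b α ∈ intLattice g := by
  rw [φ.2.2 b hb, mem_intLattice_iff_exists_toLp]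
  refine exists_congr fun n => ⟨fun h => ?_, fun h => ?_⟩
  · rw [h, ycoord_cot φ.2.1 hb]
  · rw [← h, cot_ycoord φ.2.1 hb]

theorem cot_mem_lattice (φ : ActionChart Λ) {b : B} (hb : b ∈ φ.1.source) {y : Coord g} :
    cot φ.1 b y ∈ Λ.lattice b ↔ y ∈ intLattice g := by
  rw [mem_lattice_iff φ hb, ycoord_cot φ.2.1 hb]

theorem mem_dualLattice_iff (φ : ActionChart Λ) {b : B} (hb : b ∈ φ.1.source) {v : Tan g b} :
    v ∈ dualLattice Λ b ↔ wcoord φ.1 b v ∈ intLattice g := by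
  constructor
  · exact fun h => mem_intLattice_of_inner fun l hl => h (cot φ.1 b l) ((cot_mem_lattice φ hb).2 hl)
  · intro h l hl
    rw [← inner_ycoord φ.2.1 hb]
    exact exists_int_inner_eq ((mem_lattice_iff φ hb).1 hl) h

theorem X.mk_eq_param (φ : ActionChart Λ) {b : B} (hb : b ∈ φ.1.source) (α : Cot g b) :
    (X.mk α : X Λ) = X.param φ (φ.1 b, ycoord φ.1 b α) := by
  obtain ⟨x, hx, rfl⟩ : ∃ x ∈ φ.1.target, φ.1.symm x = b :=
    ⟨φ.1 b, φ.1.map_source hb, φ.1.left_inv hb⟩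
  simp only [X.param]
  rw [φ.1.right_inv hx, cot_ycoord φ.2.1 hb]

theorem XHat.mk_eq_param (φ : ActionChart Λ) {b : B} (hb : b ∈ φ.1.source) (v : Tan g b) :
    (XHat.mk v : XHat Λ) = XHat.param φ (φ.1 b, wcoord φ.1 b v) := by
  obtain ⟨x, hx, rfl⟩ : ∃ x ∈ φ.1.target, φ.1.symm x = b :=
    ⟨φ.1 b, φ.1.map_source hb, φ.1.left_inv hb⟩
  simp only [XHat.param]
  rw [φ.1.right_inv hx, tan_wcoord φ.2.1 hx]

theorem X.param_eq_param (φ : ActionChart Λ) {x y y' : Coord g} (hx : x ∈ φ.1.target) :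
    X.param φ (x, y) = X.param φ (x, y') ↔ y' - y ∈ intLattice g := by
  simp only [X.param]
  rw [X.mk_eq_mk, mem_lattice_iff φ (φ.1.map_target hx), map_sub,
    ycoord_cot φ.2.1 (φ.1.map_target hx), ycoord_cot φ.2.1 (φ.1.map_target hx)]

theorem X.param_add_of_mem_intLattice (φ : ActionChart Λ) {x y n : Coord g}
    (hx : x ∈ φ.1.target) (hn : n ∈ intLattice g) :
    X.param φ (x, y + n) = X.param φ (x, y) :=
  (X.param_eq_param φ hx).2 (by simpa using neg_mem hn)

theorem XHat.param_eq_param (φ : ActionChart Λ) {p q : Coord g × Coord g}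
    (hp : p.1 ∈ φ.1.target) (hq : q.1 ∈ φ.1.target) :
    XHat.param φ p = XHat.param φ q ↔ p.1 = q.1 ∧ q.2 - p.2 ∈ intLattice g := by
  obtain ⟨x, w⟩ := p
  obtain ⟨x', w'⟩ := q
  have same_base : XHat.param φ (x, w) = XHat.param φ (x, w') ↔ w' - w ∈ intLattice g := by
    simp only [XHat.param]
    rw [XHat.mk_eq_mk, mem_dualLattice_iff φ (φ.1.map_target hp), map_sub,
      wcoord_tan φ.2.1 hp, wcoord_tan φ.2.1 hp]
  constructor
  · intro h
    obtain rfl : x = x' := φ.1.symm.injOn hp hq (congrArg Sigma.fst h)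
    exact ⟨rfl, same_base.1 h⟩
  · rintro ⟨h₁, h₂⟩
    obtain rfl : x = x' := h₁
    exact same_base.2 h₂

theorem XHat.param_add_of_mem_intLattice (φ : ActionChart Λ) {x w n : Coord g}
    (hx : x ∈ φ.1.target) (hn : n ∈ intLattice g) :
    XHat.param φ (x, w + n) = XHat.param φ (x, w) :=
  (XHat.param_eq_param φ hx hx).2 ⟨rfl, by simpa using neg_mem hn⟩

end Fibration

section Transition

variable {g : ℕ} {B : Type*} [TopologicalSpace B]
  {φ ψ : OpenPartialHomeomorph B (Coord g)}

theorem isOpen_transition_domain (ψ φ : OpenPartialHomeomorph B (Coord g)) :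
    IsOpen {x | x ∈ ψ.target ∧ ψ.symm x ∈ φ.source} :=
  ψ.symm.continuousOn.isOpen_inter_preimage ψ.open_target φ.open_source

variable [ChartedSpace (Coord g) B]

theorem contDiffOn_transition (hψ : ψ ∈ IsManifold.maximalAtlas (𝓡 g) ∞ B)
    (hφ : φ ∈ IsManifold.maximalAtlas (𝓡 g) ∞ B) :
    ContDiffOn ℝ ∞ (fun x => φ (ψ.symm x)) {x | x ∈ ψ.target ∧ ψ.symm x ∈ φ.source} := by
  rw [← contMDiffOn_iff_contDiffOn]
  refine (contMDiffOn_of_mem_maximalAtlas hφ).comp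
    ((contMDiffOn_symm_of_mem_maximalAtlas hψ).mono fun x hx => hx.1) fun x hx => hx.2

theorem contDiffOn_fderiv_transition (hψ : ψ ∈ IsManifold.maximalAtlas (𝓡 g) ∞ B)
    (hφ : φ ∈ IsManifold.maximalAtlas (𝓡 g) ∞ B) :
    ContDiffOn ℝ ∞ (fderiv ℝ (fun x => φ (ψ.symm x))) {x | x ∈ ψ.target ∧ ψ.symm x ∈ φ.source} :=
  (contDiffOn_transition hψ hφ).fderiv_of_isOpen (isOpen_transition_domain ψ φ) (by simp)

theorem wcoord_tan_eq_fderiv (hψ : ψ ∈ IsManifold.maximalAtlas (𝓡 g) ∞ B)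
    (hφ : φ ∈ IsManifold.maximalAtlas (𝓡 g) ∞ B) {x : Coord g} (hx : x ∈ ψ.target)
    (hx' : ψ.symm x ∈ φ.source) (w : Coord g) :
    wcoord φ (ψ.symm x) (tan ψ x w) = fderiv ℝ (fun x => φ (ψ.symm x)) x w := by
  have chain_rule := mfderiv_comp x
    ((mdifferentiable_of_mem_maximalAtlas hφ).mdifferentiableAt hx')
    ((mdifferentiable_of_mem_maximalAtlas hψ).mdifferentiableAt_symm hx)
  rw [mfderiv_eq_fderiv] at chain_rule
  exact (congrArg (fun f => f w) chain_rule).symm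

theorem ycoord_cot_apply_eq_inner_fderiv (hψ : ψ ∈ IsManifold.maximalAtlas (𝓡 g) ∞ B)
    (hφ : φ ∈ IsManifold.maximalAtlas (𝓡 g) ∞ B) {b : B} (hb : b ∈ φ.source) (hb' : b ∈ ψ.source)
    (y : Coord g) (j : Fin g) :
    ycoord φ b (cot ψ b y) j = inner ℝ y
      (fderiv ℝ (fun x => ψ (φ.symm x)) (φ b) (EuclideanSpace.single j 1)) := by
  obtain ⟨x, hx, rfl⟩ : ∃ x ∈ φ.target, φ.symm x = b := ⟨φ b, φ.map_source hb, φ.left_inv hb⟩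
  rw [φ.right_inv hx, ← wcoord_tan_eq_fderiv hφ hψ hx hb', ← cot_apply,
    ← inner_ycoord hφ hb, wcoord_tan hφ hx]
  simp [PiLp.inner_apply]

theorem contDiffOn_wcoord_tan (hψ : ψ ∈ IsManifold.maximalAtlas (𝓡 g) ∞ B)
    (hφ : φ ∈ IsManifold.maximalAtlas (𝓡 g) ∞ B) :
    ContDiffOn ℝ ∞ (fun p : Coord g × Coord g => wcoord φ (ψ.symm p.1) (tan ψ p.1 p.2))
      {p | p.1 ∈ ψ.target ∧ ψ.symm p.1 ∈ φ.source} := by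
  have hfderiv : ContDiffOn ℝ ∞ (fun p : Coord g × Coord g =>
      fderiv ℝ (fun x => φ (ψ.symm x)) p.1 p.2)
      {p | p.1 ∈ ψ.target ∧ ψ.symm p.1 ∈ φ.source} :=
    ((contDiffOn_fderiv_transition hψ hφ).comp contDiffOn_fst fun p hp => hp).clm_apply
      contDiffOn_snd
  exact hfderiv.congr fun p hp => wcoord_tan_eq_fderiv hψ hφ hp.1 hp.2 p.2

theorem contDiffOn_ycoord_cot (hψ : ψ ∈ IsManifold.maximalAtlas (𝓡 g) ∞ B)
    (hφ : φ ∈ IsManifold.maximalAtlas (𝓡 g) ∞ B) :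
    ContDiffOn ℝ ∞ (fun p : Coord g × Coord g => ycoord φ (ψ.symm p.1) (cot ψ (ψ.symm p.1) p.2))
      {p | p.1 ∈ ψ.target ∧ ψ.symm p.1 ∈ φ.source} := by
  refine contDiffOn_euclidean.2 fun j => ?_
  have hbase : ContDiffOn ℝ ∞ (fun p : Coord g × Coord g => φ (ψ.symm p.1))
      {p | p.1 ∈ ψ.target ∧ ψ.symm p.1 ∈ φ.source} :=
    (contDiffOn_transition hψ hφ).comp contDiffOn_fst fun p hp => hp
  have hinner : ContDiffOn ℝ ∞ (fun p : Coord g × Coord g => inner ℝ p.2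
      (fderiv ℝ (fun x => ψ (φ.symm x)) (φ (ψ.symm p.1)) (EuclideanSpace.single j 1)))
      {p | p.1 ∈ ψ.target ∧ ψ.symm p.1 ∈ φ.source} := by
    refine contDiffOn_snd.inner ℝ (((contDiffOn_fderiv_transition hφ hψ).comp hbase ?_).clm_apply
      contDiffOn_const)
    intro p hp
    refine ⟨φ.map_source hp.2, ?_⟩
    rw [φ.left_inv hp.2]
    exact ψ.map_target hp.1
  exact hinner.congr fun p hp =>
    ycoord_cot_apply_eq_inner_fderiv hψ hφ hp.2 (ψ.map_target hp.1) p.2 j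

variable {V : Type*} [NormedAddCommGroup V] [NormedSpace ℝ V] {f v : V → Coord g} {p : V}

theorem contDiffAt_wcoord_tan (hψ : ψ ∈ IsManifold.maximalAtlas (𝓡 g) ∞ B)
    (hφ : φ ∈ IsManifold.maximalAtlas (𝓡 g) ∞ B) (hf : ContDiffAt ℝ ∞ f p)
    (hv : ContDiffAt ℝ ∞ v p) (hp : f p ∈ ψ.target) (hp' : ψ.symm (f p) ∈ φ.source) :
    ContDiffAt ℝ ∞ (fun q => wcoord φ (ψ.symm (f q)) (tan ψ (f q) (v q))) p := by
  have hmem : {q : Coord g × Coord g | q.1 ∈ ψ.target ∧ ψ.symm q.1 ∈ φ.source} ∈ 𝓝 (f p, v p) :=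
    ((isOpen_transition_domain ψ φ).preimage continuous_fst).mem_nhds ⟨hp, hp'⟩
  exact ContDiffAt.comp (g := fun q : Coord g × Coord g => wcoord φ (ψ.symm q.1) (tan ψ q.1 q.2))
    (f := fun q => (f q, v q)) p ((contDiffOn_wcoord_tan hψ hφ).contDiffAt hmem) (hf.prodMk hv)

theorem contDiffAt_ycoord_cot (hψ : ψ ∈ IsManifold.maximalAtlas (𝓡 g) ∞ B)
    (hφ : φ ∈ IsManifold.maximalAtlas (𝓡 g) ∞ B) (hf : ContDiffAt ℝ ∞ f p)
    (hv : ContDiffAt ℝ ∞ v p) (hp : f p ∈ ψ.target) (hp' : ψ.symm (f p) ∈ φ.source) :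
    ContDiffAt ℝ ∞ (fun q => ycoord φ (ψ.symm (f q)) (cot ψ (ψ.symm (f q)) (v q))) p := by
  have hmem : {q : Coord g × Coord g | q.1 ∈ ψ.target ∧ ψ.symm q.1 ∈ φ.source} ∈ 𝓝 (f p, v p) :=
    ((isOpen_transition_domain ψ φ).preimage continuous_fst).mem_nhds ⟨hp, hp'⟩
  exact ContDiffAt.comp
    (g := fun q : Coord g × Coord g => ycoord φ (ψ.symm q.1) (cot ψ (ψ.symm q.1) q.2))
    (f := fun q => (f q, v q)) p ((contDiffOn_ycoord_cot hψ hφ).contDiffAt hmem) (hf.prodMk hv)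

end Transition

section Topology

variable {g : ℕ} {B : Type*} [TopologicalSpace B]

theorem isOpen_preimage_val_iff (φ : OpenPartialHomeomorph B (Coord g))
    {O : Set (Coord g × Coord g)} :
    IsOpen ((fun p : {p : Coord g × Coord g // p.1 ∈ φ.target} => p.1) ⁻¹' O) ↔
      IsOpen {p | p.1 ∈ φ.target ∧ p ∈ O} := by
  have htarget : IsOpen {p : Coord g × Coord g | p.1 ∈ φ.target} :=
    φ.open_target.preimage continuous_fst
  rw [htarget.isOpenEmbedding_subtypeVal.isOpen_iff_image_isOpen]
  change IsOpen (Subtype.val '' (Subtype.val ⁻¹' O)) ↔ _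
  rw [Subtype.image_preimage_val]
  rfl

variable [ChartedSpace (Coord g) B] {Λ : LagrangianCovering g B}

theorem X.isOpen_iff {U : Set (X Λ)} :
    IsOpen U ↔ ∀ φ : ActionChart Λ, IsOpen {p | p.1 ∈ φ.1.target ∧ X.param φ p ∈ U} := by
  simp only [isOpen_iSup_iff, isOpen_coinduced]
  exact forall_congr' fun φ => isOpen_preimage_val_iff φ.1 (O := X.param φ ⁻¹' U)

theorem XHat.isOpen_iff {U : Set (XHat Λ)} :
    IsOpen U ↔ ∀ φ : ActionChart Λ, IsOpen {p | p.1 ∈ φ.1.target ∧ XHat.param φ p ∈ U} := by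
  simp only [isOpen_iSup_iff, isOpen_coinduced]
  exact forall_congr' fun φ => isOpen_preimage_val_iff φ.1 (O := XHat.param φ ⁻¹' U)

theorem X.continuousOn_param (φ : ActionChart Λ) :
    ContinuousOn (X.param φ) {p | p.1 ∈ φ.1.target} :=
  (continuousOn_open_iff (φ.1.open_target.preimage continuous_fst)).2 fun _ hU =>
    X.isOpen_iff.1 hU φ

theorem XHat.continuousOn_param (φ : ActionChart Λ) :
    ContinuousOn (XHat.param φ) {p | p.1 ∈ φ.1.target} :=
  (continuousOn_open_iff (φ.1.open_target.preimage continuous_fst)).2 fun _ hU =>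
    XHat.isOpen_iff.1 hU φ

theorem XHat.continuous_proj : Continuous (fun ξ : XHat Λ => ξ.1) := by
  refine ⟨fun O hO => XHat.isOpen_iff.2 fun φ => ?_⟩
  exact (φ.1.symm.continuousOn.isOpen_inter_preimage φ.1.open_target hO).preimage continuous_fst

/-- The change of coordinates on `X̂` from the coordinates `(x, w)` of `ψ` to those of `φ`. -/
def hatTransition (ψ φ : OpenPartialHomeomorph B (Coord g)) (p : Coord g × Coord g) :
    Coord g × Coord g :=
  (φ (ψ.symm p.1), wcoord φ (ψ.symm p.1) (tan ψ p.1 p.2))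

theorem continuousOn_hatTransition {φ ψ : OpenPartialHomeomorph B (Coord g)}
    (hψ : ψ ∈ IsManifold.maximalAtlas (𝓡 g) ∞ B) (hφ : φ ∈ IsManifold.maximalAtlas (𝓡 g) ∞ B) :
    ContinuousOn (hatTransition ψ φ) {p | p.1 ∈ ψ.target ∧ ψ.symm p.1 ∈ φ.source} :=
  ((contDiffOn_transition hψ hφ).continuousOn.comp continuous_fst.continuousOn
    fun _ hp => hp).prodMk (contDiffOn_wcoord_tan hψ hφ).continuousOn

theorem XHat.param_hatTransition (φ ψ : ActionChart Λ) {p : Coord g × Coord g}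
    (hp : ψ.1.symm p.1 ∈ φ.1.source) :
    XHat.param φ (hatTransition ψ.1 φ.1 p) = XHat.param ψ p :=
  (XHat.mk_eq_param φ hp _).symm

theorem XHat.param_mem_image_param (φ ψ : ActionChart Λ) {O : Set (Coord g × Coord g)}
    (hO : ∀ q ∈ O, q.1 ∈ φ.1.target) {p : Coord g × Coord g} :
    XHat.param ψ p ∈ XHat.param φ '' O ↔ ψ.1.symm p.1 ∈ φ.1.source ∧
      ∃ n ∈ intLattice g, hatTransition ψ.1 φ.1 p + (0, n) ∈ O := by
  constructor
  · rintro ⟨q, hq, hqp⟩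
    have hbase : φ.1.symm q.1 = ψ.1.symm p.1 := congrArg Sigma.fst hqp
    have hsource : ψ.1.symm p.1 ∈ φ.1.source := hbase ▸ φ.1.map_target (hO q hq)
    rw [← XHat.param_hatTransition φ ψ hsource,
      XHat.param_eq_param φ (hO q hq) (φ.1.map_source hsource)] at hqp
    have hsub : hatTransition ψ.1 φ.1 p + (0, -((hatTransition ψ.1 φ.1 p).2 - q.2)) = q :=
      Prod.ext (by simp [hqp.1]) (by simp)
    exact ⟨hsource, _, neg_mem hqp.2, hsub.symm ▸ hq⟩
  · rintro ⟨hsource, n, hn, hO'⟩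
    refine ⟨_, hO', ?_⟩
    rw [← XHat.param_hatTransition φ ψ hsource,
      XHat.param_eq_param φ (hO _ hO') (φ.1.map_source hsource)]
    exact ⟨by simp, by simpa using hn⟩

theorem XHat.isOpen_image_param (φ : ActionChart Λ) {O : Set (Coord g × Coord g)}
    (hO : IsOpen O) (hO' : ∀ p ∈ O, p.1 ∈ φ.1.target) : IsOpen (XHat.param φ '' O) := by
  refine XHat.isOpen_iff.2 fun ψ => ?_
  have hpreimage : {p : Coord g × Coord g | p.1 ∈ ψ.1.target ∧ XHat.param ψ p ∈ XHat.param φ '' O} =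
      ⋃ n ∈ intLattice g, {p | p.1 ∈ ψ.1.target ∧ ψ.1.symm p.1 ∈ φ.1.source} ∩
        (fun p => hatTransition ψ.1 φ.1 p + (0, n)) ⁻¹' O := by
    ext p
    simp only [XHat.param_mem_image_param φ ψ hO', mem_iUnion, mem_inter_iff, mem_ofPred_eq,
      mem_preimage, exists_prop]
    tauto
  rw [hpreimage]
  exact isOpen_biUnion fun n _ =>
    ((continuousOn_hatTransition ψ.2.1 φ.2.1).add continuousOn_const).isOpen_inter_preimage
      ((isOpen_transition_domain ψ.1 φ.1).preimage continuous_fst) hO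

end Topology

section OrthogonalProjection

variable {E : Type*} [NormedAddCommGroup E] [InnerProductSpace ℝ E] {W : Submodule ℝ E}
  [W.HasOrthogonalProjection] {x y : E}

theorem starProjection_orthogonal_eq_zero_iff : Wᗮ.starProjection x = 0 ↔ x ∈ W := by
  rw [Submodule.starProjection_apply_eq_zero_iff, Submodule.orthogonal_orthogonal]

theorem starProjection_orthogonal_eq_iff :
    Wᗮ.starProjection x = Wᗮ.starProjection y ↔ x - y ∈ W := by
  rw [← sub_eq_zero, ← map_sub, starProjection_orthogonal_eq_zero_iff]

theorem starProjection_orthogonal_add_of_mem (h : y ∈ W) :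
    Wᗮ.starProjection (x + y) = Wᗮ.starProjection x :=
  starProjection_orthogonal_eq_iff.2 (by rwa [add_sub_cancel_left])

end OrthogonalProjection

section Rational

variable {g : ℕ} {W : Submodule ℝ (Coord g)}

/-- A subspace of `ℝ^g` is rational if it is spanned by integral vectors. -/
def IsRational (W : Submodule ℝ (Coord g)) : Prop :=
  Submodule.span ℝ ((W : Set (Coord g)) ∩ (intLattice g : Set (Coord g))) = W

theorem IsRational.exists_basis (hW : IsRational W) {m : ℕ} (hm : Module.finrank ℝ W = m) :
    ∃ l : Fin m → Coord g, (∀ j, l j ∈ W) ∧ (∀ j, l j ∈ intLattice g) ∧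
      LinearIndependent ℝ l ∧ Submodule.span ℝ (range l) = W := by
  obtain ⟨b, hb, hspan, hli⟩ :=
    exists_linearIndependent ℝ ((W : Set (Coord g)) ∩ (intLattice g : Set (Coord g)))
  rw [hW] at hspan
  have := hli.setFinite.fintype
  have hcard : Fintype.card b = m := by
    rw [← hm, ← hspan, finrank_span_set_eq_card hli, Set.toFinset_card]
  let e := (Fintype.equivFinOfCardEq hcard).symm
  have hrange : range (Subtype.val ∘ e) = b := by rw [e.surjective.range_comp, Subtype.range_coe]
  exact ⟨Subtype.val ∘ e, fun j => (hb (e j).2).1, fun j => (hb (e j).2).2,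
    hli.comp e e.injective, by rw [hrange, hspan]⟩

theorem countable_isRational : {W : Submodule ℝ (Coord g) | IsRational W}.Countable := by
  have : Countable (intLattice g) := by unfold intLattice; infer_instance
  refine (countable_iUnion fun m : ℕ => countable_range fun l : Fin m → intLattice g =>
    Submodule.span ℝ (range fun j => (l j : Coord g))).mono fun W hW => ?_
  obtain ⟨l, -, hl, -, hspan⟩ := IsRational.exists_basis hW rfl
  exact mem_iUnion.2 ⟨_, fun j => ⟨l j, hl j⟩, hspan⟩

theorem IsRational.exists_norm_sub_le (hW : IsRational W) :
    ∃ R : ℝ, ∀ x ∈ W, ∃ k ∈ W, k ∈ intLattice g ∧ ‖x - k‖ ≤ R := by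
  obtain ⟨l, hlW, hl, -, hspan⟩ := hW.exists_basis rfl
  refine ⟨∑ j, ‖l j‖, fun x hx => ?_⟩
  rw [← hspan] at hx
  obtain ⟨c, rfl⟩ := Submodule.mem_span_range_iff_exists_fun ℝ |>.1 hx
  refine ⟨∑ j, ⌊c j⌋ • l j, sum_mem fun j _ => zsmul_mem (hlW j) _,
    sum_mem fun j _ => zsmul_mem (hl j) _, ?_⟩
  simp only [← Finset.sum_sub_distrib, ← Int.cast_smul_eq_zsmul ℝ, ← sub_smul,
    Int.self_sub_floor]
  refine (norm_sum_le _ _).trans (Finset.sum_le_sum fun j _ => ?_)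
  rw [norm_smul, Real.norm_of_nonneg (Int.fract_nonneg _)]
  exact mul_le_of_le_one_left (norm_nonneg _) (Int.fract_lt_one _).le

theorem IsRational.exists_norm_lt_imp_mem (hW : IsRational W) :
    ∃ ε > 0, ∀ n ∈ intLattice g, ‖Wᗮ.starProjection n‖ < ε → n ∈ W := by
  obtain ⟨R, hR⟩ := hW.exists_norm_sub_le
  have hfin : ({n : Coord g | n ∉ W} ∩ Metric.closedBall 0 (R + 1) ∩ intLattice g).Finite :=
    ZSpan.setFinite_inter _ (Metric.isBounded_closedBall.subset inter_subset_right)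
  have hlower : ∀ᶠ ε in 𝓝[>] (0 : ℝ), ∀ n ∈ {n : Coord g | n ∉ W} ∩
      Metric.closedBall 0 (R + 1) ∩ intLattice g, ε < ‖Wᗮ.starProjection n‖ := by
    rw [eventually_all_finite hfin]
    intro n hn
    have : 0 < ‖Wᗮ.starProjection n‖ :=
      norm_pos_iff.2 fun h => hn.1.1 (starProjection_orthogonal_eq_zero_iff.1 h)
    exact mem_nhdsWithin_of_mem_nhds (Iio_mem_nhds this)
  obtain ⟨ε, ⟨hlower, hε₁⟩, hε₀⟩ := (hlower.and
    (mem_nhdsWithin_of_mem_nhds (Iio_mem_nhds one_pos))).and self_mem_nhdsWithin |>.exists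
  refine ⟨ε, hε₀, fun n hn hlt => ?_⟩
  obtain ⟨k, hkW, hk, hkR⟩ := hR _ (W.starProjection_apply_mem n)
  have hproj : Wᗮ.starProjection (n - k) = Wᗮ.starProjection n :=
    starProjection_orthogonal_eq_iff.2 (by simpa using hkW)
  have hnorm : ‖n - k‖ ≤ R + 1 := by
    have hdecomp : n - k = (W.starProjection n - k) + Wᗮ.starProjection n := by
      rw [Submodule.starProjection_orthogonal_val]; abel
    rw [hdecomp]
    exact (norm_add_le _ _).trans (add_le_add hkR (hlt.trans hε₁).le)
  by_contra hnW
  have hmem : n - k ∉ W := fun h => hnW (by simpa using add_mem h hkW)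
  have := hlower (n - k) ⟨⟨hmem, mem_closedBall_zero_iff.2 hnorm⟩, sub_mem hn hk⟩
  rw [hproj] at this
  exact this.not_gt hlt

theorem IsRational.eventually_mem (hW : IsRational W) {Y : Type*} {l : Filter Y}
    {γ : Y → Coord g} {y : Coord g} (hγ : Tendsto γ l (𝓝 y))
    (h : ∀ᶠ t in l, ∃ n ∈ intLattice g, γ t - y - n ∈ W) : ∀ᶠ t in l, γ t - y ∈ W := by
  obtain ⟨ε, hε, hmem⟩ := hW.exists_norm_lt_imp_mem
  have hlim : Tendsto (fun t => ‖Wᗮ.starProjection (γ t - y)‖) l (𝓝 0) := by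
    simpa using ((Wᗮ.starProjection.continuous.tendsto _).comp (hγ.sub_const y)).norm
  filter_upwards [h, hlim.eventually_lt_const hε] with t ⟨n, hn, hnW⟩ ht
  rw [starProjection_orthogonal_eq_iff.2 hnW] at ht
  simpa using add_mem hnW (hmem n hn ht)

theorem IsRational.deriv_mem (hW : IsRational W) {γ : ℝ → Coord g} {v : Coord g}
    (hγ : HasDerivAt γ v 0)
    (h : ∀ᶠ t in 𝓝 (0 : ℝ), ∃ n ∈ intLattice g, γ t - γ 0 - n ∈ W) : v ∈ W := by
  have hconst : (fun t => Wᗮ.starProjection (γ t)) =ᶠ[𝓝 0] fun _ => Wᗮ.starProjection (γ 0) := by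
    filter_upwards [hW.eventually_mem hγ.continuousAt h] with t ht
    exact starProjection_orthogonal_eq_iff.2 ht
  have hderiv : HasDerivAt (fun t => Wᗮ.starProjection (γ t)) (Wᗮ.starProjection v) 0 :=
    Wᗮ.starProjection.hasFDerivAt.comp_hasDerivAt 0 hγ
  exact starProjection_orthogonal_eq_zero_iff.1
    (hderiv.unique ((hasDerivAt_const 0 _).congr_of_eventuallyEq hconst))

end Rational

section Parametrization

variable {E V : Type*} [NormedAddCommGroup E] [NormedSpace ℝ E] [NormedAddCommGroup V]
  [NormedSpace ℝ V]

theorem injective_fderiv_of_comp_eventuallyEq {V' : Type*} [NormedAddCommGroup V']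
    [NormedSpace ℝ V'] {ψ : E → V} {Φ : V → V'} {ι : E →L[ℝ] V'} {q : E}
    (hψ : DifferentiableAt ℝ ψ q) (hΦ : DifferentiableAt ℝ Φ (ψ q)) (h : Φ ∘ ψ =ᶠ[𝓝 q] ι)
    (hι : Function.Injective ι) : Function.Injective (fderiv ℝ ψ q) := by
  have hcomp : (fderiv ℝ Φ (ψ q)).comp (fderiv ℝ ψ q) = ι :=
    (hΦ.hasFDerivAt.comp q hψ.hasFDerivAt).unique (ι.hasFDerivAt.congr_of_eventuallyEq h)
  exact .of_comp (f := fderiv ℝ Φ (ψ q)) (by rwa [← ContinuousLinearMap.coe_comp, hcomp])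

theorem IsSubmanifold.exists_parametrization {d : ℕ} {M : Set V} (hM : IsSubmanifold ℝ ∞ d M)
    {p : V} (hp : p ∈ M) :
    ∃ (F : Submodule ℝ V) (ψ : F → V) (q₀ : F), Module.finrank ℝ F = d ∧ ψ q₀ = p ∧
      (∀ᶠ q in 𝓝 q₀, ψ q ∈ M ∧ ContDiffAt ℝ ∞ ψ q ∧ Function.Injective (fderiv ℝ ψ q)) ∧
      𝓝[M] p ≤ map ψ (𝓝 q₀) := by
  obtain ⟨Φ, F, hpΦ, hΦ, hΦs, hF, hMF⟩ := hM p hp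
  have hmem : ∀ p' ∈ M ∩ Φ.source, Φ p' ∈ Φ.target ∩ (F : Set V) := fun p' hp' =>
    hMF ▸ mem_image_of_mem Φ hp'
  have htarget : IsOpen {q : F | (q : V) ∈ Φ.target} :=
    Φ.open_target.preimage continuous_subtype_val
  have hψ : ContDiffOn ℝ ∞ (fun q : F => Φ.symm (q : V)) {q : F | (q : V) ∈ Φ.target} :=
    hΦs.comp F.subtypeL.contDiff.contDiffOn fun _ hq => hq
  refine ⟨F, fun q => Φ.symm q, ⟨Φ p, (hmem p ⟨hp, hpΦ⟩).2⟩, hF, Φ.left_inv hpΦ, ?_, ?_⟩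
  · filter_upwards [htarget.mem_nhds (Φ.map_source hpΦ)] with q hq
    have hψq := hψ.contDiffAt (htarget.mem_nhds hq)
    refine ⟨?_, hψq, injective_fderiv_of_comp_eventuallyEq (Φ := Φ) (ι := F.subtypeL)
      (hψq.differentiableAt (by simp))
      ((hΦ.contDiffAt (Φ.open_source.mem_nhds (Φ.map_target hq))).differentiableAt (by simp))
      ?_ Subtype.val_injective⟩
    · obtain ⟨p', hp', hpq⟩ : (q : V) ∈ Φ '' (M ∩ Φ.source) := hMF ▸ ⟨hq, q.2⟩
      rw [← hpq, Φ.left_inv hp'.2]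
      exact hp'.1
    · filter_upwards [htarget.mem_nhds hq] with q' hq' using Φ.right_inv hq'
  · intro s hs
    rw [mem_map, nhds_subtype_eq_comap] at hs
    obtain ⟨t, ht, hts⟩ := mem_comap.1 hs
    filter_upwards [self_mem_nhdsWithin, mem_nhdsWithin_of_mem_nhds
      ((Φ.continuousAt hpΦ).preimage_mem_nhds ht), mem_nhdsWithin_of_mem_nhds
      (Φ.open_source.mem_nhds hpΦ)] with p' hp'M hp't hp's
    have := @hts ⟨Φ p', (hmem p' ⟨hp'M, hp's⟩).2⟩ hp't
    rwa [mem_preimage, Φ.left_inv hp's] at this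

theorem fderiv_mem_tangentVectors {M : Set V} {ψ : E → V} {q : E}
    (hψ : DifferentiableAt ℝ ψ q) (hM : ∀ᶠ q' in 𝓝 q, ψ q' ∈ M) (u : E) :
    fderiv ℝ ψ q u ∈ tangentVectors M (ψ q) := by
  have hline : HasDerivAt (fun t : ℝ => q + t • u) u 0 := by
    simpa using ((hasDerivAt_id (0 : ℝ)).smul_const u).const_add q
  have hcont : Tendsto (fun t : ℝ => q + t • u) (𝓝 0) (𝓝 q) := by
    simpa using hline.continuousAt.tendsto
  refine ⟨fun t => ψ (q + t • u), by simp, hcont.eventually hM, ?_⟩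
  exact HasFDerivAt.comp_hasDerivAt 0 (by simpa using hψ.hasFDerivAt) hline

end Parametrization

section ConstantRange

theorem eq_of_range_eq_of_leftInverse {E R : Type*} {π : E → R} {G G' : R → E}
    (hG : Function.LeftInverse π G) (hG' : Function.LeftInverse π G')
    (h : range G = range G') : G = G' := by
  ext v
  obtain ⟨v', hv'⟩ : G v ∈ range G' := h ▸ mem_range_self v
  rw [← hv', ← hG' v', hv', hG v]

variable {Y F E : Type*} [TopologicalSpace Y] [NormedAddCommGroup F] [NormedSpace ℝ F]
  [NormedAddCommGroup E] [InnerProductSpace ℝ E] [FiniteDimensional ℝ E] {A : Y → F →L[ℝ] E}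
  {q₀ : Y}

/-- The range of `A q`, for `q` near `q₀`, is the graph of a map from the range `R` of `A q₀` to
`Rᗮ`; here the graph is parametrized by `R`. -/
theorem exists_eventually_leftInverse_range_eq (hA : ∀ᶠ q in 𝓝 q₀, ContinuousAt A q)
    (hrank : ∀ᶠ q in 𝓝 q₀, Module.finrank ℝ (A q).range = Module.finrank ℝ (A q₀).range) :
    ∃ G : Y → (A q₀).range →L[ℝ] E, ∀ᶠ q in 𝓝 q₀, ContinuousAt G q ∧
      Function.LeftInverse (A q₀).range.orthogonalProjectionOnto (G q) ∧
      (G q).range = (A q).range := by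
  set R := (A q₀).range
  obtain ⟨j₀, hj₀⟩ := (A q₀).toLinearMap.rangeRestrict.exists_rightInverse_of_surjective
    (LinearMap.range_rangeRestrict _)
  let j : R →L[ℝ] F := LinearMap.toContinuousLinearMap j₀
  have hj : ∀ v : R, A q₀ (j v) = v := fun v =>
    congrArg Subtype.val (congrArg (fun f : R →ₗ[ℝ] R => f v) hj₀)
  let H : Y → R →L[ℝ] R := fun q => R.orthogonalProjectionOnto ∘L (A q ∘L j)
  have hH : ∀ q, ContinuousAt A q → ContinuousAt H q := fun q hq =>
    continuousAt_const.clm_comp (hq.clm_comp continuousAt_const)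
  have hH₀ : H q₀ = 1 := by
    ext v
    simp [H, hj]
  have hunit : ∀ᶠ q in 𝓝 q₀, IsUnit (H q) :=
    (hH q₀ hA.self_of_nhds).preimage_mem_nhds
      ((Units.isOpen (R := R →L[ℝ] R)).mem_nhds (hH₀ ▸ isUnit_one))
  refine ⟨fun q => (A q ∘L j) ∘L Ring.inverse (H q), ?_⟩
  filter_upwards [hA, hrank, hunit] with q hAq hrankq hHq
  have hleft : Function.LeftInverse R.orthogonalProjectionOnto
      ((A q ∘L j) ∘L Ring.inverse (H q)) := fun v =>
    congrArg (fun f : R →L[ℝ] R => f v) (Ring.mul_inverse_cancel _ hHq)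
  refine ⟨(hAq.clm_comp continuousAt_const).clm_comp ?_, hleft, ?_⟩
  · obtain ⟨u, hu⟩ := hHq
    exact ContinuousAt.comp (g := Ring.inverse)
      (hu ▸ NormedRing.inverse_continuousAt (R := R →L[ℝ] R) u) (hH q hAq)
  · refine Submodule.eq_of_le_of_finrank_eq ?_ ?_
    · rintro _ ⟨v, rfl⟩
      exact ⟨j (Ring.inverse (H q) v), rfl⟩
    · rw [hrankq]
      exact LinearMap.finrank_range_of_inj hleft.injective

theorem eventually_range_eq [LocallyConnectedSpace Y] (hA : ∀ᶠ q in 𝓝 q₀, ContinuousAt A q)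
    (hrank : ∀ᶠ q in 𝓝 q₀, Module.finrank ℝ (A q).range = Module.finrank ℝ (A q₀).range)
    {C : Set (Submodule ℝ E)} (hC : C.Countable) (hAC : ∀ᶠ q in 𝓝 q₀, (A q).range ∈ C) :
    ∀ᶠ q in 𝓝 q₀, (A q).range = (A q₀).range := by
  obtain ⟨G, hG⟩ := exists_eventually_leftInverse_range_eq hA hrank
  obtain ⟨U, ⟨hUo, hq₀, hU⟩, hUG⟩ :=
    (LocallyConnectedSpace.open_connected_basis q₀).mem_iff.1 (hG.and hAC)
  have hcont : ContinuousOn G U := fun q hq => (hUG hq).1.1.continuousWithinAt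
  have hinj : InjOn (fun f : (A q₀).range →L[ℝ] E => f.range) (G '' U) := by
    rintro _ ⟨q, hq, rfl⟩ _ ⟨q', hq', rfl⟩ h
    exact DFunLike.coe_injective (eq_of_range_eq_of_leftInverse (hUG hq).1.2.1 (hUG hq').1.2.1
      (congrArg ((↑) : Submodule ℝ E → Set E) h))
  have hcount : (G '' U).Countable := by
    refine MapsTo.countable_of_injOn (t := C) ?_ hinj hC
    rintro _ ⟨q, hq, rfl⟩
    exact (congrArg (· ∈ C) (hUG hq).1.2.2).mpr (hUG hq).2
  have hsub : (G '' U).Subsingleton :=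
    hcount.isTotallyDisconnected _ subset_rfl (hU.isPreconnected.image G hcont)
  filter_upwards [hUo.mem_nhds hq₀] with q hq
  have hGq := congrArg (fun f : (A q₀).range →L[ℝ] E => f.range)
    (hsub (mem_image_of_mem G hq) (mem_image_of_mem G hq₀))
  exact ((hUG hq).1.2.2.symm.trans hGq).trans (hUG hq₀).1.2.2

end ConstantRange

section LocalStructure

variable {g : ℕ} {M : Set (Coord g × Coord g)} {W : Submodule ℝ (Coord g)} {m : ℕ}

/-- The fibre of `M ⊂ ℝ^g × ℝ^g` through `p` is a translate of `W + ℤ^g`, i.e. the preimage of an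
affine subtorus of `ℝ^g / ℤ^g` with tangent space `W`. -/
def HasDirection (M : Set (Coord g × Coord g)) (W : Submodule ℝ (Coord g))
    (p : Coord g × Coord g) : Prop :=
  ∀ y, (p.1, y) ∈ M ↔ ∃ n ∈ intLattice g, y - p.2 - n ∈ W

theorem HasDirection.translate {p : Coord g × Coord g} (h : HasDirection M W p) {y : Coord g}
    (hy : (p.1, y) ∈ M) : HasDirection M W (p.1, y) := by
  obtain ⟨n, hn, hnW⟩ := (h y).1 hy
  intro y'
  rw [h y']
  refine ⟨fun ⟨k, hk, hkW⟩ => ⟨k - n, sub_mem hk hn, ?_⟩,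
    fun ⟨k, hk, hkW⟩ => ⟨k + n, add_mem hk hn, ?_⟩⟩
  · convert sub_mem hkW hnW using 1
    abel
  · convert add_mem hkW hnW using 1
    dsimp only
    abel

theorem HasDirection.mk_mem_tangentVectors {p : Coord g × Coord g} (h : HasDirection M W p)
    {w : Coord g} (hw : w ∈ W) : ((0, w) : Coord g × Coord g) ∈ tangentVectors M p := by
  refine ⟨fun t => (p.1, p.2 + t • w), by simp, Eventually.of_forall fun t => ?_, ?_⟩
  · exact (h _).2 ⟨0, zero_mem _, by simpa using W.smul_mem t hw⟩
  · refine (hasDerivAt_const (0 : ℝ) p.1).prodMk ?_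
    simpa using ((hasDerivAt_id (0 : ℝ)).smul_const w).const_add p.2

theorem HasDirection.snd_mem {p : Coord g × Coord g} (hW : IsRational W) (h : HasDirection M W p)
    {u : Coord g × Coord g} (hu : u ∈ tangentVectors (M ∩ {q | q.1 = p.1}) p) : u.2 ∈ W := by
  obtain ⟨γ, hγ₀, hγ, hγ'⟩ := hu
  refine hW.deriv_mem (γ := fun t => (γ t).2) hγ'.snd ?_
  filter_upwards [hγ] with t ⟨htM, htp⟩
  rw [hγ₀]
  exact (h _).1 (htp ▸ htM)

theorem finrank_orthogonal_eq (hm : Module.finrank ℝ W = m) : Module.finrank ℝ Wᗮ = g - m := by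
  have := W.finrank_add_finrank_orthogonal
  rw [hm, finrank_euclideanSpace_fin] at this
  omega

/-- A Lagrangian submanifold of `ℝ^g × ℝ^g`, periodic in `y`, whose fibres over `ℝ^g` are
`m`-dimensional affine subtori of `ℝ^g / ℤ^g` and which submerses to its image: this is what the
hypotheses on `S ⊂ X` say in an action-angle chart. -/
structure IsCleanLagrangian (M : Set (Coord g × Coord g)) (m : ℕ) : Prop where
  isSubmanifold : IsSubmanifold ℝ ∞ g M
  isotropic : ∀ p ∈ M, ∀ u ∈ tangentVectors M p, ∀ v ∈ tangentVectors M p, symplecticForm u v = 0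
  clean : ∀ p ∈ M, ∀ u ∈ tangentVectors M p, u.1 = 0 →
    u ∈ tangentVectors (M ∩ {q | q.1 = p.1}) p
  exists_hasDirection : ∀ p ∈ M, ∃ W, IsRational W ∧ Module.finrank ℝ W = m ∧ HasDirection M W p

theorem IsCleanLagrangian.range_fst_comp_eq (hM : IsCleanLagrangian M m) {F : Type*}
    [NormedAddCommGroup F] [NormedSpace ℝ F] [FiniteDimensional ℝ F] (hF : Module.finrank ℝ F = g)
    {p : Coord g × Coord g} (hp : p ∈ M) (hW : IsRational W) (h : HasDirection M W p)
    {T : F →L[ℝ] Coord g × Coord g} (hT : Function.Injective T)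
    (hTM : ∀ u, T u ∈ tangentVectors M p) :
    (ContinuousLinearMap.fst ℝ (Coord g) (Coord g) ∘L T).range = Wᗮ := by
  set A := ContinuousLinearMap.fst ℝ (Coord g) (Coord g) ∘L T
  have hle : A.range ≤ Wᗮ := by
    rintro _ ⟨u, rfl⟩
    rw [Submodule.mem_orthogonal']
    intro w hw
    simpa [symplecticForm, A] using hM.isotropic p hp _ (hTM u) _ (h.mk_mem_tangentVectors hw)
  have hker : Module.finrank ℝ A.ker ≤ Module.finrank ℝ W := by
    have hmem : ∀ u : A.ker, (T u).2 ∈ W := fun u =>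
      h.snd_mem hW (hM.clean p hp _ (hTM u) u.2)
    let f : A.ker →ₗ[ℝ] W :=
      ((LinearMap.snd ℝ (Coord g) (Coord g) ∘ₗ T.toLinearMap) ∘ₗ A.ker.subtype).codRestrict W hmem
    refine LinearMap.finrank_le_finrank_of_injective (f := f) fun u v huv => ?_
    have hfst : (T u).1 = (T v).1 := Eq.trans u.2 (Eq.symm v.2)
    exact Subtype.ext (hT (Prod.ext hfst (congrArg Subtype.val huv)))
  refine Submodule.eq_of_le_of_finrank_le hle ?_
  have hranknullity := A.toLinearMap.finrank_range_add_finrank_ker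
  rw [hF] at hranknullity
  rw [finrank_orthogonal_eq rfl]
  omega

theorem eventually_sub_mem_of_range_le {E F : Type*} [NormedAddCommGroup F] [NormedSpace ℝ F]
    [NormedAddCommGroup E] [InnerProductSpace ℝ E] {K : Submodule ℝ E} [K.HasOrthogonalProjection]
    {f : F → E} {f' : F → F →L[ℝ] E} {q₀ : F}
    (hf : ∀ᶠ q in 𝓝 q₀, HasFDerivAt f (f' q) q ∧ (f' q).range ≤ K) :
    ∀ᶠ q in 𝓝 q₀, f q - f q₀ ∈ K := by
  obtain ⟨ρ, hρ, hball⟩ := Metric.mem_nhds_iff.1 hf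
  have hderiv : ∀ q ∈ Metric.ball q₀ ρ,
      HasFDerivAt (𝕜 := ℝ) (fun q => Kᗮ.starProjection (f q)) 0 q := fun q hq => by
    refine (Kᗮ.starProjection.hasFDerivAt.comp q (hball hq).1).congr_fderiv ?_
    ext1 u
    exact starProjection_orthogonal_eq_zero_iff.2 ((hball hq).2 ⟨u, rfl⟩)
  filter_upwards [Metric.ball_mem_nhds q₀ hρ] with q hq
  exact starProjection_orthogonal_eq_iff.1 <|
    Metric.isOpen_ball.is_const_of_fderiv_eq_zero (𝕜 := ℝ) (convex_ball q₀ ρ).isPreconnected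
      (fun q hq => (hderiv q hq).differentiableAt.differentiableWithinAt)
      (fun q hq => (hderiv q hq).fderiv) hq (Metric.mem_ball_self hρ)

/-- As there are only countably many rational subspaces, the direction of the fibres is locally
constant. -/
theorem IsCleanLagrangian.exists_parametrization (hM : IsCleanLagrangian M m)
    {p : Coord g × Coord g} (hp : p ∈ M) (hW : IsRational W) (hm : Module.finrank ℝ W = m)
    (h : HasDirection M W p) :
    ∃ (F : Submodule ℝ (Coord g × Coord g)) (ψ : F → Coord g × Coord g) (q₀ : F), ψ q₀ = p ∧
      (∀ᶠ q in 𝓝 q₀, ψ q ∈ M ∧ ContDiffAt ℝ ∞ ψ q ∧ HasDirection M W (ψ q) ∧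
        (fderiv ℝ (fun q => (ψ q).1) q).range = Wᗮ ∧ (ψ q).1 - p.1 ∈ Wᗮ) ∧
      𝓝[M] p ≤ map ψ (𝓝 q₀) := by
  obtain ⟨F, ψ, q₀, hF, rfl, hψ, hψM⟩ := hM.isSubmanifold.exists_parametrization hp
  have hfst : ∀ q, ContDiffAt ℝ ∞ ψ q → fderiv ℝ (fun q => (ψ q).1) q =
      ContinuousLinearMap.fst ℝ _ _ ∘L fderiv ℝ ψ q := fun q hq =>
    (hq.differentiableAt (by simp)).hasFDerivAt.fst.fderiv
  have hrange : ∀ᶠ q in 𝓝 q₀, ∀ W', IsRational W' → HasDirection M W' (ψ q) →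
      (fderiv ℝ (fun q => (ψ q).1) q).range = W'ᗮ := by
    filter_upwards [hψ.eventually_nhds] with q hq W' hW' h'
    obtain ⟨hqM, hsmooth, hinj⟩ := hq.self_of_nhds
    rw [hfst q hsmooth]
    exact hM.range_fst_comp_eq hF hqM hW' h' hinj (fderiv_mem_tangentVectors
      (hsmooth.differentiableAt (by simp)) (hq.mono fun _ h => h.1))
  have hrange₀ := hrange.self_of_nhds W hW h
  have hconst : ∀ᶠ q in 𝓝 q₀, (fderiv ℝ (fun q => (ψ q).1) q).range = Wᗮ := by
    rw [← hrange₀]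
    refine eventually_range_eq (hψ.mono fun q hq => ?_) ?_
      (countable_isRational.image fun W' => W'ᗮ) ?_
    · exact (hq.2.1.fst.fderiv_right (m := ∞) (by simp)).continuousAt
    · filter_upwards [hrange, hψ] with q hrangeq hq
      obtain ⟨W', hW', hm', h'⟩ := hM.exists_hasDirection _ hq.1
      rw [hrangeq W' hW' h', hrange₀, finrank_orthogonal_eq hm', finrank_orthogonal_eq hm]
    · filter_upwards [hrange, hψ] with q hrangeq hq
      obtain ⟨W', hW', -, h'⟩ := hM.exists_hasDirection _ hq.1
      exact ⟨W', hW', (hrangeq W' hW' h').symm⟩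
  refine ⟨F, ψ, q₀, rfl, ?_, hψM⟩
  have hsub := eventually_sub_mem_of_range_le (hconst.and hψ |>.mono fun q hq =>
    ⟨(hq.2.2.1.fst.differentiableAt (by simp)).hasFDerivAt, hq.1.le⟩)
  filter_upwards [hψ, hrange, hconst, hsub] with q hq hrangeq hconstq hsubq
  obtain ⟨W', hW', -, h'⟩ := hM.exists_hasDirection _ hq.1
  have hWW' : W' = W := by
    rw [← W'.orthogonal_orthogonal, ← hrangeq W' hW' h', hconstq, W.orthogonal_orthogonal]
  exact ⟨hq.1, hq.2.1, hWW' ▸ h', hconstq, hsubq⟩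

theorem IsCleanLagrangian.eventually_hasDirection (hM : IsCleanLagrangian M m)
    {p : Coord g × Coord g} (hp : p ∈ M) (hW : IsRational W) (hm : Module.finrank ℝ W = m)
    (h : HasDirection M W p) :
    ∀ᶠ p' in 𝓝[M] p, p'.1 - p.1 ∈ Wᗮ ∧ HasDirection M W p' := by
  obtain ⟨F, ψ, q₀, -, hψ, hψM⟩ := hM.exists_parametrization hp hW hm h
  exact hψM (hψ.mono fun q hq => ⟨hq.2.2.2.2, hq.2.2.1⟩)

theorem exists_contDiffAt_rightInverse {E F : Type*} [NormedAddCommGroup E] [NormedSpace ℝ E]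
    [FiniteDimensional ℝ E] [NormedAddCommGroup F] [NormedSpace ℝ F] {f : F → E} {q₀ : F}
    {n : WithTop ℕ∞} (hn : n ≠ 0) (hf : ∀ᶠ q in 𝓝 q₀, ContDiffAt ℝ n f q)
    (hsurj : (fderiv ℝ f q₀).range = ⊤) :
    ∃ σ : E → F, Tendsto σ (𝓝 (f q₀)) (𝓝 q₀) ∧
      ∀ᶠ y in 𝓝 (f q₀), ContDiffAt ℝ n σ y ∧ f (σ y) = y := by
  have := FiniteDimensional.complete ℝ E
  obtain ⟨j, hj⟩ := (fderiv ℝ f q₀).exists_rightInverse_of_surjective hsurj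
  let i : E → F := fun v => q₀ + j v
  have hi : ContDiff ℝ n i := contDiff_const.add j.contDiff
  have hi₀ : Tendsto i (𝓝 0) (𝓝 q₀) := hi.continuous.tendsto' _ _ (by simp [i])
  have hk : ∀ᶠ v in 𝓝 0, ContDiffAt ℝ n (f ∘ i) v :=
    (hi₀.eventually hf).mono fun v hv => hv.comp v hi.contDiffAt
  have hk' : HasFDerivAt (f ∘ i) (ContinuousLinearEquiv.refl ℝ E : E →L[ℝ] E) 0 := by
    have hf' : HasFDerivAt f (fderiv ℝ f q₀) (i 0) := by
      simpa [i] using (hf.self_of_nhds.differentiableAt hn).hasFDerivAt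
    exact (hf'.comp 0 (j.hasFDerivAt.const_add q₀)).congr_fderiv hj
  have hunit : ∀ᶠ v in 𝓝 0, IsUnit (fderiv ℝ (f ∘ i) v) :=
    (hk.self_of_nhds.continuousAt_fderiv hn).preimage_mem_nhds
      ((Units.isOpen (R := E →L[ℝ] E)).mem_nhds (by rw [hk'.fderiv]; exact isUnit_one))
  let e := hk.self_of_nhds.toOpenPartialHomeomorph (f ∘ i) hk' hn
  have he₀ : (0 : E) ∈ e.source := hk.self_of_nhds.mem_toOpenPartialHomeomorph_source _ _
  have hfe : e 0 = f q₀ := by simp [e, i]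
  have hesymm : Tendsto e.symm (𝓝 (f q₀)) (𝓝 0) := by
    simpa only [← hfe, e.left_inv he₀] using (e.continuousAt_symm (e.map_source he₀)).tendsto
  refine ⟨i ∘ e.symm, hi₀.comp hesymm, ?_⟩
  filter_upwards [hesymm.eventually (hk.and hunit), e.open_target.mem_nhds (hfe ▸ e.map_source he₀)]
    with y ⟨hky, u, hu⟩ hy
  refine ⟨hi.contDiffAt.comp y (e.contDiffAt_symm
    (f₀' := ContinuousLinearEquiv.unitsEquiv ℝ E u) hy ?_ hky), e.right_inv hy⟩
  exact (hky.differentiableAt hn).hasFDerivAt.congr_fderiv hu.symm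

theorem IsCleanLagrangian.exists_section (hM : IsCleanLagrangian M m) {p : Coord g × Coord g}
    (hp : p ∈ M) (hW : IsRational W) (hm : Module.finrank ℝ W = m) (h : HasDirection M W p) :
    ∃ r > 0, ∃ s : Coord g → Coord g, ContDiffOn ℝ ∞ s (Metric.ball 0 r) ∧
      ∀ v ∈ Wᗮ, ‖v‖ < r → (p.1 + v, s v) ∈ M := by
  obtain ⟨F, ψ, q₀, rfl, hψ, -⟩ := hM.exists_parametrization hp hW hm h
  let P : Coord g →L[ℝ] Wᗮ := Wᗮ.orthogonalProjectionOnto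
  let k : F → Wᗮ := fun q => P ((ψ q).1 - (ψ q₀).1)
  have hk : ∀ᶠ q in 𝓝 q₀, ContDiffAt ℝ ∞ k q := hψ.mono fun q hq =>
    P.contDiff.contDiffAt.comp q (hq.2.1.fst.sub contDiffAt_const)
  have hk₀ : k q₀ = 0 := by simp [k]
  have hsurj : (fderiv ℝ k q₀).range = ⊤ := by
    have hψ₀ := (hψ.self_of_nhds.2.1.fst.differentiableAt (by simp)).hasFDerivAt
    have hk' : HasFDerivAt k (P ∘L fderiv ℝ (fun q => (ψ q).1) q₀) q₀ :=
      P.hasFDerivAt.comp q₀ (hψ₀.sub_const _)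
    rw [hk'.fderiv, eq_top_iff]
    rintro v -
    obtain ⟨u, hu⟩ : (v : Coord g) ∈ (fderiv ℝ (fun q => (ψ q).1) q₀).range := by
      rw [hψ.self_of_nhds.2.2.2.1]
      exact v.2
    exact ⟨u, (congrArg P hu).trans (Submodule.orthogonalProjectionOnto_mem_subspace_eq_self v)⟩
  obtain ⟨σ, hσ₀, hσ⟩ := exists_contDiffAt_rightInverse (by simp) hk hsurj
  rw [hk₀] at hσ₀ hσ
  obtain ⟨r, hr, hball⟩ := Metric.mem_nhds_iff.1 (hσ.and (hσ₀.eventually hψ))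
  have hPr : ∀ v, ‖v‖ < r → P v ∈ Metric.ball (0 : Wᗮ) r := fun v hv =>
    mem_ball_zero_iff.2 ((Submodule.norm_orthogonalProjectionOnto_apply_le _ v).trans_lt hv)
  refine ⟨r, hr, fun v => (ψ (σ (P v))).2, fun v hv => ?_, fun v hv hvr => ?_⟩
  · obtain ⟨⟨hσv, -⟩, -, hψv, -⟩ := hball (hPr v (mem_ball_zero_iff.1 hv))
    exact (hψv.comp v (hσv.comp v P.contDiff.contDiffAt)).snd.contDiffWithinAt
  · obtain ⟨⟨-, hkσ⟩, hψvM, -, -, -, hmem⟩ := hball (hPr v hvr)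
    have hkmem : k (σ (P v)) = ⟨_, hmem⟩ :=
      Submodule.orthogonalProjectionOnto_mem_subspace_eq_self (⟨_, hmem⟩ : Wᗮ)
    have hPv : P v = ⟨v, hv⟩ :=
      Submodule.orthogonalProjectionOnto_mem_subspace_eq_self (⟨v, hv⟩ : Wᗮ)
    have hfst : (ψ (σ (P v))).1 - (ψ q₀).1 = v :=
      congrArg Subtype.val (hkmem.symm.trans (hkσ.trans hPv))
    rw [← eq_add_of_sub_eq' hfst]
    exact hψvM

end LocalStructure

section Compactness

variable {g : ℕ}

theorem eventually_forall_of_periodic {Y : Type*} [TopologicalSpace Y] {Q : Y × Coord g → Prop}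
    {x₀ : Y} (hQ : ∀ y, ∀ᶠ p in 𝓝 (x₀, y), Q p)
    (hper : ∀ x y, ∀ n ∈ intLattice g, Q (x, y) → Q (x, y + n)) :
    ∀ᶠ x in 𝓝 x₀, ∀ y, Q (x, y) := by
  have hcube : IsCompact ((WithLp.toLp 2 : (Fin g → ℝ) → Coord g) ''
      Set.pi univ fun _ => Icc (0 : ℝ) 1) :=
    (isCompact_univ_pi fun _ => isCompact_Icc).image (PiLp.continuous_toLp 2 _)
  filter_upwards [hcube.eventually_forall_of_forall_eventually (P := fun x y => Q (x, y))
    (x₀ := x₀) fun y _ => hQ y] with x hx y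
  set n : Coord g := WithLp.toLp 2 fun j => ((⌊y j⌋ : ℤ) : ℝ)
  set y' : Coord g := WithLp.toLp 2 fun j => Int.fract (y j)
  have hy' : Q (x, y') := hx y'
    ⟨_, fun j _ => ⟨Int.fract_nonneg (y j), (Int.fract_lt_one (y j)).le⟩, rfl⟩
  have hn : n ∈ intLattice g := mem_intLattice.2 fun j => ⟨⌊y j⌋, rfl⟩
  have hy : y' + n = y := by
    ext j
    simp [n, y']
  exact hy ▸ hper x y' n hn hy'

end Compactness

section LocalModel

variable {g : ℕ} {B : Type*} [TopologicalSpace B] [ChartedSpace (Coord g) B]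
  {Λ : LagrangianCovering g B} {S : Set (X Λ)} {m : ℕ}

theorem isOpen_notMem_chart (hS : IsClosed S) (φ : ActionChart Λ) :
    IsOpen {p : Coord g × Coord g | p.1 ∈ φ.1.target ∧ X.param φ p ∉ S} :=
  X.isOpen_iff.1 hS.isOpen_compl φ

theorem add_mem_inChart (φ : ActionChart Λ) {x y n : Coord g} (hn : n ∈ intLattice g)
    (h : (x, y) ∈ inChart S φ) : (x, y + n) ∈ inChart S φ :=
  ⟨h.1, mem_of_eq_of_mem (X.param_add_of_mem_intLattice φ h.1 hn) h.2⟩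

theorem ycoord_injective (φ : ActionChart Λ) {b : B} (hb : b ∈ φ.1.source) :
    Function.Injective (ycoord φ.1 b) :=
  Function.LeftInverse.injective (g := cot φ.1 b) (cot_ycoord φ.2.1 hb)

theorem isRational_map_ycoord (φ : ActionChart Λ) {b : B} (hb : b ∈ φ.1.source)
    {V : Submodule ℝ (Cot g b)}
    (hV : Submodule.span ℝ ((V : Set (Cot g b)) ∩ (Λ.lattice b : Set (Cot g b))) = V) :
    IsRational (V.map (ycoord φ.1 b)) := by
  have himage : ycoord φ.1 b '' ((V : Set (Cot g b)) ∩ (Λ.lattice b : Set (Cot g b))) =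
      (V.map (ycoord φ.1 b) : Set (Coord g)) ∩ intLattice g := by
    have hlattice : (Λ.lattice b : Set (Cot g b)) = ycoord φ.1 b ⁻¹' intLattice g :=
      Set.ext fun α => mem_lattice_iff φ hb
    rw [hlattice, image_inter_preimage, Submodule.map_coe]
  rw [IsRational, ← himage, ← Submodule.map_span, hV]

theorem mk_cot_mem_translate_iff (φ : ActionChart Λ) {b : B} (hb : b ∈ φ.1.source)
    (α₀ : Cot g b) (V : Submodule ℝ (Cot g b)) {y : Coord g} :
    (QuotientAddGroup.mk (cot φ.1 b y) : Cot g b ⧸ Λ.lattice b) ∈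
        (fun α : Cot g b => (QuotientAddGroup.mk (α₀ + α) : Cot g b ⧸ Λ.lattice b)) '' V ↔
      ∃ w ∈ V.map (ycoord φ.1 b), y - ycoord φ.1 b α₀ - w ∈ intLattice g := by
  simp only [Submodule.mem_map, exists_exists_and_eq_and, mem_image, SetLike.mem_coe,
    QuotientAddGroup.eq]
  refine exists_congr fun α => and_congr_right fun _ => ?_
  rw [mem_lattice_iff φ hb, map_add, map_neg, map_add, ycoord_cot φ.2.1 hb]
  exact iff_of_eq (congrArg (· ∈ intLattice g) (by abel))

theorem FibresAreSubtori.exists_hasDirection (hm : FibresAreSubtori S m) (φ : ActionChart Λ)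
    {p : Coord g × Coord g} (hp : p ∈ inChart S φ) :
    ∃ W, IsRational W ∧ Module.finrank ℝ W = m ∧ HasDirection (inChart S φ) W p := by
  obtain ⟨x, y⟩ := p
  have hb : φ.1.symm x ∈ φ.1.source := φ.1.map_target hp.1
  obtain ⟨α₀, V, hfin, hspan, hT⟩ := hm _ ⟨_, hp.2⟩
  have hmem : ∀ y', (x, y') ∈ inChart S φ ↔ ∃ w ∈ V.map (ycoord φ.1 (φ.1.symm x)),
      y' - ycoord φ.1 _ α₀ - w ∈ intLattice g := fun y' => by
    rw [← mk_cot_mem_translate_iff φ hb, ← hT]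
    exact and_iff_right hp.1
  refine ⟨_, isRational_map_ycoord φ hb hspan, ?_, fun y' => ?_⟩
  · rw [← hfin]
    exact (V.equivMapOfInjective _ (ycoord_injective φ hb)).finrank_eq.symm
  obtain ⟨w, hw, hwn⟩ := (hmem y).1 hp
  rw [hmem y']
  constructor
  · rintro ⟨w', hw', hn⟩
    refine ⟨_, sub_mem hn hwn, ?_⟩
    convert sub_mem hw' hw using 1
    dsimp only
    abel
  · rintro ⟨n, hn, hn'⟩
    refine ⟨_, add_mem hn' hw, ?_⟩
    convert add_mem hn hwn using 1
    dsimp only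
    abel

theorem isCleanLagrangian_inChart (hS : IsClosedLagrangian S) (hclean : IsFibrewiseClean S)
    (hm : FibresAreSubtori S m) (φ : ActionChart Λ) : IsCleanLagrangian (inChart S φ) m :=
  ⟨hS.isSubmanifold φ, hS.isotropic φ, hclean φ, fun _ => hm.exists_hasDirection φ⟩

theorem eventually_forall_hasDirection (hS : IsClosedLagrangian S) (hclean : IsFibrewiseClean S)
    (hm : FibresAreSubtori S m) (φ : ActionChart Λ) {W : Submodule ℝ (Coord g)}
    (hW : IsRational W) (hWm : Module.finrank ℝ W = m) {x₀ y₀ : Coord g}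
    (hp : (x₀, y₀) ∈ inChart S φ) (h : HasDirection (inChart S φ) W (x₀, y₀)) :
    ∀ᶠ x in 𝓝 x₀, ∀ y, (x, y) ∈ inChart S φ →
      x - x₀ ∈ Wᗮ ∧ HasDirection (inChart S φ) W (x, y) := by
  refine eventually_forall_of_periodic (Q := fun p => p ∈ inChart S φ →
    p.1 - x₀ ∈ Wᗮ ∧ HasDirection (inChart S φ) W p) (fun y => ?_) fun x y n hn hQ hyn => ?_
  · by_cases hy : (x₀, y) ∈ inChart S φ
    · exact eventually_nhdsWithin_iff.1 <|
        (isCleanLagrangian_inChart hS hclean hm φ).eventually_hasDirection hy hW hWm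
          (h.translate hy)
    · filter_upwards [(isOpen_notMem_chart hS.isClosed φ).mem_nhds
        ⟨hp.1, fun hyS => hy ⟨hp.1, hyS⟩⟩] with p hpS hpM
      exact absurd hpM.2 hpS.2
  · have hy : (x, y) ∈ inChart S φ := by simpa using add_mem_inChart φ (neg_mem hn) hyn
    exact ⟨(hQ hy).1, (hQ hy).2.translate hyn⟩

/-- A description of `S` over a ball around `x₀` in an action chart: `S` lies over the affine
subspace `x₀ + Wᗮ`, and `z ↦ (x₀ + P_{Wᗮ} z, y z)` parametrizes it up to the lattice. -/
structure LocalModel (S : Set (X Λ)) (φ : ActionChart Λ) (m : ℕ) (x₀ : Coord g) where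
  /-- the direction of the fibres -/
  W : Submodule ℝ (Coord g)
  /-- the radius of the ball -/
  r : ℝ
  /-- the angle coordinates of the parametrization -/
  y : Coord g → Coord g
  rational : IsRational W
  finrank_eq : Module.finrank ℝ W = m
  r_pos : 0 < r
  ball_subset : Metric.ball x₀ r ⊆ φ.1.target
  contDiffOn : ContDiffOn ℝ ∞ y {z | ‖Wᗮ.starProjection z‖ < r}
  y_add : ∀ z, ∀ w ∈ W, y (z + w) = y z + w
  mem_iff : ∀ x ∈ Metric.ball x₀ r, ∀ y', X.param φ (x, y') ∈ S ↔
    ∃ z, ∃ n ∈ intLattice g, Wᗮ.starProjection z = x - x₀ ∧ y' = y z + n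

theorem exists_localModel (hS : IsClosedLagrangian S) (hclean : IsFibrewiseClean S)
    (hm : FibresAreSubtori S m) (φ : ActionChart Λ) {x₀ y₀ : Coord g} (hx₀ : x₀ ∈ φ.1.target)
    (hy₀ : X.param φ (x₀, y₀) ∈ S) : Nonempty (LocalModel S φ m x₀) := by
  have hp : (x₀, y₀) ∈ inChart S φ := ⟨hx₀, hy₀⟩
  obtain ⟨W, hW, hWm, hdir⟩ := hm.exists_hasDirection φ hp
  obtain ⟨r₁, hr₁, s, hs, hsM⟩ :=
    (isCleanLagrangian_inChart hS hclean hm φ).exists_section hp hW hWm hdir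
  obtain ⟨r₂, hr₂, hball⟩ := Metric.mem_nhds_iff.1
    ((eventually_forall_hasDirection hS hclean hm φ hW hWm hp hdir).and
      (φ.1.open_target.mem_nhds hx₀))
  refine ⟨⟨W, min r₁ r₂, fun z => s (Wᗮ.starProjection z) + W.starProjection z, hW, hWm,
    lt_min hr₁ hr₂, fun x hx => (hball (Metric.ball_subset_ball (min_le_right _ _) hx)).2,
    ?_, fun z w hw => ?_, fun x hx y' => ?_⟩⟩
  · refine (hs.comp Wᗮ.starProjection.contDiff.contDiffOn fun z hz => ?_).add
      W.starProjection.contDiff.contDiffOn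
    exact mem_ball_zero_iff.2 (lt_of_lt_of_le hz (min_le_left _ _))
  · simp only [starProjection_orthogonal_add_of_mem hw, map_add,
      W.starProjection_eq_self_iff.2 hw, add_assoc]
  · obtain ⟨hdirx, hxt⟩ := hball (Metric.ball_subset_ball (min_le_right r₁ r₂) hx)
    have hsx : x - x₀ ∈ Wᗮ → (x, s (x - x₀)) ∈ inChart S φ := fun h => by
      simpa using hsM _ h ((mem_ball_iff_norm.1 hx).trans_le (min_le_left _ _))
    constructor
    · intro hy'
      have hxW := (hdirx y' ⟨hxt, hy'⟩).1
      obtain ⟨n, hn, hnW⟩ := ((hdirx _ (hsx hxW)).2 y').1 ⟨hxt, hy'⟩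
      refine ⟨x - x₀ + (y' - s (x - x₀) - n), n, hn, ?_⟩
      rw [starProjection_orthogonal_add_of_mem hnW, Wᗮ.starProjection_eq_self_iff.2 hxW, map_add,
        W.starProjection_eq_self_iff.2 hnW, W.starProjection_apply_eq_zero_iff.2 hxW]
      exact ⟨rfl, by abel⟩
    · rintro ⟨z, n, hn, hz, rfl⟩
      refine (((hdirx _ (hsx (hz ▸ Wᗮ.starProjection_apply_mem z))).2 _).2 ⟨n, hn, ?_⟩).2
      rw [hz]
      convert W.starProjection_apply_mem z using 1
      abel

end LocalModel

section Parallel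

variable {g : ℕ} {B : Type*} [TopologicalSpace B] [ChartedSpace (Coord g) B]
  {Λ : LagrangianCovering g B} {S : Set (X Λ)} {m : ℕ}

theorem exists_mk_of_mem_proj {b : B} (h : b ∈ X.proj '' S) : ∃ α : Cot g b, X.mk α ∈ S := by
  obtain ⟨⟨b', q⟩, hq, rfl⟩ := h
  obtain ⟨α, rfl⟩ := QuotientAddGroup.mk_surjective q
  exact ⟨α, hq⟩

namespace LocalModel

variable {φ : ActionChart Λ} {x₀ : Coord g} (D : LocalModel S φ m x₀)

include D

theorem sub_mem {z z' : Coord g} (h : D.Wᗮ.starProjection z = D.Wᗮ.starProjection z') :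
    z - z' ∈ D.W :=
  starProjection_orthogonal_eq_iff.1 h

theorem y_eq {z z' : Coord g} (h : D.Wᗮ.starProjection z = D.Wᗮ.starProjection z') :
    D.y z = D.y z' + (z - z') := by
  rw [← D.y_add _ _ (D.sub_mem h), add_sub_cancel]

theorem mem_iff_of_mem {x y₁ y₂ : Coord g} (hx : x ∈ Metric.ball x₀ D.r)
    (h : X.param φ (x, y₁) ∈ S) :
    X.param φ (x, y₂) ∈ S ↔ ∃ n ∈ intLattice g, y₂ - y₁ - n ∈ D.W := by
  obtain ⟨z₁, n₁, hn₁, hz₁, rfl⟩ := (D.mem_iff x hx y₁).1 h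
  rw [D.mem_iff x hx]
  constructor
  · rintro ⟨z₂, n₂, hn₂, hz₂, rfl⟩
    refine ⟨n₂ - n₁, _root_.sub_mem hn₂ hn₁, ?_⟩
    rw [D.y_eq (hz₂.trans hz₁.symm)]
    convert D.sub_mem (hz₂.trans hz₁.symm) using 1
    abel
  · rintro ⟨n, hn, hW⟩
    refine ⟨z₁ + (y₂ - (D.y z₁ + n₁) - n), n + n₁, add_mem hn hn₁, ?_, ?_⟩
    · rw [starProjection_orthogonal_add_of_mem hW, hz₁]
    · rw [D.y_add _ _ hW]
      abel

theorem mem_vertTangent_iff {b : B} (hb : b ∈ φ.1.source) (hx : φ.1 b ∈ Metric.ball x₀ D.r)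
    {α : Cot g b} (hα : X.mk α ∈ S) {a : Cot g b} :
    a ∈ vertTangent S α ↔ ycoord φ.1 b a ∈ D.W := by
  have mem_fibre_iff : ∀ β : Cot g b, β ∈ fibre S b ↔
      ∃ n ∈ intLattice g, ycoord φ.1 b β - ycoord φ.1 b α - n ∈ D.W := fun β => by
    rw [X.mk_eq_param φ hb] at hα
    rw [← D.mem_iff_of_mem hx hα, ← X.mk_eq_param φ hb]
    rfl
  constructor
  · rintro ⟨γ, rfl, hγ, hγ'⟩
    exact D.rational.deriv_mem (hasDerivAt_ycoord hγ') (hγ.mono fun t => (mem_fibre_iff _).1)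
  · intro ha
    refine ⟨fun t => cot φ.1 b (ycoord φ.1 b α + t • ycoord φ.1 b a), ?_,
      Eventually.of_forall fun t => (mem_fibre_iff _).2 ⟨0, zero_mem _, ?_⟩, ?_⟩
    · simp [cot_ycoord φ.2.1 hb]
    · rw [ycoord_cot φ.2.1 hb]
      simpa using D.W.smul_mem t ha
    · have hderiv : HasDerivAt (fun t : ℝ => ycoord φ.1 b α + t • ycoord φ.1 b a)
          (ycoord φ.1 b a) 0 := by
        simpa using ((hasDerivAt_id (0 : ℝ)).smul_const (ycoord φ.1 b a)).const_add
          (ycoord φ.1 b α)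
      simpa only [cot_ycoord φ.2.1 hb] using hasDerivAt_cot (φ := φ.1) (b := b) hderiv

end LocalModel

theorem eventually_mem_vertTangent_iff (hS : IsClosedLagrangian S) (hclean : IsFibrewiseClean S)
    (hm : FibresAreSubtori S m) {Y : Type*} [TopologicalSpace Y] {s : Set Y} {c : Y → B} {t₀ : Y}
    (hc : ContinuousWithinAt c s t₀) (hcS : c t₀ ∈ X.proj '' S) {α : ∀ t, Cot g (c t)}
    (hα : ∀ φ : ActionChart Λ, c t₀ ∈ φ.1.source →
      ∃ y, ∀ᶠ t in 𝓝[s] t₀, α t = cot φ.1 (c t) y) :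
    ∃ C : Prop, ∀ᶠ t in 𝓝[s] t₀, ∀ β ∈ fibre S (c t), α t ∈ vertTangent S β ↔ C := by
  obtain ⟨φ, hφ, hb⟩ := Λ.exists_actionChart (c t₀)
  let φ' : ActionChart Λ := ⟨φ, hφ⟩
  obtain ⟨α₀, hα₀⟩ := exists_mk_of_mem_proj hcS
  rw [X.mk_eq_param φ' hb] at hα₀
  obtain ⟨D⟩ := exists_localModel hS hclean hm φ' (φ.map_source hb) hα₀
  obtain ⟨y, hy⟩ := hα φ' hb
  have hball : ∀ᶠ t in 𝓝[s] t₀, φ (c t) ∈ Metric.ball (φ (c t₀)) D.r :=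
    ((φ.continuousAt hb).tendsto.comp hc) (Metric.ball_mem_nhds _ D.r_pos)
  refine ⟨y ∈ D.W, ?_⟩
  filter_upwards [hc (φ.open_source.mem_nhds hb), hball, hy] with t hsource hballt hyt β hβ
  rw [D.mem_vertTangent_iff (φ := φ') hsource hballt hβ, hyt, ycoord_cot φ'.2.1 hsource]

theorem verticalTangentsParallel (hS : IsClosedLagrangian S) (hclean : IsFibrewiseClean S)
    (hm : FibresAreSubtori S m) : VerticalTangentsParallel S := by
  intro c hc hcS α hα β₀ hβ₀ β₁ hβ₁ hα₀
  have same_tangency : ∀ β ∈ fibre S (c 0), ∀ β' ∈ fibre S (c 1),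
      (α 0 ∈ vertTangent S β ↔ α 1 ∈ vertTangent S β') := by
    refine isPreconnected_Icc.induction₂ (fun t t' => ∀ β ∈ fibre S (c t), ∀ β' ∈ fibre S (c t'),
      (α t ∈ vertTangent S β ↔ α t' ∈ vertTangent S β')) (fun t ht => ?_)
      (fun t t' t'' _ ht' _ h h' β hβ β'' hβ'' => ?_)
      (fun t t' _ _ h β hβ β' hβ' => (h β' hβ' β hβ).symm)
      (left_mem_Icc.2 zero_le_one) (right_mem_Icc.2 zero_le_one)
    · obtain ⟨C, hC⟩ := eventually_mem_vertTangent_iff hS hclean hm (hc.continuousOn t ht)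
        (hcS t ht) fun φ hφ => hα φ t ht hφ
      filter_upwards [hC] with t' ht' β hβ β' hβ'
      exact (hC.self_of_nhdsWithin ht β hβ).trans (ht' β' hβ').symm
    · obtain ⟨β', hβ'⟩ := exists_mk_of_mem_proj (hcS t' ht')
      exact (h β hβ β' hβ').trans (h' β' hβ' β'' hβ'')
  exact (same_tangency β₀ hβ₀ β₁ hβ₁).1 hα₀

end Parallel

section FlatFrame

/-- The circle with the discrete topology, so that a bundle with this fibre is a covering space
whose sections are the locally constant unitary frames. -/
def DiscreteCircle : Type := Circle

instance : TopologicalSpace DiscreteCircle := ⊥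

instance : DiscreteTopology DiscreteCircle := ⟨rfl⟩

instance : CommGroup DiscreteCircle := inferInstanceAs (CommGroup Circle)

namespace LocalSystem

variable {Y : Type*} [TopologicalSpace Y] {S : Set Y} (L : LocalSystem S)

theorem trans_self (i : L.ι) {p : Y} (hp : p ∈ S) (hi : p ∈ L.cover i) : L.trans i i p = 1 := by
  simpa using L.cocycle i i i p ⟨hp, ⟨hi, hi⟩, hi⟩

theorem exists_mem_cover {p : Y} (hp : p ∈ S) : ∃ i, p ∈ L.cover i :=
  mem_iUnion.1 (L.subset_cover hp)

theorem eventually_trans_eq {A : Type*} [TopologicalSpace A] {f : C(A, Y)} (hf : ∀ a, f a ∈ S)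
    {i j : L.ι} {a : A} (hi : f a ∈ L.cover i) (hj : f a ∈ L.cover j) :
    ∀ᶠ a' in 𝓝 a, L.trans i j (f a') = L.trans i j (f a) :=
  (tendsto_nhdsWithin_iff.2 ⟨f.continuous.continuousAt, Eventually.of_forall hf⟩).eventually
    (L.locallyConstant i j (f a) ⟨hf a, hi, hj⟩)

/-- The bundle of flat unitary frames of the pull-back of a local system. -/
def frameBundle {A : Type*} [TopologicalSpace A] (f : C(A, Y)) (hf : ∀ a, f a ∈ S) :
    FiberBundleCore L.ι A DiscreteCircle where
  baseSet i := f ⁻¹' L.cover i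
  isOpen_baseSet i := (L.isOpen_cover i).preimage f.continuous
  indexAt a := (L.exists_mem_cover (hf a)).choose
  mem_baseSet_at a := (L.exists_mem_cover (hf a)).choose_spec
  coordChange i j a v := (show DiscreteCircle from L.trans j i (f a)) * v
  coordChange_self i a ha v := mul_eq_right.2 (L.trans_self i (hf a) ha)
  continuousOn_coordChange i j := by
    rintro ⟨a, v⟩ ⟨⟨hi, hj⟩, -⟩
    have hconst : ContinuousAt (fun q : A × DiscreteCircle =>
        (show DiscreteCircle from L.trans j i (f a)) * q.2) (a, v) :=
      (continuous_of_discreteTopology (f := fun v : DiscreteCircle =>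
        (show DiscreteCircle from L.trans j i (f a)) * v)).continuousAt.comp continuousAt_snd
    refine (hconst.congr ?_).continuousWithinAt
    filter_upwards [continuousAt_fst.eventually (L.eventually_trans_eq hf hj hi)] with q hq
    rw [hq]
  coordChange_comp i j k a ha v := by
    rw [← mul_assoc]
    exact congrArg (· * v) (L.cocycle k j i (f a) ⟨hf a, ⟨ha.2, ha.1.2⟩, ha.1.1⟩)

theorem exists_flat_frame {A : Type*} [TopologicalSpace A] [SimplyConnectedSpace A]
    [LocallyPathConnectedSpace A] (f : C(A, Y)) (hf : ∀ a, f a ∈ S) :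
    ∃ e : L.ι → A → Circle,
      (∀ i j a, f a ∈ L.cover i → f a ∈ L.cover j → e i a = L.trans i j (f a) * e j a) ∧
      ∀ i a, f a ∈ L.cover i → ∀ᶠ a' in 𝓝 a, e i a' = e i a := by
  let Z := L.frameBundle f hf
  have hcov : IsCoveringMap (Bundle.TotalSpace.proj : Z.TotalSpace → A) :=
    FiberBundle.isCoveringMap (F := DiscreteCircle) (E := Z.Fiber)
  obtain ⟨a₀⟩ : Nonempty A := inferInstance
  obtain ⟨s, ⟨-, hs⟩, -⟩ := hcov.existsUnique_continuousMap_lifts (ContinuousMap.id A) a₀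
    (⟨a₀, (1 : DiscreteCircle)⟩ : Z.TotalSpace) rfl
  have hproj : ∀ a, (s a).proj = a := congrFun hs
  let e : L.ι → A → Circle := fun i a => (Z.localTriv i (s a)).2
  have he : ∀ i a, e i a = L.trans i (Z.indexAt a) (f a) * (show Circle from (s a).2) :=
    fun i a => congrArg (fun a' => L.trans i (Z.indexAt a') (f a') * (show Circle from (s a).2))
      (hproj a)
  refine ⟨e, fun i j a hi hj => ?_, fun i a hi => ?_⟩
  · rw [he, he, ← mul_assoc, L.cocycle i j _ (f a) ⟨hf a, ⟨hi, hj⟩, Z.mem_baseSet_at a⟩]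
  · have hsource : s a ∈ (Z.localTriv i).source :=
      (Z.mem_localTriv_source i _).2 <|
        show f (s a).proj ∈ L.cover i from mem_of_eq_of_mem (congrArg f (hproj a)) hi
    have hcont : ContinuousAt (show A → DiscreteCircle from e i) a := continuousAt_snd.comp
      (((Z.localTriv i).toOpenPartialHomeomorph.continuousAt hsource).comp
        s.continuous.continuousAt)
    exact hcont.preimage_mem_nhds
      (mem_nhds_discrete.2 (mem_singleton (show DiscreteCircle from e i a)))

end LocalSystem

end FlatFrame

section ModelFrame

variable {g : ℕ} {B : Type*} [TopologicalSpace B] [ChartedSpace (Coord g) B]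
  {Λ : LagrangianCovering g B} {S : Set (X Λ)} {m : ℕ}

namespace LocalModel

variable {φ : ActionChart Λ} {x₀ : Coord g} (D : LocalModel S φ m x₀)

/-- The domain of the parametrization of `S` given by a local model: a tube around `W`. -/
def dom : Set (Coord g) := {z | ‖D.Wᗮ.starProjection z‖ < D.r}

theorem isOpen_dom : IsOpen D.dom :=
  isOpen_lt D.Wᗮ.starProjection.continuous.norm continuous_const

theorem convex_dom : Convex ℝ D.dom := by
  have hpreimage : D.dom = D.Wᗮ.starProjection.toLinearMap ⁻¹' Metric.ball 0 D.r :=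
    Set.ext fun z => mem_ball_zero_iff.symm
  exact hpreimage ▸ (convex_ball _ _).linear_preimage _

theorem zero_mem_dom : (0 : Coord g) ∈ D.dom := by
  simp [dom, D.r_pos]

theorem add_mem_dom {z w : Coord g} (hz : z ∈ D.dom) (hw : w ∈ D.W) : z + w ∈ D.dom := by
  change ‖D.Wᗮ.starProjection (z + w)‖ < D.r
  rw [starProjection_orthogonal_add_of_mem hw]
  exact hz

/-- The action-angle coordinates of the parametrization `LocalModel.pt`. -/
def coords (z : Coord g) : Coord g × Coord g := (x₀ + D.Wᗮ.starProjection z, D.y z)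

/-- The parametrization of `S` given by a local model; it is invariant under `W ∩ ℤ^g`. -/
def pt (z : Coord g) : X Λ := X.param φ (D.coords z)

theorem coords_fst_mem_ball {z : Coord g} (hz : z ∈ D.dom) :
    (D.coords z).1 ∈ Metric.ball x₀ D.r := by
  rw [mem_ball_iff_norm, coords, add_sub_cancel_left]
  exact hz

theorem coords_fst_mem {z : Coord g} (hz : z ∈ D.dom) : (D.coords z).1 ∈ φ.1.target :=
  D.ball_subset (D.coords_fst_mem_ball hz)

theorem pt_mem {z : Coord g} (hz : z ∈ D.dom) : D.pt z ∈ S :=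
  (D.mem_iff _ (D.coords_fst_mem_ball hz) _).2 ⟨z, 0, zero_mem _, by simp [coords], by simp⟩

theorem contDiffOn_coords : ContDiffOn ℝ ∞ D.coords D.dom :=
  (contDiffOn_const.add D.Wᗮ.starProjection.contDiff.contDiffOn).prodMk D.contDiffOn

theorem continuousOn_pt : ContinuousOn D.pt D.dom :=
  (X.continuousOn_param φ).comp D.contDiffOn_coords.continuousOn fun _ hz => D.coords_fst_mem hz

theorem coords_add {z w : Coord g} (hw : w ∈ D.W) :
    D.coords (z + w) = ((D.coords z).1, (D.coords z).2 + w) := by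
  rw [coords, D.y_add z w hw, starProjection_orthogonal_add_of_mem hw]
  rfl

theorem pt_add {z l : Coord g} (hz : z ∈ D.dom) (hl : l ∈ D.W)
    (hl' : l ∈ intLattice g) : D.pt (z + l) = D.pt z := by
  rw [pt, D.coords_add hl]
  exact X.param_add_of_mem_intLattice φ (D.coords_fst_mem hz) hl'

theorem eventually_mem_cover (L : LocalSystem S) {z : Coord g} (hz : z ∈ D.dom) {i : L.ι}
    (hi : D.pt z ∈ L.cover i) : ∀ᶠ z' in 𝓝 z, z' ∈ D.dom ∧ D.pt z' ∈ L.cover i :=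
  have hdom := D.isOpen_dom.mem_nhds hz
  Filter.Eventually.and hdom
    ((D.continuousOn_pt.continuousAt hdom).eventually ((L.isOpen_cover i).mem_nhds hi))

end LocalModel

/-- A flat frame of the pull-back of a local system along the parametrization of a local model,
given by its components `e i` in the local frames of the local system. -/
structure FlatFrame {φ : ActionChart Λ} {x₀ : Coord g} (D : LocalModel S φ m x₀)
    (L : LocalSystem S) where
  /-- the components of the flat frame in the frames of the local system -/
  e : L.ι → Coord g → Circle
  glue : ∀ i j, ∀ z ∈ D.dom, D.pt z ∈ L.cover i → D.pt z ∈ L.cover j →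
    e i z = L.trans i j (D.pt z) * e j z
  locallyConstant : ∀ i, ∀ z ∈ D.dom, D.pt z ∈ L.cover i → ∀ᶠ z' in 𝓝 z, e i z' = e i z

theorem exists_flatFrame {φ : ActionChart Λ} {x₀ : Coord g}
    (D : LocalModel S φ m x₀) (L : LocalSystem S) : Nonempty (FlatFrame D L) := by
  classical
  have : ContractibleSpace D.dom := D.convex_dom.contractibleSpace ⟨0, D.zero_mem_dom⟩
  have : LocallyPathConnectedSpace D.dom := D.isOpen_dom.locallyPathConnectedSpace
  obtain ⟨e₀, glue, locallyConstant⟩ := L.exists_flat_frame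
    (⟨D.dom.domRestrict D.pt, D.continuousOn_pt.domRestrict⟩ : C(D.dom, X Λ))
    (fun z => D.pt_mem z.2)
  let e : L.ι → Coord g → Circle := fun i z => if h : z ∈ D.dom then e₀ i ⟨z, h⟩ else 1
  have he : ∀ i z (hz : z ∈ D.dom), e i z = e₀ i ⟨z, hz⟩ := fun i z hz => dif_pos hz
  refine ⟨⟨e, fun i j z hz hi hj => ?_, fun i z hz hi => ?_⟩⟩
  · rw [he i z hz, he j z hz]
    exact glue i j ⟨z, hz⟩ hi hj
  · have hconst := locallyConstant i ⟨z, hz⟩ hi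
    rw [nhds_subtype_eq_comap, eventually_comap] at hconst
    filter_upwards [hconst, D.isOpen_dom.mem_nhds hz] with z' hz' hzd
    rw [he i z hz, he i z' hzd]
    exact hz' ⟨z', hzd⟩ rfl

namespace FlatFrame

variable {φ : ActionChart Λ} {x₀ : Coord g} {D : LocalModel S φ m x₀} {L : LocalSystem S}
  (E : FlatFrame D L)

/-- The holonomy of the local system along the loop in `S` that lifts to the segment from `0` to
`l ∈ W ∩ ℤ^g`. -/
def hol (l : Coord g) : Circle :=
  let i := (L.exists_mem_cover (D.pt_mem D.zero_mem_dom)).choose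
  E.e i (0 + l) / E.e i 0

theorem e_add_div_e_eq {l z : Coord g} (hl : l ∈ D.W) (hl' : l ∈ intLattice g) (hz : z ∈ D.dom)
    {i j : L.ι} (hi : D.pt z ∈ L.cover i) (hj : D.pt z ∈ L.cover j) :
    E.e i (z + l) / E.e i z = E.e j (z + l) / E.e j z := by
  have hpt := D.pt_add hz hl hl'
  rw [E.glue i j (z + l) (D.add_mem_dom hz hl) (hpt ▸ hi) (hpt ▸ hj), hpt, E.glue i j z hz hi hj,
    mul_div_mul_left_eq_div]

theorem eventually_e_add_div_e_eq {l z : Coord g} (hl : l ∈ D.W) (hl' : l ∈ intLattice g)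
    (hz : z ∈ D.dom) {i : L.ι} (hi : D.pt z ∈ L.cover i) :
    ∀ᶠ z' in 𝓝 z, E.e i (z' + l) / E.e i z' = E.e i (z + l) / E.e i z := by
  have htranslate : Tendsto (· + l) (𝓝 z) (𝓝 (z + l)) := (continuous_add_const l).continuousAt
  filter_upwards [E.locallyConstant i z hz hi, htranslate.eventually <|
    E.locallyConstant i (z + l) (D.add_mem_dom hz hl) (D.pt_add hz hl hl' ▸ hi)] with z' h h'
  rw [h, h']

theorem e_add (i : L.ι) (z : Coord g) (hz : z ∈ D.dom) (hi : D.pt z ∈ L.cover i) (l : Coord g)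
    (hl : l ∈ D.W) (hl' : l ∈ intLattice g) : E.e i (z + l) = E.hol l * E.e i z := by
  refine div_eq_iff_eq_mul.1 <| D.convex_dom.isPreconnected.induction₂
    (fun z z' => ∀ i j, D.pt z ∈ L.cover i → D.pt z' ∈ L.cover j →
      E.e i (z + l) / E.e i z = E.e j (z' + l) / E.e j z') (fun z hz => ?_)
    (fun z z' z'' _ hz' _ h h' i k hi hk => ?_)
    (fun z z' _ _ h i j hi hj => (h j i hj hi).symm) hz D.zero_mem_dom i _ hi
    (L.exists_mem_cover (D.pt_mem D.zero_mem_dom)).choose_spec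
  · obtain ⟨k, hk⟩ := L.exists_mem_cover (D.pt_mem hz)
    refine mem_nhdsWithin_of_mem_nhds ?_
    filter_upwards [E.eventually_e_add_div_e_eq hl hl' hz hk, D.eventually_mem_cover L hz hk]
      with z' hconst ⟨hz', hk'⟩ i j hi hj
    rw [E.e_add_div_e_eq hl hl' hz hi hk, E.e_add_div_e_eq hl hl' hz' hj hk', hconst]
  · obtain ⟨j, hj⟩ := L.exists_mem_cover (D.pt_mem hz')
    exact (h i j hi hj).trans (h' j k hj hk)

end FlatFrame

end ModelFrame

section Character

open scoped FourierTransform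

theorem fourierChar_eq_one_iff {r : ℝ} : 𝐞 r = 1 ↔ ∃ n : ℤ, r = n := by
  rw [Real.fourierChar_apply', Circle.exp_eq_one]
  refine exists_congr fun n => ?_
  rw [mul_comm (n : ℝ), mul_right_inj' Real.two_pi_pos.ne']

theorem fourierChar_inner_eq_one {g : ℕ} {n μ : Coord g} (hn : n ∈ intLattice g)
    (hμ : μ ∈ intLattice g) : 𝐞 (inner ℝ n μ) = 1 :=
  fourierChar_eq_one_iff.2 (exists_int_inner_eq hn hμ)

theorem cexp_neg_eq_fourierChar (r : ℝ) :
    Complex.exp (-(2 * Real.pi * Complex.I * r)) = 𝐞 (-r) := by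
  rw [Real.fourierChar_apply]
  push_cast
  ring_nf

theorem contDiff_fourierChar : ContDiff ℝ ∞ fun r : ℝ => (𝐞 r : ℂ) := by
  simp only [Real.fourierChar_apply]
  exact ((Complex.ofRealCLM.contDiff.comp (contDiff_const.mul contDiff_id)).mul contDiff_const).cexp

end Character

section ModelForms

open scoped FourierTransform

variable {g : ℕ} {B : Type*} [TopologicalSpace B] [ChartedSpace (Coord g) B]
  {Λ : LagrangianCovering g B} {S : Set (X Λ)} {m : ℕ} {L : LocalSystem S}
  {φ : ActionChart Λ} {x₀ : Coord g} {q : ℕ}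

namespace LocalModel

variable (D : LocalModel S φ m x₀)

/-- The base point of the fibre containing the point with parameter `z`. -/
abbrev base (z : Coord g) : B := φ.1.symm (D.coords z).1

theorem base_mem {z : Coord g} (hz : z ∈ D.dom) : D.base z ∈ φ.1.source :=
  φ.1.map_target (D.coords_fst_mem hz)

theorem chart_base {z : Coord g} (hz : z ∈ D.dom) : φ.1 (D.base z) = (D.coords z).1 :=
  φ.1.right_inv (D.coords_fst_mem hz)

theorem chart_base_mem_ball {z : Coord g} (hz : z ∈ D.dom) :
    φ.1 (D.base z) ∈ Metric.ball x₀ D.r :=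
  D.chart_base hz ▸ D.coords_fst_mem_ball hz

theorem base_add {z w : Coord g} (hw : w ∈ D.W) : D.base (z + w) = D.base z := by
  rw [base, D.coords_add hw, base]

/-- The parameter space of `S ×_B U`. -/
def hatDom (U : Set (XHat Λ)) : Set (Coord g × Coord g) :=
  {p | p.1 ∈ D.dom ∧ XHat.param φ ((D.coords p.1).1, p.2) ∈ U}

theorem isOpen_hatDom {U : Set (XHat Λ)} (hU : IsOpen U) : IsOpen (D.hatDom U) := by
  have hcont : ContinuousOn (fun p : Coord g × Coord g => XHat.param φ ((D.coords p.1).1, p.2))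
      {p | p.1 ∈ D.dom} := by
    refine (XHat.continuousOn_param φ).comp ?_ fun p hp => D.coords_fst_mem hp
    exact ((continuous_fst.comp_continuousOn D.contDiffOn_coords.continuousOn).comp
      continuousOn_fst fun p hp => hp).prodMk continuousOn_snd
  exact hcont.isOpen_inter_preimage (D.isOpen_dom.preimage continuous_fst) hU

theorem add_mem_hatDom {U : Set (XHat Λ)} {z w u : Coord g} (h : (z, w) ∈ D.hatDom U)
    (hu : u ∈ D.W) : (z + u, w) ∈ D.hatDom U := by
  refine ⟨D.add_mem_dom h.1 hu, ?_⟩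
  rw [D.coords_add hu]
  exact h.2

theorem add_mem_hatDom_of_mem_intLattice {U : Set (XHat Λ)} {z w μ : Coord g}
    (h : (z, w) ∈ D.hatDom U) (hμ : μ ∈ intLattice g) : (z, w + μ) ∈ D.hatDom U :=
  ⟨h.1, mem_of_eq_of_mem (XHat.param_add_of_mem_intLattice φ (D.coords_fst_mem h.1) hμ) h.2⟩

theorem hatDom_mono {U U' : Set (XHat Λ)} (h : U' ⊆ U) : D.hatDom U' ⊆ D.hatDom U :=
  fun _ hp => ⟨hp.1, h hp.2⟩

end LocalModel

/-- A relative form, trivialized on the parameter space of a local model of `S` by a flat frame. -/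
structure IsModelForm {D : LocalModel S φ m x₀} (E : FlatFrame D L) (U : Set (XHat Λ))
    (T : Coord g → Coord g → Coord g [⋀^Fin q]→ₗ[ℝ] ℂ) : Prop where
  smooth : ∀ u : Fin q → Coord g, (∀ a, u a ∈ D.W) →
    ContDiffOn ℝ ∞ (fun p : Coord g × Coord g => T p.1 p.2 u) (D.hatDom U)
  hol : ∀ z w, (z, w) ∈ D.hatDom U → ∀ l ∈ D.W, l ∈ intLattice g →
    ∀ u : Fin q → Coord g, (∀ a, u a ∈ D.W) →
      T (z + l) w u = (E.hol l : ℂ)⁻¹ * T z w u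
  automorphy : ∀ z w, (z, w) ∈ D.hatDom U → ∀ μ ∈ intLattice g,
    ∀ u : Fin q → Coord g, (∀ a, u a ∈ D.W) →
      T z (w + μ) u = 𝐞 (-inner ℝ (D.y z) μ) * T z w u

/-- `T` is the form `τ`, trivialized by the flat frame. -/
def Represents {D : LocalModel S φ m x₀} (E : FlatFrame D L) (U : Set (XHat Λ))
    (τ : FormData L q) (T : Coord g → Coord g → Coord g [⋀^Fin q]→ₗ[ℝ] ℂ) : Prop :=
  ∀ i z w, (z, w) ∈ D.hatDom U → D.pt z ∈ L.cover i → ∀ n ∈ intLattice g,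
    ∀ u : Fin q → Coord g, (∀ a, u a ∈ D.W) →
      τ i (D.base z) (cot φ.1 (D.base z) (D.y z + n)) (tan φ.1 (D.coords z).1 w)
        (fun a => cot φ.1 (D.base z) (u a)) = E.e i z * T z w u

/-- The covariant derivative along `v` of a trivialized form, in the direction of the fibres. -/
def covDeriv (T : Coord g → Coord g → Coord g [⋀^Fin q]→ₗ[ℝ] ℂ) (z w v : Coord g)
    (u : Fin q → Coord g) : ℂ :=
  deriv (fun t : ℝ => T (z + t • v) w u) 0 + 2 * Real.pi * Complex.I * (inner ℝ v w : ℝ) * T z w u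

/-- The differential `∇_r` of a trivialized form. -/
def modelRelD (T : Coord g → Coord g → Coord g [⋀^Fin q]→ₗ[ℝ] ℂ) (z w : Coord g)
    (u : Fin (q + 1) → Coord g) : ℂ :=
  ∑ a : Fin (q + 1), (-1 : ℂ) ^ (a : ℕ) * covDeriv T z w (u a) fun c => u (a.succAbove c)

theorem LocalModel.exists_index (D : LocalModel S φ m x₀) (L : LocalSystem S) :
    ∃ idx : Coord g → L.ι, ∀ z ∈ D.dom, D.pt z ∈ L.cover (idx z) := by
  have : Nonempty L.ι := ⟨(L.exists_mem_cover (D.pt_mem D.zero_mem_dom)).choose⟩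
  choose! idx hidx using fun z (hz : z ∈ D.dom) => L.exists_mem_cover (D.pt_mem hz)
  exact ⟨idx, hidx⟩

theorem LocalModel.mk_eq_pt (D : LocalModel S φ m x₀) {z n : Coord g} (hz : z ∈ D.dom)
    (hn : n ∈ intLattice g) : X.mk (cot φ.1 (D.base z) (D.y z + n)) = D.pt z :=
  X.param_add_of_mem_intLattice φ (D.coords_fst_mem hz) hn

theorem LocalModel.cot_mem_vertTangent (D : LocalModel S φ m x₀) {z n u : Coord g}
    (hz : z ∈ D.dom) (hn : n ∈ intLattice g) (hu : u ∈ D.W) :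
    cot φ.1 (D.base z) u ∈ vertTangent S (cot φ.1 (D.base z) (D.y z + n)) := by
  rw [D.mem_vertTangent_iff (D.base_mem hz) (D.chart_base_mem_ball hz)
    (by rw [D.mk_eq_pt hz hn]; exact D.pt_mem hz), ycoord_cot φ.2.1 (D.base_mem hz)]
  exact hu

variable {D : LocalModel S φ m x₀} {E : FlatFrame D L} {U : Set (XHat Λ)} {τ : FormData L q}
  {T : Coord g → Coord g → Coord g [⋀^Fin q]→ₗ[ℝ] ℂ}

theorem Represents.relD_eq (hT : Represents E U τ T) {i : L.ι} {z w n : Coord g}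
    (hzw : (z, w) ∈ D.hatDom U) (hi : D.pt z ∈ L.cover i) (hn : n ∈ intLattice g)
    {u : Fin (q + 1) → Coord g} (hu : ∀ a, u a ∈ D.W) :
    relD τ i (D.base z) (cot φ.1 (D.base z) (D.y z + n)) (tan φ.1 (D.coords z).1 w)
      (fun a => cot φ.1 (D.base z) (u a)) = E.e i z * modelRelD T z w u := by
  rw [relD, modelRelD, Finset.mul_sum]
  refine Finset.sum_congr rfl fun a _ => ?_
  have hvalues : (fun t : ℝ => τ i (D.base z)
      (cot φ.1 (D.base z) (D.y z + n) + t • cot φ.1 (D.base z) (u a)) (tan φ.1 (D.coords z).1 w)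
      (fun c => cot φ.1 (D.base z) (u (a.succAbove c)))) =ᶠ[𝓝 0]
      fun t : ℝ => E.e i z * T (z + t • u a) w (fun c => u (a.succAbove c)) := by
    have hline : Tendsto (fun t : ℝ => z + t • u a) (𝓝 0) (𝓝 z) :=
      Continuous.tendsto' (by fun_prop) _ _ (by simp)
    filter_upwards [hline.eventually (D.eventually_mem_cover L hzw.1 hi),
      hline.eventually (E.locallyConstant i z hzw.1 hi)] with t ⟨_, hit⟩ het
    have hW := D.W.smul_mem t (hu a)
    have hτT := hT i (z + t • u a) w (D.add_mem_hatDom hzw hW) hit n hn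
      (fun c => u (a.succAbove c)) fun c => hu _
    rw [het, D.y_add z _ hW, D.base_add hW, D.coords_add hW] at hτT
    rw [← hτT, ← cot_smul, ← cot_add, add_right_comm]
  rw [hvalues.deriv_eq, deriv_const_mul_field, hT i z w hzw hi n hn _ fun c => hu _,
    cot_tan φ.2.1 (D.coords_fst_mem hzw.1), covDeriv]
  ring

theorem Represents.eq_inv_mul (hT : Represents E U τ T) {i : L.ι} {z w n : Coord g}
    (hzw : (z, w) ∈ D.hatDom U) (hi : D.pt z ∈ L.cover i) (hn : n ∈ intLattice g)
    {u : Fin q → Coord g} (hu : ∀ a, u a ∈ D.W) :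
    T z w u = (E.e i z : ℂ)⁻¹ * τ i (D.base z) (cot φ.1 (D.base z) (D.y z + n))
      (tan φ.1 (D.coords z).1 w) (fun a => cot φ.1 (D.base z) (u a)) := by
  rw [hT i z w hzw hi n hn u hu, inv_mul_cancel_left₀ (Circle.coe_ne_zero _)]

/-- The trivialization of a form by a flat frame. -/
def trivialize (E : FlatFrame D L) (τ : FormData L q) (idx : Coord g → L.ι) (z w : Coord g) :
    Coord g [⋀^Fin q]→ₗ[ℝ] ℂ :=
  (E.e (idx z) z : ℂ)⁻¹ • (τ (idx z) (D.base z) (cot φ.1 (D.base z) (D.y z))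
    (tan φ.1 (D.coords z).1 w)).compLinearMap (cotₗ φ.1 (D.base z))

namespace IsRelForm

theorem add_lattice (hτ : IsRelForm L U τ) {i : L.ι} {z w n : Coord g}
    (hzw : (z, w) ∈ D.hatDom U) (hi : D.pt z ∈ L.cover i) (hn : n ∈ intLattice g)
    {u : Fin q → Coord g} (hu : ∀ a, u a ∈ D.W) :
    τ i (D.base z) (cot φ.1 (D.base z) (D.y z + n)) (tan φ.1 (D.coords z).1 w)
        (fun a => cot φ.1 (D.base z) (u a)) =
      τ i (D.base z) (cot φ.1 (D.base z) (D.y z)) (tan φ.1 (D.coords z).1 w)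
        (fun a => cot φ.1 (D.base z) (u a)) := by
  have hmk := D.mk_eq_pt hzw.1 (zero_mem _)
  have hvert := fun a => D.cot_mem_vertTangent hzw.1 (zero_mem _) (hu a)
  rw [add_zero] at hmk hvert
  have h := hτ.automorphy i (D.base z) (cot φ.1 (D.base z) (D.y z)) (tan φ.1 (D.coords z).1 w)
    (hmk ▸ ⟨D.pt_mem hzw.1, hi⟩) hzw.2 _ ((cot_mem_lattice φ (D.base_mem hzw.1)).2 hn) 0
    (zero_mem _) (fun a => cot φ.1 (D.base z) (u a)) hvert
  simpa only [cot_add, add_zero, map_zero, Complex.ofReal_zero, mul_zero, neg_zero,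
    Complex.exp_zero, one_mul] using h

theorem add_dualLattice (hτ : IsRelForm L U τ) {i : L.ι} {z w μ : Coord g}
    (hzw : (z, w) ∈ D.hatDom U) (hi : D.pt z ∈ L.cover i) (hμ : μ ∈ intLattice g)
    {u : Fin q → Coord g} (hu : ∀ a, u a ∈ D.W) :
    τ i (D.base z) (cot φ.1 (D.base z) (D.y z)) (tan φ.1 (D.coords z).1 (w + μ))
        (fun a => cot φ.1 (D.base z) (u a)) =
      𝐞 (-inner ℝ (D.y z) μ) *
        τ i (D.base z) (cot φ.1 (D.base z) (D.y z)) (tan φ.1 (D.coords z).1 w)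
          (fun a => cot φ.1 (D.base z) (u a)) := by
  have hmk := D.mk_eq_pt hzw.1 (zero_mem _)
  have hvert := fun a => D.cot_mem_vertTangent hzw.1 (zero_mem _) (hu a)
  rw [add_zero] at hmk hvert
  have hx := D.coords_fst_mem hzw.1
  have hdual : tan φ.1 (D.coords z).1 μ ∈ dualLattice Λ (D.base z) := by
    rwa [mem_dualLattice_iff φ (D.base_mem hzw.1), wcoord_tan φ.2.1 hx]
  have h := hτ.automorphy i (D.base z) (cot φ.1 (D.base z) (D.y z)) (tan φ.1 (D.coords z).1 w)
    (hmk ▸ ⟨D.pt_mem hzw.1, hi⟩) hzw.2 0 (zero_mem _) _ hdual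
    (fun a => cot φ.1 (D.base z) (u a)) hvert
  rwa [add_zero, cot_tan φ.2.1 hx, ← tan_add, cexp_neg_eq_fourierChar] at h

theorem represents (hτ : IsRelForm L U τ) (E : FlatFrame D L) {idx : Coord g → L.ι}
    (hidx : ∀ z ∈ D.dom, D.pt z ∈ L.cover (idx z)) :
    Represents E U τ (trivialize E τ idx) := by
  intro i z w hzw hi n hn u hu
  have hmk := D.mk_eq_pt hzw.1 (zero_mem _)
  have hvert := fun a => D.cot_mem_vertTangent hzw.1 (zero_mem _) (hu a)
  rw [add_zero] at hmk hvert
  have hglue := hτ.glue i (idx z) (D.base z) (cot φ.1 (D.base z) (D.y z))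
    (tan φ.1 (D.coords z).1 w) (hmk ▸ ⟨D.pt_mem hzw.1, hi, hidx z hzw.1⟩) hzw.2
    (fun a => cot φ.1 (D.base z) (u a)) hvert
  have hframe : (E.e i z : ℂ) = L.trans i (idx z) (D.pt z) * E.e (idx z) z := by
    rw [E.glue i (idx z) z hzw.1 hi (hidx z hzw.1), Circle.coe_mul]
  rw [hτ.add_lattice hzw hi hn hu, hglue, hmk, hframe, trivialize, AlternatingMap.smul_apply,
    smul_eq_mul, mul_assoc, mul_inv_cancel_left₀ (Circle.coe_ne_zero _)]
  rfl

theorem contDiffOn_of_represents (hτ : IsRelForm L U τ) (hT : Represents E U τ T) (hU : IsOpen U)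
    {u : Fin q → Coord g} (hu : ∀ a, u a ∈ D.W) :
    ContDiffOn ℝ ∞ (fun p : Coord g × Coord g => T p.1 p.2 u) (D.hatDom U) := by
  rintro ⟨z₀, w₀⟩ h₀
  obtain ⟨i, hi⟩ := L.exists_mem_cover (D.pt_mem h₀.1)
  have hfst : Tendsto (Prod.fst : Coord g × Coord g → Coord g) (𝓝 (z₀, w₀)) (𝓝 z₀) :=
    continuous_fst.continuousAt
  have hnear : ∀ᶠ p : Coord g × Coord g in 𝓝 (z₀, w₀), p ∈ D.hatDom U ∧ D.pt p.1 ∈ L.cover i :=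
    Filter.Eventually.and ((D.isOpen_hatDom hU).mem_nhds h₀) <|
      (hfst.eventually (D.eventually_mem_cover L h₀.1 hi)).mono fun _ hp => hp.2
  let G : Coord g × Coord g → Coord g × Coord g × Coord g :=
    fun p => ((D.coords p.1).1, (D.coords p.1).2, p.2)
  have hG : ContDiffAt ℝ ∞ G (z₀, w₀) := by
    have hcoords : ContDiffAt ℝ ∞ (fun p : Coord g × Coord g => D.coords p.1) (z₀, w₀) :=
      ContDiffAt.comp (g := D.coords) (z₀, w₀)
        (D.contDiffOn_coords.contDiffAt (D.isOpen_dom.mem_nhds h₀.1)) contDiffAt_fst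
    exact (contDiffAt_fst.comp _ hcoords).prodMk
      ((contDiffAt_snd.comp _ hcoords).prodMk contDiffAt_snd)
  have hmaps : MapsTo G {p | p ∈ D.hatDom U ∧ D.pt p.1 ∈ L.cover i}
      {p | p.1 ∈ φ.1.target ∧ X.param φ (p.1, p.2.1) ∈ S ∩ L.cover i ∧
        XHat.param φ (p.1, p.2.2) ∈ U} :=
    fun p hp => ⟨D.coords_fst_mem hp.1.1, ⟨D.pt_mem hp.1.1, hp.2⟩, hp.1.2⟩
  have hτG := (hτ.smooth i φ u (G (z₀, w₀)) (hmaps ⟨h₀, hi⟩)).comp (z₀, w₀)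
    hG.contDiffWithinAt hmaps
  refine (((contDiffWithinAt_const (c := (E.e i z₀ : ℂ)⁻¹)).mul hτG).contDiffAt
    hnear).congr_of_eventuallyEq ?_ |>.contDiffWithinAt
  filter_upwards [hnear, hfst.eventually (E.locallyConstant i z₀ h₀.1 hi)] with p hp he
  rw [hT.eq_inv_mul hp.1 hp.2 (zero_mem _) hu, he, add_zero]
  rfl

theorem isModelForm (hτ : IsRelForm L U τ) (hU : IsOpen U) (hT : Represents E U τ T) :
    IsModelForm E U T where
  smooth _ hu := hτ.contDiffOn_of_represents hT hU hu
  hol z w hzw l hl hl' u hu := by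
    obtain ⟨i, hi⟩ := L.exists_mem_cover (D.pt_mem hzw.1)
    have hTl := hT.eq_inv_mul (D.add_mem_hatDom hzw hl) (D.pt_add hzw.1 hl hl' ▸ hi)
      (zero_mem _) hu
    rw [hTl, D.base_add hl, D.y_add z l hl, D.coords_add hl, add_zero, hT i z w hzw hi l hl' u hu,
      E.e_add i z hzw.1 hi l hl hl', Circle.coe_mul, mul_inv, mul_assoc,
      inv_mul_cancel_left₀ (Circle.coe_ne_zero _)]
  automorphy z w hzw μ hμ u hu := by
    obtain ⟨i, hi⟩ := L.exists_mem_cover (D.pt_mem hzw.1)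
    have hzw' := D.add_mem_hatDom_of_mem_intLattice hzw hμ
    rw [hT.eq_inv_mul hzw hi (zero_mem _) hu, hT.eq_inv_mul hzw' hi (zero_mem _) hu, add_zero,
      hτ.add_dualLattice hzw hi hμ hu, mul_left_comm]

end IsRelForm

end ModelForms

section BuildForms

open scoped FourierTransform

variable {g : ℕ} {B : Type*} [TopologicalSpace B] [ChartedSpace (Coord g) B]
  {Λ : LagrangianCovering g B} {S : Set (X Λ)} {m : ℕ} {L : LocalSystem S}
  {φ : ActionChart Λ} {x₀ : Coord g} {q : ℕ}

namespace LocalModel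

variable (D : LocalModel S φ m x₀)

/-- A parameter of the point with action-angle coordinates `(x, y)`, if there is one. -/
def param (x y : Coord g) : Coord g :=
  Classical.epsilon fun z => z ∈ D.dom ∧ (D.coords z).1 = x ∧ y - D.y z ∈ intLattice g

/-- The part of `X̂` over the domain of a local model. -/
def hatBall : Set (XHat Λ) :=
  {ξ | ξ.1 ∈ φ.1.source ∧ φ.1 ξ.1 ∈ Metric.ball x₀ D.r}

variable {D}

theorem param_sub_mem {z n : Coord g} (hz : z ∈ D.dom) (hn : n ∈ intLattice g) :
    D.param (D.coords z).1 (D.y z + n) - z ∈ D.W ∧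
      D.param (D.coords z).1 (D.y z + n) - z ∈ intLattice g := by
  obtain ⟨-, hbase, hy⟩ := Classical.epsilon_spec (p := fun z' => z' ∈ D.dom ∧
    (D.coords z').1 = (D.coords z).1 ∧ D.y z + n - D.y z' ∈ intLattice g)
    ⟨z, hz, rfl, by simpa using hn⟩
  have hproj := add_left_cancel hbase
  refine ⟨D.sub_mem hproj, ?_⟩
  rw [D.y_eq hproj] at hy
  convert _root_.sub_mem hn hy using 1
  simp only [param]
  abel

theorem mk_eq_pt_of_coord_eq {b : B} (hb : b ∈ φ.1.source) {α : Cot g b} {z n : Coord g}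
    (hz : z ∈ D.dom) (hn : n ∈ intLattice g) (hx : φ.1 b = (D.coords z).1)
    (hy : ycoord φ.1 b α = D.y z + n) : X.mk α = D.pt z := by
  rw [X.mk_eq_param φ hb, hx, hy, X.param_add_of_mem_intLattice φ (D.coords_fst_mem hz) hn]
  rfl

theorem sub_mem_dom {x : Coord g} (hx : x ∈ Metric.ball x₀ D.r) : x - x₀ ∈ D.dom :=
  (Submodule.norm_starProjection_apply_le _ _).trans_lt (mem_ball_iff_norm.1 hx)

theorem exists_param {x y : Coord g} (hx : x ∈ Metric.ball x₀ D.r) (h : X.param φ (x, y) ∈ S) :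
    ∃ z ∈ D.dom, ∃ n ∈ intLattice g, x = (D.coords z).1 ∧ y = D.y z + n := by
  obtain ⟨z, n, hn, hz, hy⟩ := (D.mem_iff x hx y).1 h
  refine ⟨z, ?_, n, hn, by simp only [coords, hz, add_sub_cancel], hy⟩
  change ‖_‖ < _
  rw [hz]
  exact mem_ball_iff_norm.1 hx

theorem exists_param_of_mk_mem {b : B} (hb : b ∈ φ.1.source)
    (hbr : φ.1 b ∈ Metric.ball x₀ D.r) {α : Cot g b} (hα : X.mk α ∈ S) :
    ∃ z ∈ D.dom, ∃ n ∈ intLattice g, φ.1 b = (D.coords z).1 ∧ ycoord φ.1 b α = D.y z + n ∧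
      X.mk α = D.pt z := by
  obtain ⟨z, hz, n, hn, hx, hy⟩ := exists_param hbr (X.mk_eq_param φ hb α ▸ hα)
  exact ⟨z, hz, n, hn, hx, hy, mk_eq_pt_of_coord_eq hb hz hn hx hy⟩

theorem exists_sub_mem {x y : Coord g} (hx : x ∈ Metric.ball x₀ D.r)
    (h : X.param φ (x, y) ∈ S) :
    x - x₀ ∈ D.Wᗮ ∧ ∃ n ∈ intLattice g, y - D.y (x - x₀) - n ∈ D.W := by
  obtain ⟨z, n, hn, hz, rfl⟩ := (D.mem_iff x hx y).1 h
  have hmem : x - x₀ ∈ D.Wᗮ := hz ▸ D.Wᗮ.starProjection_apply_mem z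
  have hproj : D.Wᗮ.starProjection z = D.Wᗮ.starProjection (x - x₀) := by
    rw [hz, D.Wᗮ.starProjection_eq_self_iff.2 hmem]
  refine ⟨hmem, n, hn, ?_⟩
  rw [D.y_eq hproj]
  convert D.sub_mem hproj using 1
  abel

theorem coords_sub_add {x w : Coord g} (hx : x - x₀ ∈ D.Wᗮ) (hw : w ∈ D.W) :
    D.coords (x - x₀ + w) = (x, D.y (x - x₀) + w) := by
  rw [D.coords_add hw, coords, D.Wᗮ.starProjection_eq_self_iff.2 hx, add_sub_cancel]

/-- The lift is unique up to `ℤ^g`, whose image in `ℝ^g / W` is discrete; so near `p₀` a single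
lattice vector will do. -/
theorem exists_contDiffAt_param {V : Type*} [NormedAddCommGroup V] [NormedSpace ℝ V] {Q : Set V}
    {p₀ : V} (hp₀ : p₀ ∈ Q) {f h : V → Coord g} (hf : ContDiffAt ℝ ∞ f p₀)
    (hh : ContDiffAt ℝ ∞ h p₀) (hball : ∀ p ∈ Q, f p ∈ Metric.ball x₀ D.r)
    (hS : ∀ p ∈ Q, X.param φ (f p, h p) ∈ S) :
    ∃ ζ : V → Coord g, ContDiffAt ℝ ∞ ζ p₀ ∧ ∃ n ∈ intLattice g, ∀ᶠ p in 𝓝[Q] p₀,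
      ζ p ∈ D.dom ∧ f p = (D.coords (ζ p)).1 ∧ h p = D.y (ζ p) + n := by
  let γ : V → Coord g := fun p => h p - D.y (f p - x₀)
  have hγ : ContDiffAt ℝ ∞ γ p₀ :=
    hh.sub <| ContDiffAt.comp (g := D.y) p₀ (D.contDiffOn.contDiffAt <|
      D.isOpen_dom.mem_nhds (sub_mem_dom (hball p₀ hp₀))) (hf.sub contDiffAt_const)
  obtain ⟨-, n₀, hn₀, hγ₀⟩ := exists_sub_mem (hball p₀ hp₀) (hS p₀ hp₀)
  have hconst : ∀ᶠ p in 𝓝[Q] p₀, γ p - γ p₀ ∈ D.W := by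
    refine D.rational.eventually_mem (hγ.continuousAt.tendsto.mono_left nhdsWithin_le_nhds) ?_
    filter_upwards [self_mem_nhdsWithin] with p hp
    obtain ⟨-, n, hn, hγp⟩ := exists_sub_mem (hball p hp) (hS p hp)
    refine ⟨n - n₀, _root_.sub_mem hn hn₀, ?_⟩
    convert _root_.sub_mem hγp hγ₀ using 1
    simp only [γ]
    abel
  refine ⟨fun p => f p - x₀ + D.W.starProjection (γ p - n₀), (hf.sub contDiffAt_const).add
    (D.W.starProjection.contDiff.contDiffAt.comp p₀ (hγ.sub contDiffAt_const)), n₀, hn₀, ?_⟩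
  filter_upwards [hconst, self_mem_nhdsWithin] with p hp hpQ
  have hmem : γ p - n₀ ∈ D.W := by
    convert add_mem hp hγ₀ using 1
    simp only [γ]
    abel
  have hxW := (exists_sub_mem (hball p hpQ) (hS p hpQ)).1
  rw [D.W.starProjection_eq_self_iff.2 hmem, coords_sub_add hxW hmem, D.y_add _ _ hmem]
  refine ⟨D.add_mem_dom (sub_mem_dom (hball p hpQ)) hmem, rfl, ?_⟩
  simp only [γ]
  abel

end LocalModel

/-- The relative form defined by its trivialization. -/
def ofModel {D : LocalModel S φ m x₀} (E : FlatFrame D L)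
    (T : Coord g → Coord g → Coord g [⋀^Fin q]→ₗ[ℝ] ℂ) : FormData L q :=
  fun i b α v => (E.e i (D.param (φ.1 b) (ycoord φ.1 b α)) : ℂ) •
    (T (D.param (φ.1 b) (ycoord φ.1 b α)) (wcoord φ.1 b v)).compLinearMap
      (D.W.starProjection.toLinearMap ∘ₗ ycoord φ.1 b)

section Smoothness

variable {V : Type*} [NormedAddCommGroup V] [NormedSpace ℝ V] {W : Submodule ℝ (Coord g)}

theorem alternatingMap_starProjection_eq_sum (T : Coord g [⋀^Fin q]→ₗ[ℝ] ℂ)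
    (u : Fin q → Coord g) : (T fun a => W.starProjection (u a)) =
      ∑ k : Fin q → Fin g, ((∏ a, u a (k a) : ℝ) : ℂ) *
        T fun a => W.starProjection (EuclideanSpace.single (k a) 1) := by
  have hbasis : ∀ a, W.starProjection (u a) =
      ∑ j, u a j • W.starProjection (EuclideanSpace.single j 1) := fun a => by
    conv_lhs => rw [← (EuclideanSpace.basisFun (Fin g) ℝ).sum_repr (u a), map_sum]
    simp only [map_smul, EuclideanSpace.basisFun_repr, EuclideanSpace.basisFun_apply]
  simp only [hbasis]
  refine (T.toMultilinearMap.map_sum fun a j =>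
    u a j • W.starProjection (EuclideanSpace.single j (1 : ℝ))).trans
      (Finset.sum_congr rfl fun k _ => ?_)
  rw [MultilinearMap.map_smul_univ, Complex.real_smul]
  rfl

theorem contDiffWithinAt_alternatingMap {T : V → Coord g [⋀^Fin q]→ₗ[ℝ] ℂ} {Q : Set V} {p₀ : V}
    (hT : ∀ u : Fin q → Coord g, (∀ a, u a ∈ W) → ContDiffWithinAt ℝ ∞ (fun p => T p u) Q p₀)
    {u : V → Fin q → Coord g} (hu : ∀ a, ContDiffWithinAt ℝ ∞ (fun p => u p a) Q p₀) :
    ContDiffWithinAt ℝ ∞ (fun p => T p fun a => W.starProjection (u p a)) Q p₀ := by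
  simp only [fun p => alternatingMap_starProjection_eq_sum (W := W) (T p) (u p)]
  refine ContDiffWithinAt.sum fun k _ => ContDiffWithinAt.mul ?_ (hT _ fun a =>
    W.starProjection_apply_mem _)
  refine Complex.ofRealCLM.contDiff.contDiffAt.comp_contDiffWithinAt p₀ ?_
  exact contDiffWithinAt_prod (t := Finset.univ) (f := fun a p => u p a (k a)) fun a _ =>
    (contDiffWithinAt_euclidean.1 (hu a)) (k a)

end Smoothness

variable {D : LocalModel S φ m x₀} {E : FlatFrame D L}
  {U : Set (XHat Λ)} {T : Coord g → Coord g → Coord g [⋀^Fin q]→ₗ[ℝ] ℂ}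

theorem LocalModel.mem_hatDom_of_mk_mem {b : B} (hb : b ∈ φ.1.source) {v : Tan g b}
    (hv : XHat.mk v ∈ U) {z : Coord g} (hz : z ∈ D.dom) (hx : φ.1 b = (D.coords z).1) :
    (z, wcoord φ.1 b v) ∈ D.hatDom U := by
  rw [XHat.mk_eq_param φ hb, hx] at hv
  exact ⟨hz, hv⟩

namespace IsModelForm

theorem ofModel_apply (hT : IsModelForm E U T) {i : L.ι} {b : B} (hb : b ∈ φ.1.source)
    {α : Cot g b} {v : Tan g b} {z n : Coord g} (hz : z ∈ D.dom) (hn : n ∈ intLattice g)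
    (hi : D.pt z ∈ L.cover i) (hx : φ.1 b = (D.coords z).1) (hy : ycoord φ.1 b α = D.y z + n)
    (hv : XHat.mk v ∈ U) (u : Fin q → Cot g b) :
    ofModel E T i b α v u = E.e i z * T z (wcoord φ.1 b v)
      (fun a => D.W.starProjection (ycoord φ.1 b (u a))) := by
  obtain ⟨l, hl⟩ : ∃ l, D.param (D.coords z).1 (D.y z + n) = z + l := ⟨_, (add_sub_cancel _ _).symm⟩
  obtain ⟨hlW, hlℤ⟩ := LocalModel.param_sub_mem hz hn
  rw [hl, add_sub_cancel_left] at hlW hlℤ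
  rw [ofModel, hx, hy, hl, AlternatingMap.smul_apply, AlternatingMap.compLinearMap_apply,
    smul_eq_mul]
  change _ * T (z + l) (wcoord φ.1 b v) (fun a => D.W.starProjection (ycoord φ.1 b (u a))) = _
  rw [hT.hol z _ (D.mem_hatDom_of_mk_mem hb hv hz hx) l hlW hlℤ _
    fun a => D.W.starProjection_apply_mem _, E.e_add i z hz hi l hlW hlℤ, Circle.coe_mul, mul_assoc,
    mul_left_comm, mul_inv_cancel_left₀ (Circle.coe_ne_zero _)]

theorem represents_ofModel (hT : IsModelForm E U T) : Represents E U (ofModel E T) T := by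
  intro i z w hzw hi n hn u hu
  have hb := D.base_mem hzw.1
  rw [hT.ofModel_apply hb hzw.1 hn hi (D.chart_base hzw.1) (ycoord_cot φ.2.1 hb _) hzw.2,
    wcoord_tan φ.2.1 (D.coords_fst_mem hzw.1)]
  congr 2
  ext1 a
  rw [ycoord_cot φ.2.1 hb, D.W.starProjection_eq_self_iff.2 (hu a)]

theorem contDiffWithinAt_apply (hT : IsModelForm E U T) (hU : IsOpen U) {V : Type*}
    [NormedAddCommGroup V] [NormedSpace ℝ V] {Q : Set V} {p₀ : V} {ζ w : V → Coord g}
    {u : V → Fin q → Coord g} (h : (ζ p₀, w p₀) ∈ D.hatDom U) (hζ : ContDiffWithinAt ℝ ∞ ζ Q p₀)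
    (hw : ContDiffWithinAt ℝ ∞ w Q p₀) (hu : ∀ a, ContDiffWithinAt ℝ ∞ (fun p => u p a) Q p₀) :
    ContDiffWithinAt ℝ ∞ (fun p => T (ζ p) (w p) fun a => D.W.starProjection (u p a)) Q p₀ :=
  contDiffWithinAt_alternatingMap (T := fun p => T (ζ p) (w p)) (fun v hv => by
    have hTv : ContDiffAt ℝ ∞ (fun r : Coord g × Coord g => T r.1 r.2 v) (ζ p₀, w p₀) :=
      (hT.smooth v hv).contDiffAt ((D.isOpen_hatDom hU).mem_nhds h)
    exact hTv.comp_contDiffWithinAt (f := fun p => (ζ p, w p)) p₀ (hζ.prodMk hw)) hu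

theorem contDiffOn_ofModel (hT : IsModelForm E U T) (hUo : IsOpen U) (hU : U ⊆ D.hatBall)
    (i : L.ι) (ψ : ActionChart Λ) (u : Fin q → Coord g) :
    ContDiffOn ℝ ∞
      (fun p : Coord g × Coord g × Coord g =>
        ofModel E T i (ψ.1.symm p.1) (cot ψ.1 (ψ.1.symm p.1) p.2.1) (tan ψ.1 p.1 p.2.2)
          (fun j => cot ψ.1 (ψ.1.symm p.1) (u j)))
      {p | p.1 ∈ ψ.1.target ∧ X.param ψ (p.1, p.2.1) ∈ S ∩ L.cover i ∧
        XHat.param ψ (p.1, p.2.2) ∈ U} := by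
  set Q := {p : Coord g × Coord g × Coord g | p.1 ∈ ψ.1.target ∧
    X.param ψ (p.1, p.2.1) ∈ S ∩ L.cover i ∧ XHat.param ψ (p.1, p.2.2) ∈ U}
  intro p₀ hp₀
  have hbase : ∀ p ∈ Q, ψ.1.symm p.1 ∈ φ.1.source ∧ φ.1 (ψ.1.symm p.1) ∈ Metric.ball x₀ D.r :=
    fun p hp => hU hp.2.2
  have hb₀ := (hbase p₀ hp₀).1
  have hx : ContDiffAt ℝ ∞ (fun p : Coord g × Coord g × Coord g => φ.1 (ψ.1.symm p.1)) p₀ :=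
    ContDiffAt.comp (g := fun x => φ.1 (ψ.1.symm x)) p₀ ((contDiffOn_transition ψ.2.1
      φ.2.1).contDiffAt ((isOpen_transition_domain ψ.1 φ.1).mem_nhds ⟨hp₀.1, hb₀⟩)) contDiffAt_fst
  have hy : ContDiffAt ℝ ∞ (fun p : Coord g × Coord g × Coord g =>
      ycoord φ.1 (ψ.1.symm p.1) (cot ψ.1 (ψ.1.symm p.1) p.2.1)) p₀ :=
    contDiffAt_ycoord_cot ψ.2.1 φ.2.1 contDiffAt_fst contDiffAt_snd.fst hp₀.1 hb₀
  have hw : ContDiffAt ℝ ∞ (fun p : Coord g × Coord g × Coord g =>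
      wcoord φ.1 (ψ.1.symm p.1) (tan ψ.1 p.1 p.2.2)) p₀ :=
    contDiffAt_wcoord_tan ψ.2.1 φ.2.1 contDiffAt_fst contDiffAt_snd.snd hp₀.1 hb₀
  have hu : ∀ a, ContDiffAt ℝ ∞ (fun p : Coord g × Coord g × Coord g =>
      ycoord φ.1 (ψ.1.symm p.1) (cot ψ.1 (ψ.1.symm p.1) (u a))) p₀ := fun a =>
    contDiffAt_ycoord_cot ψ.2.1 φ.2.1 contDiffAt_fst contDiffAt_const hp₀.1 hb₀
  obtain ⟨ζ, hζ, n, hn, hcoords⟩ := LocalModel.exists_contDiffAt_param hp₀ hx hy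
    (fun p hp => (hbase p hp).2) fun p hp => X.mk_eq_param φ (hbase p hp).1 _ ▸ hp.2.1.1
  have hcover : ∀ p ∈ Q, ζ p ∈ D.dom ∧ φ.1 (ψ.1.symm p.1) = (D.coords (ζ p)).1 ∧
      ycoord φ.1 (ψ.1.symm p.1) (cot ψ.1 (ψ.1.symm p.1) p.2.1) = D.y (ζ p) + n →
      D.pt (ζ p) ∈ L.cover i := fun p hp ⟨hζp, hxp, hyp⟩ =>
    LocalModel.mk_eq_pt_of_coord_eq (hbase p hp).1 hζp hn hxp hyp ▸ hp.2.1.2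
  have hcoords₀ := hcoords.self_of_nhdsWithin hp₀
  have hframe : ∀ᶠ p in 𝓝[Q] p₀, E.e i (ζ p) = E.e i (ζ p₀) :=
    (hζ.continuousAt.tendsto.mono_left nhdsWithin_le_nhds).eventually
      (E.locallyConstant i _ hcoords₀.1 (hcover p₀ hp₀ hcoords₀))
  have hTζ := hT.contDiffWithinAt_apply hUo (D.mem_hatDom_of_mk_mem hb₀ hp₀.2.2 hcoords₀.1
    hcoords₀.2.1) (Q := Q) hζ.contDiffWithinAt hw.contDiffWithinAt
    fun a => (hu a).contDiffWithinAt
  refine ((contDiffWithinAt_const (c := (E.e i (ζ p₀) : ℂ))).mul hTζ).congr_of_eventuallyEq_of_mem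
    ?_ hp₀
  filter_upwards [hcoords, hframe, self_mem_nhdsWithin] with p hp he hpQ
  rw [hT.ofModel_apply (hbase p hpQ).1 hp.1 hn (hcover p hpQ hp) hp.2.1 hp.2.2 hpQ.2.2, he]

theorem isRelForm_ofModel (hT : IsModelForm E U T) (hUo : IsOpen U) (hU : U ⊆ D.hatBall) :
    IsRelForm L U (ofModel E T) where
  smooth := hT.contDiffOn_ofModel hUo hU
  glue i j b α v hα hv u _ := by
    obtain ⟨hb, hbr⟩ : b ∈ φ.1.source ∧ φ.1 b ∈ Metric.ball x₀ D.r := hU hv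
    obtain ⟨z, hz, n, hn, hx, hy, hpt⟩ := LocalModel.exists_param_of_mk_mem hb hbr hα.1
    rw [hpt] at hα ⊢
    rw [hT.ofModel_apply hb hz hn hα.2.1 hx hy hv, hT.ofModel_apply hb hz hn hα.2.2 hx hy hv,
      E.glue i j z hz hα.2.1 hα.2.2, Circle.coe_mul, mul_assoc]
  automorphy i b α v hα hv l hl μ hμ u _ := by
    obtain ⟨hb, hbr⟩ : b ∈ φ.1.source ∧ φ.1 b ∈ Metric.ball x₀ D.r := hU hv
    obtain ⟨z, hz, n, hn, hx, hy, hpt⟩ := LocalModel.exists_param_of_mk_mem hb hbr hα.1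
    have hi : D.pt z ∈ L.cover i := hpt ▸ hα.2
    have hlℤ := (mem_lattice_iff φ hb).1 hl
    have hμℤ := (mem_dualLattice_iff φ hb).1 hμ
    have hvμ : (XHat.mk (v + μ) : XHat Λ) ∈ U :=
      mem_of_eq_of_mem (XHat.mk_eq_mk.2 (by simpa using hμ)) hv
    have hyl : ycoord φ.1 b (α + l) = D.y z + (n + ycoord φ.1 b l) := by
      rw [map_add, hy, add_assoc]
    have hpairing : (𝐞 (-α μ) : ℂ) = 𝐞 (-inner ℝ (D.y z) (wcoord φ.1 b μ)) := by
      rw [← inner_ycoord φ.2.1 hb, hy, inner_add_left, AddChar.map_neg_eq_inv,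
        AddChar.map_add_eq_mul, fourierChar_inner_eq_one hn hμℤ, mul_one, AddChar.map_neg_eq_inv]
    rw [cexp_neg_eq_fourierChar, hpairing, hT.ofModel_apply hb hz hn hi hx hy hv,
      hT.ofModel_apply hb hz (add_mem hn hlℤ) hi hx hyl hvμ, map_add,
      hT.automorphy z _ (D.mem_hatDom_of_mk_mem hb hv hz hx) _ hμℤ _
        fun a => D.W.starProjection_apply_mem _, mul_left_comm]

end IsModelForm

end BuildForms

section ParametricIntegral

open MeasureTheory

theorem eventually_norm_le_of_continuousOn {V Y H : Type*} [TopologicalSpace V]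
    [TopologicalSpace Y] [SeminormedAddCommGroup H] {P : Set V} {K : Set Y} {F : V → Y → H}
    (hP : IsOpen P) (hK : IsCompact K) (hF : ContinuousOn (Function.uncurry F) (P ×ˢ univ)) {p₀ : V}
    (hp₀ : p₀ ∈ P) : ∃ C, ∀ᶠ p in 𝓝 p₀, ∀ s ∈ K, ‖F p s‖ ≤ C := by
  have hcont : ∀ s, ContinuousAt (Function.uncurry F) (p₀, s) := fun s =>
    hF.continuousAt ((hP.prod isOpen_univ).mem_nhds ⟨hp₀, trivial⟩)
  have hslice : Continuous (F p₀) := continuous_iff_continuousAt.2 fun s =>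
    (hcont s).comp (f := fun s => (p₀, s)) (by fun_prop)
  obtain ⟨C, hC⟩ := hK.exists_bound_of_continuousOn hslice.continuousOn
  refine ⟨C + 1, hK.eventually_forall_of_forall_eventually fun s hs => ?_⟩
  exact ((hcont s).norm.tendsto.eventually_lt_const ((hC s hs).trans_lt (lt_add_one C))).mono
    fun _ h => h.le

theorem continuous_slice {V Y H : Type*} [TopologicalSpace V] [TopologicalSpace Y]
    [TopologicalSpace H] {P : Set V} {F : V → Y → H} (hP : IsOpen P)
    (hF : ContinuousOn (Function.uncurry F) (P ×ˢ univ)) {p : V} (hp : p ∈ P) :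
    Continuous (F p) :=
  continuous_iff_continuousAt.2 fun s =>
    (hF.continuousAt ((hP.prod isOpen_univ).mem_nhds ⟨hp, trivial⟩)).comp
      (f := fun s => (p, s)) (by fun_prop)

section Differentiability

variable {V H : Type*} [NormedAddCommGroup V] [NormedAddCommGroup H] [NormedSpace ℝ H]
  {P : Set V} {F : V → ℝ → H} {a b : ℝ}

theorem continuousOn_parametric_integral (hP : IsOpen P)
    (hF : ContinuousOn (Function.uncurry F) (P ×ˢ univ)) :
    ContinuousOn (fun p => ∫ s in a..b, F p s) P := by
  intro p₀ hp₀
  obtain ⟨C, hC⟩ := eventually_norm_le_of_continuousOn hP (isCompact_uIcc (a := a) (b := b)) hF hp₀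
  refine (intervalIntegral.continuousAt_of_dominated_interval (bound := fun _ => C) ?_ ?_
    intervalIntegrable_const ?_).continuousWithinAt
  · filter_upwards [hP.mem_nhds hp₀] with p hp
    exact (continuous_slice hP hF hp).aestronglyMeasurable
  · filter_upwards [hC] with p hp
    exact Eventually.of_forall fun s hs => hp s (uIoc_subset_uIcc hs)
  · exact Eventually.of_forall fun s _ =>
      (hF.continuousAt ((hP.prod isOpen_univ).mem_nhds ⟨hp₀, trivial⟩)).comp
        (f := fun p => (p, s)) (by fun_prop)

variable [NormedSpace ℝ V]

theorem hasFDerivAt_parametric_integral (hP : IsOpen P)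
    (hF : ContDiffOn ℝ 1 (Function.uncurry F) (P ×ˢ univ)) {p₀ : V} (hp₀ : p₀ ∈ P) :
    HasFDerivAt (fun p => ∫ s in a..b, F p s)
      (∫ s in a..b, (fderiv ℝ (Function.uncurry F) (p₀, s)).comp
        (ContinuousLinearMap.inl ℝ V ℝ)) p₀ := by
  have hPo : IsOpen (P ×ˢ (univ : Set ℝ)) := hP.prod isOpen_univ
  let F' : V → ℝ → V →L[ℝ] H := fun p s =>
    (fderiv ℝ (Function.uncurry F) (p, s)).comp (ContinuousLinearMap.inl ℝ V ℝ)
  have hF' : ContinuousOn (Function.uncurry F') (P ×ˢ univ) :=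
    (hF.continuousOn_fderiv_of_isOpen hPo le_rfl).clm_comp continuousOn_const
  have hderiv : ∀ p ∈ P, ∀ s, HasFDerivAt (fun p => F p s) (F' p s) p := fun p hp s =>
    HasFDerivAt.comp (f := fun p => (p, s)) p ((hF.contDiffAt (hPo.mem_nhds
      ⟨hp, trivial⟩)).differentiableAt one_ne_zero).hasFDerivAt (hasFDerivAt_prodMk_left p s)
  obtain ⟨C, hC⟩ := eventually_norm_le_of_continuousOn hP (isCompact_uIcc (a := a) (b := b)) hF' hp₀
  refine intervalIntegral.hasFDerivAt_integral_of_dominated_of_fderiv_le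
    (s := {p | p ∈ P ∧ ∀ s ∈ uIcc a b, ‖F' p s‖ ≤ C}) (bound := fun _ => C) (F' := F')
    (Filter.Eventually.and (hP.mem_nhds hp₀) hC) ?_ ?_ ?_ ?_ intervalIntegrable_const ?_
  · filter_upwards [hP.mem_nhds hp₀] with p hp
    exact (continuous_slice hP hF.continuousOn hp).aestronglyMeasurable
  · exact (continuous_slice hP hF.continuousOn hp₀).intervalIntegrable _ _
  · exact (continuous_slice hP hF' hp₀).aestronglyMeasurable
  · exact Eventually.of_forall fun s hs p hp => hp.2 s (uIoc_subset_uIcc hs)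
  · exact Eventually.of_forall fun s _ p hp => hderiv p hp.1 s

end Differentiability

section Smoothness

universe v

variable {V : Type v} [NormedAddCommGroup V] [NormedSpace ℝ V] {P : Set V} {a b : ℝ}

/-- The induction replaces `H` by `V →L[ℝ] H`, so both have to live in the same universe. -/
theorem contDiffOn_parametric_integral_nat (hP : IsOpen P) (n : ℕ) {H : Type v}
    [NormedAddCommGroup H] [NormedSpace ℝ H] {F : V → ℝ → H}
    (hF : ContDiffOn ℝ n (Function.uncurry F) (P ×ˢ univ)) :
    ContDiffOn ℝ n (fun p => ∫ s in a..b, F p s) P := by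
  induction n generalizing H with
  | zero => exact contDiffOn_zero.2 (continuousOn_parametric_integral hP hF.continuousOn)
  | succ n ih =>
    have hPo : IsOpen (P ×ˢ (univ : Set ℝ)) := hP.prod isOpen_univ
    have hderiv : ∀ p ∈ P, HasFDerivAt (fun p => ∫ s in a..b, F p s) _ p := fun p hp =>
      hasFDerivAt_parametric_integral hP (hF.of_le (by norm_cast; omega)) hp
    have hF' : ContDiffOn ℝ n (Function.uncurry fun p s =>
        (fderiv ℝ (Function.uncurry F) (p, s)).comp (ContinuousLinearMap.inl ℝ V ℝ))
        (P ×ˢ univ) :=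
      (hF.fderiv_of_isOpen hPo (by norm_cast)).clm_comp contDiffOn_const
    rw [Nat.cast_add, Nat.cast_one, contDiffOn_succ_iff_fderiv_of_isOpen hP]
    exact ⟨fun p hp => (hderiv p hp).differentiableAt.differentiableWithinAt, by simp,
      (ih hF').congr fun p hp => (hderiv p hp).fderiv⟩

theorem contDiffOn_parametric_integral {H : Type v} [NormedAddCommGroup H] [NormedSpace ℝ H]
    {F : V → ℝ → H} (hP : IsOpen P) (hF : ContDiffOn ℝ ∞ (Function.uncurry F) (P ×ˢ univ)) :
    ContDiffOn ℝ ∞ (fun p => ∫ s in a..b, F p s) P :=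
  contDiffOn_infty.2 fun n => contDiffOn_parametric_integral_nat hP n
    (hF.of_le (by exact_mod_cast le_top))

end Smoothness

section OneParameter

variable {H : Type*} [NormedAddCommGroup H] [NormedSpace ℝ H] {F : ℝ → ℝ → H} {a b : ℝ}

theorem deriv_slice_eq_fderiv (hF : ContDiff ℝ 1 (Function.uncurry F)) (t s : ℝ) :
    deriv (fun t => F t s) t = fderiv ℝ (Function.uncurry F) (t, s) (1, 0) := by
  have hFts : HasFDerivAt (Function.uncurry F) (fderiv ℝ (Function.uncurry F) (t, s)) (t, s) :=
    (hF.differentiable one_ne_zero _).hasFDerivAt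
  exact (hFts.comp_hasDerivAt t ((hasDerivAt_id t).prodMk (hasDerivAt_const t s))).deriv

theorem continuous_deriv_slice (hF : ContDiff ℝ 1 (Function.uncurry F)) (t : ℝ) :
    Continuous fun s => deriv (fun t => F t s) t := by
  simp only [deriv_slice_eq_fderiv hF]
  exact ((hF.continuous_fderiv one_ne_zero).comp (by fun_prop : Continuous fun s : ℝ =>
    (t, s))).clm_apply continuous_const

theorem hasDerivAt_parametric_integral (hF : ContDiff ℝ 1 (Function.uncurry F)) (t : ℝ) :
    HasDerivAt (fun t => ∫ s in a..b, F t s) (∫ s in a..b, deriv (fun t => F t s) t) t := by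
  have hcont : Continuous fun s => (fderiv ℝ (Function.uncurry F) (t, s)).comp
      (ContinuousLinearMap.inl ℝ ℝ ℝ) :=
    ((hF.continuous_fderiv one_ne_zero).comp (by fun_prop : Continuous fun s : ℝ =>
      (t, s))).clm_comp continuous_const
  refine (hasFDerivAt_parametric_integral isOpen_univ (hF.contDiffOn (s := univ ×ˢ univ))
    (mem_univ t)).hasDerivAt.congr_deriv ?_
  rw [ContinuousLinearMap.intervalIntegral_apply (hcont.intervalIntegrable _ _)]
  simp only [deriv_slice_eq_fderiv hF]
  rfl

end OneParameter

open Classical in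
/-- The integral over `[0, 1]` of a family of alternating maps, or `0` if the family is not
integrable. -/
def integralAlternating {E : Type*} [AddCommGroup E] [Module ℝ E] {q : ℕ}
    (A : ℝ → E [⋀^Fin q]→ₗ[ℝ] ℂ) : E [⋀^Fin q]→ₗ[ℝ] ℂ :=
  if h : ∀ u, IntervalIntegrable (fun s => A s u) volume 0 1 then
    { toFun := fun u => ∫ s in (0 : ℝ)..1, A s u
      map_update_add' := fun u i x y => by
        simp only [AlternatingMap.map_update_add]
        exact intervalIntegral.integral_add (h _) (h _)
      map_update_smul' := fun u i c x => by
        simp only [AlternatingMap.map_update_smul]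
        exact intervalIntegral.integral_smul _ _
      map_eq_zero_of_eq' := fun u i j hij hne => by
        simp [fun s => (A s).map_eq_zero_of_eq u hij hne] }
  else 0

theorem integralAlternating_apply {E : Type*} [AddCommGroup E] [Module ℝ E] {q : ℕ}
    {A : ℝ → E [⋀^Fin q]→ₗ[ℝ] ℂ}
    (h : ∀ u, IntervalIntegrable (fun s => A s u) volume 0 1) (u : Fin q → E) :
    integralAlternating A u = ∫ s in (0 : ℝ)..1, A s u := by
  rw [integralAlternating, dif_pos h]
  rfl

end ParametricIntegral

section CovariantDerivative

open scoped FourierTransform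

variable {g : ℕ} {B : Type*} [TopologicalSpace B] [ChartedSpace (Coord g) B]
  {Λ : LagrangianCovering g B} {S : Set (X Λ)} {m : ℕ} {L : LocalSystem S}
  {φ : ActionChart Λ} {x₀ : Coord g} {q : ℕ} {D : LocalModel S φ m x₀} {E : FlatFrame D L}
  {U : Set (XHat Λ)} {T : Coord g → Coord g → Coord g [⋀^Fin q]→ₗ[ℝ] ℂ}

theorem vecCons_comp_succ_succAbove {α : Type*} (l : α) (u : Fin (q + 1) → α) (a : Fin (q + 1)) :
    (fun c => (Matrix.vecCons l u : Fin (q + 2) → α) (a.succ.succAbove c)) =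
      Matrix.vecCons l fun c => u (a.succAbove c) := by
  ext1 c
  refine Fin.cases ?_ (fun c => ?_) c
  · simp
  · simp [Fin.succ_succAbove_succ]

theorem modelRelD_vecCons (T : Coord g → Coord g → Coord g [⋀^Fin (q + 1)]→ₗ[ℝ] ℂ)
    (z w l : Coord g) (u : Fin (q + 1) → Coord g) :
    modelRelD T z w (Matrix.vecCons l u) = covDeriv T z w l u -
      ∑ a : Fin (q + 1), (-1 : ℂ) ^ (a : ℕ) *
        covDeriv T z w (u a) (Matrix.vecCons l fun c => u (a.succAbove c)) := by
  rw [modelRelD, Fin.sum_univ_succ, sub_eq_add_neg, ← Finset.sum_neg_distrib]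
  simp only [vecCons_comp_succ_succAbove, Fin.val_succ, Matrix.cons_val_succ, Matrix.cons_val_zero,
    Fin.val_zero, pow_zero, one_mul, Fin.succAbove_zero, pow_succ, mul_neg, mul_one, neg_mul]

namespace IsModelForm

theorem contDiff_comp_add (hT : IsModelForm E U T) (hU : IsOpen U) {z w : Coord g}
    (hzw : (z, w) ∈ D.hatDom U) {V : Type*} [NormedAddCommGroup V] [NormedSpace ℝ V]
    {f : V → Coord g} (hf : ContDiff ℝ ∞ f) (hfW : ∀ p, f p ∈ D.W) {u : Fin q → Coord g}
    (hu : ∀ a, u a ∈ D.W) : ContDiff ℝ ∞ fun p => T (z + f p) w u :=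
  contDiff_iff_contDiffAt.2 fun p =>
    ContDiffAt.comp (g := fun p : Coord g × Coord g => T p.1 p.2 u) (f := fun p => (z + f p, w)) p
      ((hT.smooth u hu).contDiffAt ((D.isOpen_hatDom hU).mem_nhds (D.add_mem_hatDom hzw (hfW p))))
      ((contDiffAt_const.add hf.contDiffAt).prodMk contDiffAt_const)

theorem contDiff_line (hT : IsModelForm E U T) (hU : IsOpen U) {z w v : Coord g}
    (hzw : (z, w) ∈ D.hatDom U) (hv : v ∈ D.W) {u : Fin q → Coord g} (hu : ∀ a, u a ∈ D.W) :
    ContDiff ℝ ∞ fun s : ℝ => T (z + s • v) w u :=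
  hT.contDiff_comp_add hU hzw (by fun_prop) (fun s => D.W.smul_mem s hv) hu

theorem contDiff_plane (hT : IsModelForm E U T) (hU : IsOpen U) {z w l v : Coord g}
    (hzw : (z, w) ∈ D.hatDom U) (hl : l ∈ D.W) (hv : v ∈ D.W) {u : Fin q → Coord g}
    (hu : ∀ a, u a ∈ D.W) : ContDiff ℝ ∞ fun p : ℝ × ℝ => T (z + p.2 • l + p.1 • v) w u := by
  simp only [add_assoc]
  exact hT.contDiff_comp_add hU hzw (f := fun p : ℝ × ℝ => p.2 • l + p.1 • v) (by fun_prop)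
    (fun p => add_mem (D.W.smul_mem _ hl) (D.W.smul_mem _ hv)) hu

theorem continuous_covDeriv_line (hT : IsModelForm E U T) (hU : IsOpen U) {z w l v : Coord g}
    (hzw : (z, w) ∈ D.hatDom U) (hl : l ∈ D.W) (hv : v ∈ D.W) {u : Fin q → Coord g}
    (hu : ∀ a, u a ∈ D.W) : Continuous fun s : ℝ => covDeriv T (z + s • l) w v u :=
  (continuous_deriv_slice (F := fun t s => T (z + s • l + t • v) w u)
    ((hT.contDiff_plane hU hzw hl hv hu).of_le (by simp)) 0).add
    (continuous_const.mul (hT.contDiff_line hU hzw hl hu).continuous)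

theorem hasDerivAt_line (hT : IsModelForm E U T) (hU : IsOpen U) {z w v : Coord g}
    (hzw : (z, w) ∈ D.hatDom U) (hv : v ∈ D.W) {u : Fin q → Coord g} (hu : ∀ a, u a ∈ D.W)
    (s : ℝ) : HasDerivAt (fun s : ℝ => T (z + s • v) w u)
      (deriv (fun t : ℝ => T (z + s • v + t • v) w u) 0) s := by
  simp only [add_assoc, ← add_smul]
  rw [deriv_comp_const_add (f := fun s => T (z + s • v) w u), add_zero]
  exact ((hT.contDiff_line hU hzw hv hu).differentiable (by simp) s).hasDerivAt

end IsModelForm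

theorem hasDerivAt_fourierChar_mul (r s : ℝ) :
    HasDerivAt (fun s : ℝ => (𝐞 (s * r) : ℂ)) (2 * Real.pi * Complex.I * r * 𝐞 (s * r)) s := by
  refine ((Real.hasDerivAt_fourierChar (s * r)).scomp s (hasDerivAt_mul_const r)).congr_deriv ?_
  rw [Complex.real_smul]
  ring

theorem contDiff_fourierChar_mul (r : ℝ) : ContDiff ℝ ∞ fun s : ℝ => (𝐞 (s * r) : ℂ) :=
  contDiff_fourierChar.comp (contDiff_id.mul contDiff_const)

/-- The factor `𝐞 (s * ⟪v, w⟫)` is the parallel transport of the Poincaré bundle along the line. -/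
theorem IsModelForm.hasDerivAt_fourierChar_mul_line (hT : IsModelForm E U T) (hU : IsOpen U)
    {z w v : Coord g} (hzw : (z, w) ∈ D.hatDom U) (hv : v ∈ D.W) {u : Fin q → Coord g}
    (hu : ∀ a, u a ∈ D.W) (s : ℝ) :
    HasDerivAt (fun s : ℝ => 𝐞 (s * inner ℝ v w) * T (z + s • v) w u)
      (𝐞 (s * inner ℝ v w) * covDeriv T (z + s • v) w v u) s := by
  refine ((hasDerivAt_fourierChar_mul _ s).mul (hT.hasDerivAt_line hU hzw hv hu s)).congr_deriv ?_
  rw [covDeriv]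
  ring

end CovariantDerivative

section Exactness

open scoped FourierTransform

variable {g : ℕ} {B : Type*} [TopologicalSpace B] [ChartedSpace (Coord g) B]
  {Λ : LagrangianCovering g B} {S : Set (X Λ)} {m : ℕ} {L : LocalSystem S}
  {φ : ActionChart Λ} {x₀ : Coord g} {q : ℕ} {D : LocalModel S φ m x₀} {E : FlatFrame D L}
  {U : Set (XHat Λ)}

/-- The holonomy along `l` of the restriction of `L ⊗ P` to a fibre of the projection to `X̂`. -/
def holonomy (E : FlatFrame D L) (l w : Coord g) : Circle := 𝐞 (inner ℝ l w) * (E.hol l)⁻¹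

theorem holonomy_add_of_mem_intLattice (E : FlatFrame D L) {l μ : Coord g}
    (hl : l ∈ intLattice g) (hμ : μ ∈ intLattice g) (w : Coord g) :
    holonomy E l (w + μ) = holonomy E l w := by
  rw [holonomy, holonomy, inner_add_right, AddChar.map_add_eq_mul, fourierChar_inner_eq_one hl hμ,
    mul_one]

theorem contDiff_holonomy (E : FlatFrame D L) (l : Coord g) :
    ContDiff ℝ ∞ fun w => (holonomy E l w : ℂ) := by
  simp only [holonomy, Circle.coe_mul]
  exact (contDiff_fourierChar.comp (contDiff_const.inner ℝ contDiff_id)).mul contDiff_const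

/-- A primitive of a closed trivialized form, defined by averaging along a loop with nontrivial
holonomy. -/
def averagedForm (E : FlatFrame D L) (l : Coord g)
    (T : Coord g → Coord g → Coord g [⋀^Fin (q + 1)]→ₗ[ℝ] ℂ) (z w : Coord g) :
    Coord g [⋀^Fin q]→ₗ[ℝ] ℂ :=
  (holonomy E l w - 1 : ℂ)⁻¹ • integralAlternating fun s =>
    ((𝐞 (s * inner ℝ l w) : ℂ) • (T (z + s • l) w).curryLeft l).compLinearMap
      D.W.starProjection.toLinearMap

theorem vecCons_mem {W : Submodule ℝ (Coord g)} {l : Coord g} (hl : l ∈ W) {u : Fin q → Coord g}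
    (hu : ∀ a, u a ∈ W) (a : Fin (q + 1)) : (Matrix.vecCons l u : Fin (q + 1) → Coord g) a ∈ W :=
  Fin.cases hl hu a

variable {T : Coord g → Coord g → Coord g [⋀^Fin (q + 1)]→ₗ[ℝ] ℂ} {l : Coord g}

theorem averagedForm_apply (hT : IsModelForm E U T) (hU : IsOpen U) {z w : Coord g}
    (hzw : (z, w) ∈ D.hatDom U) (hl : l ∈ D.W) {u : Fin q → Coord g} (hu : ∀ a, u a ∈ D.W) :
    averagedForm E l T z w u = (holonomy E l w - 1 : ℂ)⁻¹ *
      ∫ s in (0 : ℝ)..1, 𝐞 (s * inner ℝ l w) * T (z + s • l) w (Matrix.vecCons l u) := by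
  have hcont : ∀ u : Fin q → Coord g, (∀ a, u a ∈ D.W) → Continuous fun s : ℝ =>
      (𝐞 (s * inner ℝ l w) : ℂ) * T (z + s • l) w (Matrix.vecCons l u) := fun u hu =>
    (contDiff_fourierChar_mul _).continuous.mul
      (hT.contDiff_line hU hzw hl (vecCons_mem hl hu)).continuous
  have hproj : (fun a => D.W.starProjection (u a)) = u :=
    funext fun a => D.W.starProjection_eq_self_iff.2 (hu a)
  rw [averagedForm, AlternatingMap.smul_apply, smul_eq_mul, integralAlternating_apply fun u =>
    (hcont _ fun a => D.W.starProjection_apply_mem (u a)).intervalIntegrable _ _]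
  conv_rhs => rw [← hproj]
  rfl

theorem contDiffOn_averagedForm (hT : IsModelForm E U T) (hU : IsOpen U) (hl : l ∈ D.W)
    (hne : ∀ p ∈ D.hatDom U, holonomy E l p.2 ≠ 1) {u : Fin q → Coord g} (hu : ∀ a, u a ∈ D.W) :
    ContDiffOn ℝ ∞ (fun p : Coord g × Coord g => averagedForm E l T p.1 p.2 u) (D.hatDom U) := by
  have hhol : ContDiff ℝ ∞ fun p : Coord g × Coord g => (holonomy E l p.2 : ℂ) :=
    ContDiff.comp (g := fun w => (holonomy E l w : ℂ)) (contDiff_holonomy E l) contDiff_snd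
  have hhol_ne : ∀ p ∈ D.hatDom U, (holonomy E l p.2 - 1 : ℂ) ≠ 0 := fun p hp =>
    sub_ne_zero.2 fun h => hne p hp (Circle.coe_eq_one.1 h)
  have hexponent : ContDiff ℝ ∞ fun p : (Coord g × Coord g) × ℝ => p.2 * inner ℝ l p.1.2 :=
    contDiff_snd.mul (contDiff_const.inner ℝ contDiff_fst.snd)
  have hchar : ContDiff ℝ ∞ fun p : (Coord g × Coord g) × ℝ => (𝐞 (p.2 * inner ℝ l p.1.2) : ℂ) :=
    ContDiff.comp (g := fun r : ℝ => (𝐞 r : ℂ)) contDiff_fourierChar hexponent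
  have htranslate : ContDiff ℝ ∞ fun p : (Coord g × Coord g) × ℝ => (p.1.1 + p.2 • l, p.1.2) := by
    fun_prop
  have hTl : ContDiffOn ℝ ∞ (fun p : (Coord g × Coord g) × ℝ =>
      T (p.1.1 + p.2 • l) p.1.2 (Matrix.vecCons l u)) (D.hatDom U ×ˢ univ) :=
    ContDiffOn.comp (g := fun p : Coord g × Coord g => T p.1 p.2 (Matrix.vecCons l u))
      (hT.smooth _ (vecCons_mem hl hu)) htranslate.contDiffOn
      fun p hp => D.add_mem_hatDom hp.1 (D.W.smul_mem p.2 hl)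
  have hintegral : ContDiffOn ℝ ∞ (fun p : Coord g × Coord g => ∫ s in (0 : ℝ)..1,
      𝐞 (s * inner ℝ l p.2) * T (p.1 + s • l) p.2 (Matrix.vecCons l u)) (D.hatDom U) :=
    contDiffOn_parametric_integral (D.isOpen_hatDom hU) (hchar.contDiffOn.mul hTl)
  exact (((hhol.sub contDiff_const).contDiffOn.inv hhol_ne).mul hintegral).congr fun p hp =>
    averagedForm_apply hT hU hp hl hu

theorem isModelForm_averagedForm (hT : IsModelForm E U T) (hU : IsOpen U) (hl : l ∈ D.W)
    (hlℤ : l ∈ intLattice g) (hne : ∀ p ∈ D.hatDom U, holonomy E l p.2 ≠ 1) :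
    IsModelForm E U (averagedForm E l T) where
  smooth _ hu := contDiffOn_averagedForm hT hU hl hne hu
  hol z w hzw k hk hkℤ u hu := by
    rw [averagedForm_apply hT hU (D.add_mem_hatDom hzw hk) hl hu,
      averagedForm_apply hT hU hzw hl hu, mul_left_comm]
    congr 1
    rw [← intervalIntegral.integral_const_mul]
    refine intervalIntegral.integral_congr fun s _ => ?_
    rw [add_right_comm, hT.hol (z + s • l) w (D.add_mem_hatDom hzw (D.W.smul_mem s hl)) k hk hkℤ _
      (vecCons_mem hl hu)]
    ring
  automorphy z w hzw μ hμ u hu := by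
    rw [averagedForm_apply hT hU (D.add_mem_hatDom_of_mem_intLattice hzw hμ) hl hu,
      averagedForm_apply hT hU hzw hl hu, holonomy_add_of_mem_intLattice E hlℤ hμ, mul_left_comm]
    congr 1
    rw [← intervalIntegral.integral_const_mul]
    refine intervalIntegral.integral_congr fun s _ => ?_
    have hsl := D.W.smul_mem s hl
    have hcancel : s * inner ℝ l (w + μ) + -inner ℝ (D.y (z + s • l)) μ =
        -inner ℝ (D.y z) μ + s * inner ℝ l w := by
      rw [D.y_add z _ hsl, inner_add_left, inner_add_right, real_inner_smul_left]
      ring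
    rw [hT.automorphy (z + s • l) w (D.add_mem_hatDom hzw hsl) μ hμ _ (vecCons_mem hl hu),
      ← mul_assoc, ← mul_assoc, ← Circle.coe_mul, ← Circle.coe_mul, ← AddChar.map_add_eq_mul,
      ← AddChar.map_add_eq_mul, hcancel]

theorem covDeriv_averagedForm (hT : IsModelForm E U T) (hU : IsOpen U) {z w v : Coord g}
    (hzw : (z, w) ∈ D.hatDom U) (hl : l ∈ D.W) (hv : v ∈ D.W) {u : Fin q → Coord g}
    (hu : ∀ a, u a ∈ D.W) :
    covDeriv (averagedForm E l T) z w v u = (holonomy E l w - 1 : ℂ)⁻¹ *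
      ∫ s in (0 : ℝ)..1, 𝐞 (s * inner ℝ l w) *
        covDeriv T (z + s • l) w v (Matrix.vecCons l u) := by
  have hlu := vecCons_mem hl hu
  let F : ℝ → ℝ → ℂ := fun t s =>
    𝐞 (s * inner ℝ l w) * T (z + s • l + t • v) w (Matrix.vecCons l u)
  have hF : ContDiff ℝ 1 (Function.uncurry F) := ContDiff.of_le
    (((contDiff_fourierChar_mul _).comp contDiff_snd).mul (hT.contDiff_plane hU hzw hl hv hlu))
    (by simp)
  have hline : (fun t : ℝ => averagedForm E l T (z + t • v) w u) =
      fun t => (holonomy E l w - 1 : ℂ)⁻¹ * ∫ s in (0 : ℝ)..1, F t s := by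
    ext1 t
    rw [averagedForm_apply hT hU (D.add_mem_hatDom hzw (D.W.smul_mem t hv)) hl hu]
    simp only [F, add_right_comm]
  have hF₀ : Continuous fun s : ℝ => 2 * Real.pi * Complex.I * (inner ℝ v w : ℝ) *
      (𝐞 (s * inner ℝ l w) * T (z + s • l) w (Matrix.vecCons l u)) :=
    continuous_const.mul <|
      (contDiff_fourierChar_mul _).continuous.mul (hT.contDiff_line hU hzw hl hlu).continuous
  rw [covDeriv, hline, ((hasDerivAt_parametric_integral hF 0).const_mul _).deriv,
    averagedForm_apply hT hU hzw hl hu, mul_left_comm, ← mul_add,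
    ← intervalIntegral.integral_const_mul, ← intervalIntegral.integral_add
      ((continuous_deriv_slice hF 0).intervalIntegrable _ _)
      (hF₀.intervalIntegrable _ _)]
  congr 3 with s
  simp only [F, deriv_const_mul_field, covDeriv]
  ring

theorem modelRelD_averagedForm (hT : IsModelForm E U T) (hU : IsOpen U) (hl : l ∈ D.W)
    (hlℤ : l ∈ intLattice g) (hclosed : ∀ z w, (z, w) ∈ D.hatDom U →
      ∀ u : Fin (q + 2) → Coord g, (∀ a, u a ∈ D.W) → modelRelD T z w u = 0)
    {z w : Coord g} (hzw : (z, w) ∈ D.hatDom U) (hne : holonomy E l w ≠ 1)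
    {u : Fin (q + 1) → Coord g} (hu : ∀ a, u a ∈ D.W) :
    modelRelD (averagedForm E l T) z w u = T z w u := by
  have hhol : (holonomy E l w - 1 : ℂ) ≠ 0 := sub_ne_zero.2 fun h => hne (Circle.coe_eq_one.1 h)
  have hcont : ∀ a : Fin (q + 1), Continuous fun s : ℝ => (-1 : ℂ) ^ (a : ℕ) *
      (𝐞 (s * inner ℝ l w) *
        covDeriv T (z + s • l) w (u a) (Matrix.vecCons l fun c => u (a.succAbove c))) := fun a =>
    continuous_const.mul <| (contDiff_fourierChar_mul _).continuous.mul
      (hT.continuous_covDeriv_line hU hzw hl (hu a) (vecCons_mem hl fun c => hu _))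
  have hcartan : ∀ s : ℝ, covDeriv T (z + s • l) w l u = ∑ a : Fin (q + 1), (-1 : ℂ) ^ (a : ℕ) *
      covDeriv T (z + s • l) w (u a) (Matrix.vecCons l fun c => u (a.succAbove c)) := fun s => by
    rw [← sub_eq_zero, ← modelRelD_vecCons]
    exact hclosed _ w (D.add_mem_hatDom hzw (D.W.smul_mem s hl)) _ (vecCons_mem hl hu)
  calc modelRelD (averagedForm E l T) z w u
      = (holonomy E l w - 1 : ℂ)⁻¹ * ∑ a : Fin (q + 1), ∫ s in (0 : ℝ)..1, (-1 : ℂ) ^ (a : ℕ) *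
          (𝐞 (s * inner ℝ l w) * covDeriv T (z + s • l) w (u a)
            (Matrix.vecCons l fun c => u (a.succAbove c))) := by
        simp only [modelRelD, covDeriv_averagedForm hT hU hzw hl (hu _) fun _ => hu _,
          intervalIntegral.integral_const_mul, Finset.mul_sum, mul_left_comm]
    _ = (holonomy E l w - 1 : ℂ)⁻¹ *
          ∫ s in (0 : ℝ)..1, 𝐞 (s * inner ℝ l w) * covDeriv T (z + s • l) w l u := by
        rw [← intervalIntegral.integral_finsetSum fun a _ =>
          (hcont a).intervalIntegrable _ _]
        simp only [hcartan, Finset.mul_sum, mul_left_comm]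
    _ = (holonomy E l w - 1 : ℂ)⁻¹ * (𝐞 (inner ℝ l w) * T (z + l) w u - T z w u) := by
        rw [intervalIntegral.integral_eq_sub_of_hasDerivAt
          (fun s _ => hT.hasDerivAt_fourierChar_mul_line hU hzw hl hu s)
          (((contDiff_fourierChar_mul _).continuous.mul
            (hT.continuous_covDeriv_line hU hzw hl hl hu)).intervalIntegrable _ _)]
        simp only [one_mul, one_smul, zero_mul, AddChar.map_zero_eq_one, Circle.coe_one, zero_smul,
          add_zero]
    _ = (holonomy E l w - 1 : ℂ)⁻¹ * ((holonomy E l w - 1) * T z w u) := by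
        rw [hT.hol z w hzw l hl hlℤ u hu, holonomy, Circle.coe_mul, Circle.coe_inv]
        ring
    _ = T z w u := inv_mul_cancel_left₀ hhol _

end Exactness

section Vanishing

variable {g : ℕ} {B : Type*} [TopologicalSpace B] [ChartedSpace (Coord g) B]
  {Λ : LagrangianCovering g B} {S : Set (X Λ)} {m : ℕ} {L : LocalSystem S}
  {φ : ActionChart Λ} {x₀ : Coord g} {q : ℕ} {U : Set (XHat Λ)} {τ : FormData L q}

theorem isClosed_image_proj (hS : IsClosed S) : IsClosed (X.proj '' S) := by
  refine isOpen_compl_iff.1 (isOpen_iff_mem_nhds.2 fun b hb => ?_)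
  obtain ⟨φ, hφ, hbφ⟩ := Λ.exists_actionChart b
  let φ' : ActionChart Λ := ⟨φ, hφ⟩
  have hempty : ∀ᶠ x in 𝓝 (φ b), ∀ y, x ∈ φ.target ∧ X.param φ' (x, y) ∉ S := by
    refine eventually_forall_of_periodic (Q := fun p => p.1 ∈ φ.target ∧ X.param φ' p ∉ S)
      (fun y => (isOpen_notMem_chart hS φ').mem_nhds
        ⟨φ.map_source hbφ, fun hy => hb ⟨_, hy, φ.left_inv hbφ⟩⟩) ?_
    rintro x y n hn ⟨hx, hy⟩
    exact ⟨hx, by rwa [X.param_add_of_mem_intLattice φ' hx hn]⟩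
  filter_upwards [(φ.continuousAt hbφ).eventually hempty, φ.open_source.mem_nhds hbφ]
    with b' hb' hb'φ hb'S
  obtain ⟨α, hα⟩ := exists_mk_of_mem_proj hb'S
  exact (hb' _).2 (X.mk_eq_param φ' hb'φ α ▸ hα)

theorem isRelForm_zero (L : LocalSystem S) (U : Set (XHat Λ)) :
    IsRelForm L U (0 : FormData L q) where
  smooth _ _ _ := contDiffOn_const
  glue _ _ _ _ _ _ _ _ _ := (mul_zero _).symm
  automorphy _ _ _ _ _ _ _ _ _ _ _ _ := (mul_zero _).symm

theorem IsRelForm.mono {U' : Set (XHat Λ)} (hU : U' ⊆ U) (hτ : IsRelForm L U τ) :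
    IsRelForm L U' τ where
  smooth i φ u := (hτ.smooth i φ u).mono fun _ hp => ⟨hp.1, hp.2.1, hU hp.2.2⟩
  glue i j b α v hα hv := hτ.glue i j b α v hα (hU hv)
  automorphy i b α v hα hv := hτ.automorphy i b α v hα (hU hv)

theorem isRelExact_of_fst_notMem (h : ∀ ξ ∈ U, ξ.1 ∉ X.proj '' S) : IsRelExact U τ := by
  have hempty : ∀ (b : B) (α : Cot g b) (v : Tan g b), XHat.mk v ∈ U → X.mk α ∉ S :=
    fun b α v hv hα => h _ hv ⟨_, hα, rfl⟩
  cases q with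
  | zero => exact fun i b α v hα hv => absurd hα.1 (hempty b α v hv)
  | succ q =>
    exact ⟨0, isRelForm_zero L U, fun i b α v hα hv => absurd hα.1 (hempty b α v hv)⟩

theorem fst_mem_of_mem_transformSupport (hS : IsClosed S) {ξ : XHat Λ}
    (hξ : ξ ∈ transformSupport L q) : ξ.1 ∈ X.proj '' S := by
  by_contra hξS
  obtain ⟨U, hU, hξU, τ, -, -, hex⟩ := hξ
  have hV : IsOpen {η : XHat Λ | η.1 ∉ X.proj '' S} :=
    (isClosed_image_proj hS).isOpen_compl.preimage XHat.continuous_proj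
  exact hex (U ∩ {η | η.1 ∉ X.proj '' S}) inter_subset_left (hU.inter hV) ⟨hξU, hξS⟩
    (isRelExact_of_fst_notMem fun η hη => hη.2)

namespace LocalModel

variable (D : LocalModel S φ m x₀)

/-- The set of the points `(x, w)` of `X̂` with `x` in the domain of a local model and `w ∈ N`. -/
def tube (N : Set (Coord g)) : Set (XHat Λ) :=
  XHat.param φ '' (Metric.ball x₀ D.r ×ˢ N)

theorem tube_subset_hatBall (N : Set (Coord g)) : D.tube N ⊆ D.hatBall := by
  rintro _ ⟨⟨x, w⟩, ⟨hx, -⟩, rfl⟩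
  have hxφ := D.ball_subset hx
  exact ⟨φ.1.map_target hxφ, mem_of_eq_of_mem (φ.1.right_inv hxφ) hx⟩

theorem isOpen_tube {N : Set (Coord g)} (hN : IsOpen N) : IsOpen (D.tube N) :=
  XHat.isOpen_image_param φ (Metric.isOpen_ball.prod hN) fun _ hp => D.ball_subset hp.1

theorem mem_of_mem_hatDom_tube {N : Set (Coord g)}
    (hN : ∀ w ∈ N, ∀ μ ∈ intLattice g, w + μ ∈ N) {z w : Coord g}
    (h : (z, w) ∈ D.hatDom (D.tube N)) : w ∈ N := by
  obtain ⟨hz, ⟨x', w'⟩, ⟨hx', hw'⟩, heq⟩ := h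
  have hμ := ((XHat.param_eq_param φ (q := ((D.coords z).1, w)) (D.ball_subset hx')
    (D.coords_fst_mem hz)).1 heq).2
  exact add_sub_cancel w' w ▸ hN w' hw' _ hμ

/-- A statement about the points of `S ×_B U` and the tangent vectors of the fibres of `S` may be
checked in the parametrization of the local model. -/
theorem forall_of_forall_hatDom (hU : U ⊆ D.hatBall) {i : L.ι}
    {P : ∀ b : B, Cot g b → Tan g b → (Fin q → Cot g b) → Prop}
    (h : ∀ z w n, (z, w) ∈ D.hatDom U → D.pt z ∈ L.cover i → n ∈ intLattice g →
      ∀ u : Fin q → Coord g, (∀ a, u a ∈ D.W) →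
      P (D.base z) (cot φ.1 (D.base z) (D.y z + n)) (tan φ.1 (D.coords z).1 w)
        fun a => cot φ.1 (D.base z) (u a))
    (b : B) (α : Cot g b) (v : Tan g b) (hα : X.mk α ∈ S ∩ L.cover i) (hv : XHat.mk v ∈ U)
    (u : Fin q → Cot g b) (hu : ∀ a, u a ∈ vertTangent S α) : P b α v u := by
  obtain ⟨hb, hbr⟩ : b ∈ φ.1.source ∧ φ.1 b ∈ Metric.ball x₀ D.r := hU hv
  obtain ⟨z, hz, n, hn, hx, hy, hpt⟩ := exists_param_of_mk_mem hb hbr hα.1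
  have hu' : ∀ a, ycoord φ.1 b (u a) ∈ D.W := fun a =>
    (D.mem_vertTangent_iff hb hbr hα.1).1 (hu a)
  have hzw := mem_hatDom_of_mk_mem hb hv hz hx
  obtain rfl : b = D.base z := by rw [base, ← hx, φ.1.left_inv hb]
  simpa only [← hy, cot_ycoord φ.2.1 hb, tan_wcoord φ.2.1 (D.coords_fst_mem hz)]
    using h z _ n hzw (hpt ▸ hα.2) hn _ hu'

end LocalModel

variable {D : LocalModel S φ m x₀} {E : FlatFrame D L}
  {T : Coord g → Coord g → Coord g [⋀^Fin q]→ₗ[ℝ] ℂ}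

namespace Represents

theorem modelRelD_eq_zero (hT : Represents E U τ T) (hclosed : IsRelClosed U τ) {z w : Coord g}
    (hzw : (z, w) ∈ D.hatDom U) {u : Fin (q + 1) → Coord g} (hu : ∀ a, u a ∈ D.W) :
    modelRelD T z w u = 0 := by
  obtain ⟨i, hi⟩ := L.exists_mem_cover (D.pt_mem hzw.1)
  have hzero := zero_mem (intLattice g)
  refine (mul_eq_zero.1 ((hT.relD_eq hzw hi hzero hu).symm.trans ?_)).resolve_left
    (Circle.coe_ne_zero _)
  exact hclosed i _ _ _ ((D.mk_eq_pt hzw.1 hzero).symm ▸ ⟨D.pt_mem hzw.1, hi⟩) hzw.2 _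
    fun a => D.cot_mem_vertTangent hzw.1 hzero (hu a)

theorem isRelExact {τ : FormData L (q + 1)}
    {T' : Coord g → Coord g → Coord g [⋀^Fin (q + 1)]→ₗ[ℝ] ℂ}
    (hT' : Represents E U τ T') (hT : IsModelForm E U T) (hU : IsOpen U) (hUD : U ⊆ D.hatBall)
    (h : ∀ z w, (z, w) ∈ D.hatDom U → ∀ u : Fin (q + 1) → Coord g, (∀ a, u a ∈ D.W) →
      T' z w u = modelRelD T z w u) : IsRelExact U τ := by
  refine ⟨ofModel E T, hT.isRelForm_ofModel hU hUD, fun i => D.forall_of_forall_hatDom hUD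
    (P := fun b α v u => τ i b α v u = relD (ofModel E T) i b α v u) ?_⟩
  intro z w n hzw hi hn u hu
  rw [hT.represents_ofModel.relD_eq hzw hi hn hu, hT' i z w hzw hi n hn u hu, h z w hzw u hu]

end Represents

theorem IsRelForm.isRelExact_of_holonomy_ne_one {τ : FormData L (q + 1)} (hτ : IsRelForm L U τ)
    (hclosed : IsRelClosed U τ) (hU : IsOpen U) (hUD : U ⊆ D.hatBall) {l : Coord g}
    (hl : l ∈ D.W) (hlℤ : l ∈ intLattice g) (hne : ∀ p ∈ D.hatDom U, holonomy E l p.2 ≠ 1) :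
    IsRelExact U τ := by
  obtain ⟨idx, hidx⟩ := D.exists_index L
  have hrep := hτ.represents E hidx
  have hT := hτ.isModelForm hU hrep
  have hA := isModelForm_averagedForm hT hU hl hlℤ hne
  refine hrep.isRelExact hA hU hUD fun z w hzw u hu => ?_
  have hprimitive := modelRelD_averagedForm hT hU hl hlℤ
    (fun _ _ hzw _ hu => hrep.modelRelD_eq_zero hclosed hzw hu) hzw (hne (z, w) hzw) hu
  exact hprimitive.symm

theorem notMem_transformSupport_of_holonomy_ne_one (E : FlatFrame D L) {l : Coord g}
    (hl : l ∈ D.W) (hlℤ : l ∈ intLattice g) {x w : Coord g} (hx : x ∈ Metric.ball x₀ D.r)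
    (hw : holonomy E l w ≠ 1) : XHat.param φ (x, w) ∉ transformSupport L (q + 1) := by
  rintro ⟨U, hU, hξU, τ, hτ, hclosed, hex⟩
  let N : Set (Coord g) := {w | (holonomy E l w : ℂ) ≠ 1}
  have hN : IsOpen N := isOpen_ne.preimage (contDiff_holonomy E l).continuous
  have hper : ∀ w ∈ N, ∀ μ ∈ intLattice g, w + μ ∈ N := by
    intro w hw μ hμ
    change (holonomy E l (w + μ) : ℂ) ≠ 1
    rwa [holonomy_add_of_mem_intLattice E hlℤ hμ]
  have hUN : IsOpen (U ∩ D.tube N) := hU.inter (D.isOpen_tube hN)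
  refine hex (U ∩ D.tube N) inter_subset_left hUN
    ⟨hξU, ⟨(x, w), ⟨hx, fun h => hw (Circle.coe_eq_one.1 h)⟩, rfl⟩⟩ ?_
  refine (hτ.mono inter_subset_left).isRelExact_of_holonomy_ne_one (E := E)
    (fun i b α v hα hv => hclosed i b α v hα hv.1) hUN
    (inter_subset_right.trans (D.tube_subset_hatBall N)) hl hlℤ ?_
  rintro ⟨z, w'⟩ hp h
  exact D.mem_of_mem_hatDom_tube hper (D.hatDom_mono inter_subset_right hp) (Circle.coe_eq_one.2 h)

end Vanishing

section Rounding

variable {g : ℕ}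

/-- The integral vector nearest to `w`, coordinatewise. -/
def roundVec (w : Coord g) : Coord g := WithLp.toLp 2 fun j => (round (w j) : ℝ)

theorem roundVec_mem_intLattice (w : Coord g) : roundVec w ∈ intLattice g :=
  mem_intLattice.2 fun j => ⟨round (w j), rfl⟩

theorem roundVec_add {n : Coord g} (hn : n ∈ intLattice g) (w : Coord g) :
    roundVec (w + n) = roundVec w + n := by
  obtain ⟨k, rfl⟩ := mem_intLattice_iff_exists_toLp.1 hn
  ext j
  simp [roundVec, round_add_intCast]

theorem roundVec_eq_zero {w : Coord g} (hw : ‖w‖ < 1 / 2) : roundVec w = 0 := by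
  ext j
  have hj : |w j| < 1 / 2 := lt_of_le_of_lt (PiLp.norm_apply_le w j) hw
  have hround : round (w j) = 0 := round_eq_zero_iff.2 ⟨(abs_lt.1 hj).1.le, (abs_lt.1 hj).2⟩
  simp [roundVec, hround]

theorem roundVec_eq_of_norm_sub_lt {w n : Coord g} (hn : n ∈ intLattice g) (h : ‖w - n‖ < 1 / 2) :
    roundVec w = n := by
  rw [← sub_add_cancel w n, roundVec_add hn, roundVec_eq_zero h, zero_add]

end Rounding

section Periodic

open MeasureTheory

theorem integral_divergence_eq_zero_of_periodic {q : ℕ} {G : Fin (q + 1) → (Fin (q + 1) → ℝ) → ℂ}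
    (hG : ∀ a, ContDiff ℝ ∞ (G a)) (hper : ∀ a t, G a (t + Pi.single a 1) = G a t) :
    ∫ t in Icc (0 : Fin (q + 1) → ℝ) 1, ∑ a, fderiv ℝ (G a) t (Pi.single a 1) = 0 := by
  have hcont : Continuous fun t => ∑ a, fderiv ℝ (G a) t (Pi.single a 1) :=
    continuous_finsetSum _ fun a _ =>
      ((hG a).continuous_fderiv (by simp)).clm_apply continuous_const
  rw [integral_divergence_of_hasFDerivAt_off_countable' 0 1 zero_le_one G
    (fun a => fderiv ℝ (G a)) ∅ countable_empty (fun a => (hG a).continuous.continuousOn)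
    (fun t _ a => ((hG a).differentiable (by simp) t).hasFDerivAt)
    (hcont.continuousOn.integrableOn_compact isCompact_Icc)]
  refine Finset.sum_eq_zero fun a _ => sub_eq_zero.2 ?_
  congr 1
  ext1 t
  refine Eq.trans ?_ (hper a _)
  congr 1
  ext j
  cases j using Fin.succAboveCases a <;> simp

end Periodic

section TopForms

variable {g m : ℕ} {W : Submodule ℝ (Coord g)}

theorem exists_topForm (hm : Module.finrank ℝ W = m) {l : Fin m → Coord g} (hl : ∀ j, l j ∈ W)
    (hli : LinearIndependent ℝ l) : ∃ vol : Coord g [⋀^Fin m]→ₗ[ℝ] ℂ, vol l = 1 := by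
  let l' : Fin m → W := fun j => ⟨l j, hl j⟩
  have hli' : LinearIndependent ℝ l' := LinearIndependent.of_comp W.subtype hli
  let b := basisOfLinearIndependentOfCardEqFinrank' l' hli' (by simp [hm])
  have hb : ⇑b = l' := coe_basisOfLinearIndependentOfCardEqFinrank' _ _ _
  have hproj : (fun j => W.orthogonalProjectionOnto (l j)) = l' := funext fun j =>
    W.orthogonalProjectionOnto_mem_subspace_eq_self (l' j)
  refine ⟨Complex.ofRealCLM.toLinearMap.compAlternatingMap
    (b.det.compLinearMap W.orthogonalProjectionOnto.toLinearMap), ?_⟩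
  change ((b.det fun j => W.orthogonalProjectionOnto (l j) : ℝ) : ℂ) = 1
  rw [hproj, ← hb, b.det_self, Complex.ofReal_one]

theorem not_linearIndependent_of_finrank_eq (hm : Module.finrank ℝ W = m)
    {u : Fin (m + 1) → Coord g} (hu : ∀ a, u a ∈ W) : ¬ LinearIndependent ℝ u := by
  intro h
  have hW : LinearIndependent ℝ fun a => (⟨u a, hu a⟩ : W) := LinearIndependent.of_comp W.subtype h
  have hcard := hW.fintype_card_le_finrank
  rw [hm, Fintype.card_fin] at hcard
  omega

/-- This is `⟨·, c⟩ ∧ vol`, an `(m + 1)`-form on a space of dimension `m`. -/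
theorem sum_inner_mul_topForm (hm : Module.finrank ℝ W = m) (vol : Coord g [⋀^Fin m]→ₗ[ℝ] ℂ)
    (c : Coord g) {u : Fin (m + 1) → Coord g} (hu : ∀ a, u a ∈ W) :
    ∑ a : Fin (m + 1), (-1 : ℂ) ^ (a : ℕ) * ((inner ℝ (u a) c : ℝ) *
      vol fun j => u (a.succAbove j)) = 0 := by
  let f : Coord g →ₗ[ℝ] Coord g [⋀^Fin m]→ₗ[ℝ] ℂ := (innerSL ℝ c).toLinearMap.smulRight vol
  have hwedge := (AlternatingMap.alternatizeUncurryFin f).map_linearDependent u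
    (not_linearIndependent_of_finrank_eq hm hu)
  rw [AlternatingMap.alternatizeUncurryFin_apply] at hwedge
  rw [← hwedge]
  refine Finset.sum_congr rfl fun a _ => ?_
  have hf : f (u a) (a.removeNth u) = (inner ℝ (u a) c : ℝ) * vol fun j => u (a.succAbove j) := by
    change (inner ℝ c (u a) : ℝ) • vol (a.removeNth u) = _
    rw [real_inner_comm, Complex.real_smul]
    rfl
  rw [hf, zsmul_eq_mul]
  push_cast
  rfl

end TopForms

section Nonvanishing

open scoped FourierTransform

variable {g : ℕ} {B : Type*} [TopologicalSpace B] [ChartedSpace (Coord g) B]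
  {Λ : LagrangianCovering g B} {S : Set (X Λ)} {m : ℕ} {L : LocalSystem S}
  {φ : ActionChart Λ} {x₀ : Coord g} {q : ℕ} {U : Set (XHat Λ)}
  {D : LocalModel S φ m x₀} {E : FlatFrame D L} {w₀ : Coord g}

theorem holonomy_eq_one_iff {l w : Coord g} :
    holonomy E l w = 1 ↔ 𝐞 (inner ℝ l w) = E.hol l :=
  mul_inv_eq_one

/-- The neighbourhood of the translates of `w₀` by integral vectors on which the integral vector
nearest to `w - w₀` is locally constant. -/
def nearLattice (w₀ : Coord g) : Set (Coord g) := {w | ∃ n ∈ intLattice g, ‖w - w₀ - n‖ < 1 / 2}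

theorem isOpen_nearLattice (w₀ : Coord g) : IsOpen (nearLattice w₀) := by
  have hunion : nearLattice w₀ = ⋃ n ∈ intLattice g, {w | ‖w - w₀ - n‖ < 1 / 2} := by
    ext w
    simp [nearLattice]
  rw [hunion]
  exact isOpen_biUnion fun n _ => isOpen_lt (by fun_prop) continuous_const

theorem self_mem_nearLattice (w₀ : Coord g) : w₀ ∈ nearLattice w₀ := ⟨0, zero_mem _, by simp⟩

theorem add_mem_nearLattice {w μ : Coord g} (hw : w ∈ nearLattice w₀) (hμ : μ ∈ intLattice g) :
    w + μ ∈ nearLattice w₀ := by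
  obtain ⟨n, hn, hnw⟩ := hw
  refine ⟨n + μ, add_mem hn hμ, ?_⟩
  rwa [show w + μ - w₀ - (n + μ) = w - w₀ - n by abel]

/-- The form with constant coefficients `vol` along the fibres, in a frame of the Poincaré bundle
that is parallel at `w = w₀`; it is extended from `w₀` by quasi-periodicity. -/
def constantForm (D : LocalModel S φ m x₀) (vol : Coord g [⋀^Fin q]→ₗ[ℝ] ℂ) (w₀ z w : Coord g) :
    Coord g [⋀^Fin q]→ₗ[ℝ] ℂ :=
  (𝐞 (-inner ℝ (D.y z) (w₀ + roundVec (w - w₀))) : ℂ) • vol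

theorem constantForm_apply (D : LocalModel S φ m x₀) (vol : Coord g [⋀^Fin q]→ₗ[ℝ] ℂ)
    (w₀ z w : Coord g) (u : Fin q → Coord g) :
    constantForm D vol w₀ z w u = 𝐞 (-inner ℝ (D.y z) (w₀ + roundVec (w - w₀))) * vol u := rfl

theorem constantForm_self_apply (D : LocalModel S φ m x₀) (vol : Coord g [⋀^Fin q]→ₗ[ℝ] ℂ)
    (w₀ z : Coord g) (u : Fin q → Coord g) :
    constantForm D vol w₀ z w₀ u = 𝐞 (-inner ℝ (D.y z) w₀) * vol u := by
  rw [constantForm_apply, sub_self, roundVec_eq_zero (by simp), add_zero]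

theorem covDeriv_constantForm (vol : Coord g [⋀^Fin q]→ₗ[ℝ] ℂ) (z w : Coord g) {v : Coord g}
    (hv : v ∈ D.W) (u : Fin q → Coord g) :
    covDeriv (constantForm D vol w₀) z w v u = 2 * Real.pi * Complex.I *
      (inner ℝ v (w - (w₀ + roundVec (w - w₀))) : ℝ) * constantForm D vol w₀ z w u := by
  set ρ := w₀ + roundVec (w - w₀) with hρ
  have hline : (fun t : ℝ => constantForm D vol w₀ (z + t • v) w u) =
      fun t : ℝ => (𝐞 (t * -inner ℝ v ρ) : ℂ) * constantForm D vol w₀ z w u := by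
    ext t
    rw [constantForm_apply, constantForm_apply, ← hρ, D.y_add z _ (D.W.smul_mem t hv),
      inner_add_left, real_inner_smul_left, neg_add_rev, AddChar.map_add_eq_mul, Circle.coe_mul,
      mul_neg, mul_assoc]
  rw [covDeriv, hline, ((hasDerivAt_fourierChar_mul _ 0).mul_const _).deriv, zero_mul,
    AddChar.map_zero_eq_one, inner_sub_right]
  push_cast
  ring

theorem modelRelD_constantForm (vol : Coord g [⋀^Fin m]→ₗ[ℝ] ℂ) (z w : Coord g)
    {u : Fin (m + 1) → Coord g} (hu : ∀ a, u a ∈ D.W) :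
    modelRelD (constantForm D vol w₀) z w u = 0 := by
  set ρ := w₀ + roundVec (w - w₀)
  calc modelRelD (constantForm D vol w₀) z w u
      = 2 * Real.pi * Complex.I * 𝐞 (-inner ℝ (D.y z) ρ) *
        ∑ a : Fin (m + 1), (-1 : ℂ) ^ (a : ℕ) * ((inner ℝ (u a) (w - ρ) : ℝ) *
          vol fun j => u (a.succAbove j)) := by
        rw [modelRelD, Finset.mul_sum]
        refine Finset.sum_congr rfl fun a _ => ?_
        rw [covDeriv_constantForm vol z w (hu a), constantForm_apply]
        ring
    _ = 0 := by rw [sum_inner_mul_topForm D.finrank_eq vol _ hu, mul_zero]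

theorem contDiffOn_constantForm (vol : Coord g [⋀^Fin q]→ₗ[ℝ] ℂ) (u : Fin q → Coord g) :
    ContDiffOn ℝ ∞ (fun p : Coord g × Coord g => constantForm D vol w₀ p.1 p.2 u)
      (D.hatDom (D.tube (nearLattice w₀))) := by
  rintro ⟨z, w⟩ hzw
  obtain ⟨n, hn, hw⟩ := D.mem_of_mem_hatDom_tube (fun _ h _ => add_mem_nearLattice h) hzw
  have hnear : ∀ᶠ p : Coord g × Coord g in 𝓝 (z, w), ‖p.2 - w₀ - n‖ < 1 / 2 :=
    (isOpen_lt (by fun_prop : Continuous fun p : Coord g × Coord g => ‖p.2 - w₀ - n‖)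
      continuous_const).mem_nhds hw
  have hy : ContDiffAt ℝ ∞ (fun p : Coord g × Coord g => D.y p.1) (z, w) :=
    ContDiffAt.comp (g := D.y) (f := fun p : Coord g × Coord g => p.1) (z, w)
      (D.contDiffOn.contDiffAt (D.isOpen_dom.mem_nhds hzw.1)) contDiffAt_fst
  have hchar : ContDiffAt ℝ ∞ (fun p : Coord g × Coord g =>
      (𝐞 (-inner ℝ (D.y p.1) (w₀ + n)) : ℂ)) (z, w) :=
    ContDiffAt.comp (g := fun r : ℝ => (𝐞 r : ℂ))
      (f := fun p : Coord g × Coord g => -inner ℝ (D.y p.1) (w₀ + n))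
      (z, w) contDiff_fourierChar.contDiffAt (hy.inner ℝ contDiffAt_const).neg
  refine ContDiffAt.contDiffWithinAt
    ((hchar.mul (contDiffAt_const (c := vol u))).congr_of_eventuallyEq ?_)
  filter_upwards [hnear] with p hp
  rw [constantForm_apply, roundVec_eq_of_norm_sub_lt hn hp]

theorem isModelForm_constantForm (E : FlatFrame D L) (vol : Coord g [⋀^Fin q]→ₗ[ℝ] ℂ)
    (hw₀ : ∀ l ∈ D.W, l ∈ intLattice g → holonomy E l w₀ = 1) :
    IsModelForm E (D.tube (nearLattice w₀)) (constantForm D vol w₀) where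
  smooth u _ := contDiffOn_constantForm vol u
  hol z w _ l hl hlℤ u _ := by
    rw [constantForm_apply, constantForm_apply, D.y_add z l hl, inner_add_left, inner_add_right l,
      neg_add, AddChar.map_add_eq_mul, AddChar.map_neg_eq_inv _ (_ + _), AddChar.map_add_eq_mul,
      holonomy_eq_one_iff.1 (hw₀ l hl hlℤ),
      fourierChar_inner_eq_one hlℤ (roundVec_mem_intLattice _), mul_one, Circle.coe_mul,
      Circle.coe_inv]
    ring
  automorphy z w _ μ hμ u _ := by
    rw [constantForm_apply, constantForm_apply, add_sub_right_comm, roundVec_add hμ, ← add_assoc,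
      inner_add_right _ _ μ, neg_add, AddChar.map_add_eq_mul, Circle.coe_mul]
    ring

/-- The components of the trivialized form `T` on the fibre through `z` over `w`, in the
coordinates given by the basis `l` and in a parallel frame of the Poincaré bundle, with the signs
that turn the exterior derivative of a form of codegree one into a divergence. -/
def fibreField (T : Coord g → Coord g → Coord g [⋀^Fin q]→ₗ[ℝ] ℂ) (l : Fin (q + 1) → Coord g)
    (z w : Coord g) (a : Fin (q + 1)) (t : Fin (q + 1) → ℝ) : ℂ :=
  (-1 : ℂ) ^ (a : ℕ) * (𝐞 (inner ℝ (Fintype.linearCombination ℝ l t) w) *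
    T (z + Fintype.linearCombination ℝ l t) w fun c => l (a.succAbove c))

theorem linearCombination_mem {W : Submodule ℝ (Coord g)} {l : Fin q → Coord g}
    (hl : ∀ j, l j ∈ W) (t : Fin q → ℝ) : Fintype.linearCombination ℝ l t ∈ W := by
  rw [Fintype.linearCombination_apply]
  exact sum_mem fun j _ => W.smul_mem _ (hl j)

section FibreField

variable {T : Coord g → Coord g → Coord g [⋀^Fin q]→ₗ[ℝ] ℂ} {l : Fin (q + 1) → Coord g}
  {z w : Coord g}

theorem contDiff_fibreField (hT : IsModelForm E U T) (hU : IsOpen U) (hzw : (z, w) ∈ D.hatDom U)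
    (hl : ∀ j, l j ∈ D.W) (a : Fin (q + 1)) : ContDiff ℝ ∞ (fibreField T l z w a) := by
  have hcomb : ContDiff ℝ ∞ fun t => Fintype.linearCombination ℝ l t := by
    simp only [Fintype.linearCombination_apply]
    fun_prop
  have hchar : ContDiff ℝ ∞ fun t => (𝐞 (inner ℝ (Fintype.linearCombination ℝ l t) w) : ℂ) :=
    ContDiff.comp (g := fun r : ℝ => (𝐞 r : ℂ))
      (f := fun t => inner ℝ (Fintype.linearCombination ℝ l t) w)
      contDiff_fourierChar (hcomb.inner ℝ contDiff_const)
  exact contDiff_const.mul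
    (hchar.mul (hT.contDiff_comp_add hU hzw hcomb (linearCombination_mem hl) fun c => hl _))

theorem fibreField_add_single (hT : IsModelForm E U T) (hzw : (z, w) ∈ D.hatDom U)
    (hl : ∀ j, l j ∈ D.W) (hlℤ : ∀ j, l j ∈ intLattice g)
    (hw : ∀ j, holonomy E (l j) w = 1) (a : Fin (q + 1)) (t : Fin (q + 1) → ℝ) :
    fibreField T l z w a (t + Pi.single a 1) = fibreField T l z w a t := by
  have hmem := D.add_mem_hatDom hzw (linearCombination_mem hl t)
  rw [fibreField, map_add, Fintype.linearCombination_apply_single, one_smul, ← add_assoc,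
    hT.hol _ w hmem (l a) (hl a) (hlℤ a) _ fun c => hl _, inner_add_left, AddChar.map_add_eq_mul,
    holonomy_eq_one_iff.1 (hw a), Circle.coe_mul, fibreField]
  have hhol := Circle.coe_ne_zero (E.hol (l a))
  field_simp

theorem fderiv_fibreField_single (hT : IsModelForm E U T) (hU : IsOpen U)
    (hzw : (z, w) ∈ D.hatDom U) (hl : ∀ j, l j ∈ D.W) (a : Fin (q + 1)) (t : Fin (q + 1) → ℝ) :
    fderiv ℝ (fibreField T l z w a) t (Pi.single a 1) =
      𝐞 (inner ℝ (Fintype.linearCombination ℝ l t) w) * ((-1 : ℂ) ^ (a : ℕ) *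
        covDeriv T (z + Fintype.linearCombination ℝ l t) w (l a) fun c => l (a.succAbove c)) := by
  have hmem := D.add_mem_hatDom hzw (linearCombination_mem hl t)
  have hline : (fun s : ℝ => fibreField T l z w a (t + s • Pi.single a 1)) = fun s : ℝ =>
      (-1 : ℂ) ^ (a : ℕ) * 𝐞 (inner ℝ (Fintype.linearCombination ℝ l t) w) *
        (𝐞 (s * inner ℝ (l a) w) * T (z + Fintype.linearCombination ℝ l t + s • l a) w
          fun c => l (a.succAbove c)) := by
    ext s
    rw [fibreField, map_add, map_smul, Fintype.linearCombination_apply_single, one_smul,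
      inner_add_left, real_inner_smul_left, AddChar.map_add_eq_mul, Circle.coe_mul, add_assoc]
    ring
  have hderiv := hT.hasDerivAt_fourierChar_mul_line hU hmem (hl a) (fun c => hl (a.succAbove c)) 0
  rw [← ((contDiff_fibreField hT hU hzw hl a).differentiable (by simp) t).lineDeriv_eq_fderiv,
    lineDeriv, hline, (hderiv.const_mul _).deriv, zero_mul, AddChar.map_zero_eq_one, zero_smul,
    add_zero, Circle.coe_one]
  ring

theorem integral_modelRelD_eq_zero (hT : IsModelForm E U T) (hU : IsOpen U)
    (hzw : (z, w) ∈ D.hatDom U) (hl : ∀ j, l j ∈ D.W) (hlℤ : ∀ j, l j ∈ intLattice g)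
    (hw : ∀ j, holonomy E (l j) w = 1) :
    ∫ t in Icc (0 : Fin (q + 1) → ℝ) 1, (𝐞 (inner ℝ (Fintype.linearCombination ℝ l t) w) : ℂ) *
      modelRelD T (z + Fintype.linearCombination ℝ l t) w l = 0 := by
  have hstokes := integral_divergence_eq_zero_of_periodic (contDiff_fibreField hT hU hzw hl)
    (fibreField_add_single hT hzw hl hlℤ hw)
  simpa only [fderiv_fibreField_single hT hU hzw hl, ← Finset.mul_sum, modelRelD] using hstokes

theorem exists_constantForm_ne_modelRelD (hT : IsModelForm E U T) (hU : IsOpen U)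
    (hzw : (z, w) ∈ D.hatDom U) (hl : ∀ j, l j ∈ D.W) (hlℤ : ∀ j, l j ∈ intLattice g)
    (hw : ∀ j, holonomy E (l j) w = 1) {vol : Coord g [⋀^Fin (q + 1)]→ₗ[ℝ] ℂ}
    (hvol : vol l = 1) :
    ∃ z', (z', w) ∈ D.hatDom U ∧ constantForm D vol w z' w l ≠ modelRelD T z' w l := by
  by_contra! hexact
  have hzero := integral_modelRelD_eq_zero hT hU hzw hl hlℤ hw
  have hconst : ∀ t, (𝐞 (inner ℝ (Fintype.linearCombination ℝ l t) w) : ℂ) *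
      modelRelD T (z + Fintype.linearCombination ℝ l t) w l = 𝐞 (-inner ℝ (D.y z) w) := by
    intro t
    have ht := linearCombination_mem hl t
    rw [← hexact _ (D.add_mem_hatDom hzw ht), constantForm_self_apply, hvol, mul_one,
      D.y_add z _ ht, inner_add_left, ← Circle.coe_mul, ← AddChar.map_add_eq_mul]
    congr 3
    ring
  simp only [hconst] at hzero
  rw [MeasureTheory.setIntegral_const, MeasureTheory.measureReal_def, Real.volume_Icc_pi] at hzero
  simp at hzero

end FibreField

theorem IsModelForm.isRelClosed_ofModel {T : Coord g → Coord g → Coord g [⋀^Fin q]→ₗ[ℝ] ℂ}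
    (hT : IsModelForm E U T) (hU : U ⊆ D.hatBall)
    (hclosed : ∀ z w, (z, w) ∈ D.hatDom U → ∀ u : Fin (q + 1) → Coord g, (∀ a, u a ∈ D.W) →
      modelRelD T z w u = 0) : IsRelClosed U (ofModel E T) := by
  intro i
  refine D.forall_of_forall_hatDom hU (P := fun b α v u => relD (ofModel E T) i b α v u = 0) ?_
  intro z w n hzw hi hn u hu
  rw [hT.represents_ofModel.relD_eq hzw hi hn hu, hclosed z w hzw u hu, mul_zero]

theorem not_isRelExact_of_represents_constantForm {τ : FormData L m}
    {vol : Coord g [⋀^Fin m]→ₗ[ℝ] ℂ} (hτ : Represents E U τ (constantForm D vol w₀))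
    (hU : IsOpen U) {z₀ : Coord g} (hz₀ : (z₀, w₀) ∈ D.hatDom U) {l : Fin m → Coord g}
    (hl : ∀ j, l j ∈ D.W) (hlℤ : ∀ j, l j ∈ intLattice g)
    (hw₀ : ∀ j, holonomy E (l j) w₀ = 1) (hvol : vol l = 1) : ¬ IsRelExact U τ := by
  intro hexact
  have hzero : (0 : Coord g) ∈ intLattice g := zero_mem _
  have hmem : ∀ z ∈ D.dom, ∀ i, D.pt z ∈ L.cover i →
      X.mk (cot φ.1 (D.base z) (D.y z + 0)) ∈ S ∩ L.cover i := fun z hz i hi =>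
    (D.mk_eq_pt hz hzero).symm ▸ ⟨D.pt_mem hz, hi⟩
  cases m with
  | zero =>
    obtain ⟨i, hi⟩ := L.exists_mem_cover (D.pt_mem hz₀.1)
    have hvanish := hexact i (D.base z₀) _ _ (hmem z₀ hz₀.1 i hi) hz₀.2
      fun a => cot φ.1 (D.base z₀) (l a)
    rw [hτ i z₀ w₀ hz₀ hi 0 hzero l hl, constantForm_self_apply, hvol] at hvanish
    simp at hvanish
  | succ q =>
    obtain ⟨σ, hσ, hσeq⟩ := hexact
    obtain ⟨idx, hidx⟩ := D.exists_index L
    have hσrep := hσ.represents E hidx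
    obtain ⟨z, hz, hne⟩ := exists_constantForm_ne_modelRelD (hσ.isModelForm hU hσrep) hU hz₀ hl hlℤ
      hw₀ hvol
    obtain ⟨i, hi⟩ := L.exists_mem_cover (D.pt_mem hz.1)
    have hτσ := hσeq i (D.base z) _ _ (hmem z hz.1 i hi) hz.2 (fun a => cot φ.1 (D.base z) (l a))
      fun a => D.cot_mem_vertTangent hz.1 hzero (hl a)
    rw [hτ i z w₀ hz hi 0 hzero l hl, hσrep.relD_eq hz hi hzero hl] at hτσ
    exact hne (mul_left_cancel₀ (Circle.coe_ne_zero (E.e i z)) hτσ)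

theorem mem_transformSupport_of_holonomy_eq_one (E : FlatFrame D L)
    (hw₀ : ∀ l ∈ D.W, l ∈ intLattice g → holonomy E l w₀ = 1) {z₀ : Coord g} (hz₀ : z₀ ∈ D.dom) :
    XHat.param φ ((D.coords z₀).1, w₀) ∈ transformSupport L m := by
  obtain ⟨l, hl, hlℤ, hli, -⟩ := D.rational.exists_basis D.finrank_eq
  obtain ⟨vol, hvol⟩ := exists_topForm D.finrank_eq hl hli
  have hT := isModelForm_constantForm E vol hw₀
  have hopen := D.isOpen_tube (isOpen_nearLattice w₀)
  have hsub := D.tube_subset_hatBall (nearLattice w₀)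
  refine ⟨D.tube (nearLattice w₀), hopen,
    ⟨((D.coords z₀).1, w₀), ⟨D.coords_fst_mem_ball hz₀, self_mem_nearLattice w₀⟩, rfl⟩,
    ofModel E (constantForm D vol w₀), hT.isRelForm_ofModel hopen hsub,
    hT.isRelClosed_ofModel hsub fun z w _ u hu => modelRelD_constantForm vol z w hu, ?_⟩
  intro U' hU' hU'o hξ
  have hrep : Represents E U' (ofModel E (constantForm D vol w₀)) (constantForm D vol w₀) :=
    fun i z w hzw => hT.represents_ofModel i z w (D.hatDom_mono hU' hzw)
  exact not_isRelExact_of_represents_constantForm hrep hU'o ⟨hz₀, hξ⟩ hl hlℤ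
    (fun j => hw₀ _ (hl j) (hlℤ j)) hvol

end Nonvanishing

section ComplexSubspace

variable {g : ℕ}

/-- The real part of a complex vector, as a point of the real model space. -/
def reVec : (Fin g → ℂ) →L[ℝ] Coord g :=
  (EuclideanSpace.equiv (Fin g) ℝ).symm.toContinuousLinearMap ∘L
    ContinuousLinearMap.pi fun j => Complex.reCLM ∘L ContinuousLinearMap.proj j

/-- The imaginary part of a complex vector, as a point of the real model space. -/
def imVec : (Fin g → ℂ) →L[ℝ] Coord g :=
  (EuclideanSpace.equiv (Fin g) ℝ).symm.toContinuousLinearMap ∘L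
    ContinuousLinearMap.pi fun j => Complex.imCLM ∘L ContinuousLinearMap.proj j

theorem reVec_apply (z : Fin g → ℂ) (j : Fin g) : reVec z j = (z j).re := rfl

theorem imVec_apply (z : Fin g → ℂ) (j : Fin g) : imVec z j = (z j).im := rfl

theorem reVec_smul (c : ℂ) (z : Fin g → ℂ) : reVec (c • z) = c.re • reVec z - c.im • imVec z := by
  ext j
  simp [reVec_apply, imVec_apply]

theorem imVec_smul (c : ℂ) (z : Fin g → ℂ) : imVec (c • z) = c.re • imVec z + c.im • reVec z := by
  ext j
  simp [reVec_apply, imVec_apply]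

/-- The complexification of a subspace of `ℝ^g`. -/
def complexify (W : Submodule ℝ (Coord g)) : Submodule ℂ (Fin g → ℂ) where
  carrier := {z | reVec z ∈ W ∧ imVec z ∈ W}
  zero_mem' := by simp
  add_mem' := by
    rintro z z' ⟨hre, him⟩ ⟨hre', him'⟩
    exact ⟨map_add reVec z z' ▸ add_mem hre hre', map_add imVec z z' ▸ add_mem him him'⟩
  smul_mem' := by
    rintro c z ⟨hre, him⟩
    exact ⟨reVec_smul c z ▸ sub_mem (W.smul_mem _ hre) (W.smul_mem _ him),
      imVec_smul c z ▸ add_mem (W.smul_mem _ him) (W.smul_mem _ hre)⟩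

theorem mem_complexify {W : Submodule ℝ (Coord g)} {z : Fin g → ℂ} :
    z ∈ complexify W ↔ reVec z ∈ W ∧ imVec z ∈ W := Iff.rfl

/-- A complexified subspace is the product of its real and imaginary parts. -/
def complexifyEquiv (W : Submodule ℝ (Coord g)) : complexify W ≃ₗ[ℝ] W × W where
  toFun z := (⟨reVec z.1, z.2.1⟩, ⟨imVec z.1, z.2.2⟩)
  invFun p := ⟨fun j => ⟨p.1.1 j, p.2.1 j⟩, p.1.2, p.2.2⟩
  map_add' z z' := by ext j <;> simp [reVec_apply, imVec_apply]
  map_smul' c z := by ext j <;> simp [reVec_apply, imVec_apply]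
  left_inv z := rfl
  right_inv p := rfl

theorem finrank_complexify (W : Submodule ℝ (Coord g)) :
    Module.finrank ℂ (complexify W) = Module.finrank ℝ W := by
  have hreal := (complexifyEquiv W).finrank_eq
  rw [Module.finrank_prod, ← Module.finrank_mul_finrank ℝ ℂ, Complex.finrank_real_complex] at hreal
  omega

end ComplexSubspace

section Support

open scoped FourierTransform

theorem exists_submanifoldChart_of_mem_iff_sub_mem {𝕜 V : Type*} [NontriviallyNormedField 𝕜]
    [NormedAddCommGroup V] [NormedSpace 𝕜 V] (n : WithTop ℕ∞) {M O : Set V} {p : V}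
    {F : Submodule 𝕜 V} (hO : IsOpen O) (hp : p ∈ O) (h : ∀ z ∈ O, z ∈ M ↔ z - p ∈ F) :
    ∃ Φ : OpenPartialHomeomorph V V, p ∈ Φ.source ∧ ContDiffOn 𝕜 n Φ Φ.source ∧
      ContDiffOn 𝕜 n Φ.symm Φ.target ∧ Φ '' (M ∩ Φ.source) = Φ.target ∩ (F : Set V) := by
  let e : V ≃ₜ V := Homeomorph.subRight p
  refine ⟨e.toOpenPartialHomeomorphOfImageEq O hO (e.symm ⁻¹' O) (e.image_eq_preimage_symm O), hp,
    (contDiff_id.sub contDiff_const).contDiffOn, (contDiff_id.add contDiff_const).contDiffOn, ?_⟩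
  change e '' (M ∩ O) = e.symm ⁻¹' O ∩ F
  rw [e.image_eq_preimage_symm]
  ext z
  have hz : e.symm z - p = z := e.apply_symm_apply z
  rw [mem_preimage, mem_inter_iff, mem_inter_iff, mem_preimage, and_comm]
  exact and_congr_right fun hzO => by rw [h _ hzO, hz, SetLike.mem_coe]

variable {g : ℕ} {B : Type*} [TopologicalSpace B] [ChartedSpace (Coord g) B]
  {Λ : LagrangianCovering g B} {S : Set (X Λ)} {m : ℕ} {L : LocalSystem S}
  {φ : ActionChart Λ} {x₀ : Coord g} {D : LocalModel S φ m x₀}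

theorem exists_param_mem_of_mem_transformSupport (hS : IsClosed S) {x w : Coord g}
    (hx : x ∈ φ.1.target) (h : XHat.param φ (x, w) ∈ transformSupport L m) :
    ∃ y, X.param φ (x, y) ∈ S := by
  obtain ⟨α, hα⟩ := exists_mk_of_mem_proj (fst_mem_of_mem_transformSupport hS h)
  have hmk := X.mk_eq_param φ (φ.1.map_target hx) α
  rw [φ.1.right_inv hx] at hmk
  exact ⟨_, hmk ▸ hα⟩

theorem FlatFrame.hol_zero (E : FlatFrame D L) : E.hol 0 = 1 := by
  obtain ⟨i, hi⟩ := L.exists_mem_cover (D.pt_mem D.zero_mem_dom)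
  simpa using E.e_add i 0 D.zero_mem_dom hi 0 (zero_mem _) (zero_mem _)

theorem holonomy_eq_one_of_mem_transformSupport (E : FlatFrame D L) {x w l : Coord g}
    (hx : x ∈ Metric.ball x₀ D.r) (h : XHat.param φ (x, w) ∈ transformSupport L m)
    (hl : l ∈ D.W) (hlℤ : l ∈ intLattice g) : holonomy E l w = 1 := by
  by_contra hne
  cases m with
  | zero =>
    rw [Submodule.finrank_eq_zero.1 D.finrank_eq, Submodule.mem_bot] at hl
    rw [hl] at hne
    exact hne (by simp [holonomy, E.hol_zero])
  | succ q => exact notMem_transformSupport_of_holonomy_ne_one E hl hlℤ hx hne h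

theorem mem_transformSupport_iff (hS : IsClosed S) (E : FlatFrame D L) {x w : Coord g}
    (hx : x ∈ Metric.ball x₀ D.r) :
    XHat.param φ (x, w) ∈ transformSupport L m ↔
      x - x₀ ∈ D.Wᗮ ∧ ∀ l ∈ D.W, l ∈ intLattice g → holonomy E l w = 1 := by
  constructor
  · intro h
    obtain ⟨y, hy⟩ := exists_param_mem_of_mem_transformSupport hS (D.ball_subset hx) h
    exact ⟨(LocalModel.exists_sub_mem hx hy).1, fun l =>
      holonomy_eq_one_of_mem_transformSupport E hx h⟩
  · rintro ⟨hxW, hhol⟩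
    have hcoords : (D.coords (x - x₀)).1 = x := by
      simpa using congrArg Prod.fst (LocalModel.coords_sub_add hxW D.W.zero_mem)
    exact hcoords ▸ mem_transformSupport_of_holonomy_eq_one E hhol (LocalModel.sub_mem_dom hx)

theorem holonomy_eq_mul (E : FlatFrame D L) (l w w₀ : Coord g) :
    holonomy E l w = 𝐞 (inner ℝ l (w - w₀)) * holonomy E l w₀ := by
  rw [holonomy, holonomy, ← mul_assoc, ← AddChar.map_add_eq_mul, ← inner_add_right,
    sub_add_cancel]

theorem forall_holonomy_eq_one_iff_sub_mem (E : FlatFrame D L) {w₀ w : Coord g}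
    (hw₀ : ∀ l ∈ D.W, l ∈ intLattice g → holonomy E l w₀ = 1) {l : Fin m → Coord g}
    (hlℤ : ∀ j, l j ∈ intLattice g) (hspan : Submodule.span ℝ (range l) = D.W)
    (hw : ∀ j, |inner ℝ (l j) (w - w₀)| < 1) :
    (∀ l ∈ D.W, l ∈ intLattice g → holonomy E l w = 1) ↔ w - w₀ ∈ D.Wᗮ := by
  constructor
  · intro h
    rw [← hspan, ← Submodule.span_singleton_le_iff_mem, ← Submodule.isOrtho_iff_le,
      Submodule.isOrtho_span]
    rintro _ rfl _ ⟨j, rfl⟩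
    have hl : l j ∈ D.W := hspan ▸ Submodule.subset_span (mem_range_self j)
    have hhol := h (l j) hl (hlℤ j)
    rw [holonomy_eq_mul E _ w w₀, hw₀ _ hl (hlℤ j), mul_one, fourierChar_eq_one_iff] at hhol
    obtain ⟨n, hn⟩ := hhol
    have hn_lt : |n| < 1 := by exact_mod_cast hn ▸ hw j
    rw [real_inner_comm, hn, Int.abs_lt_one_iff.1 hn_lt, Int.cast_zero]
  · intro h l hl hlℤ
    rw [holonomy_eq_mul E l w w₀, hw₀ l hl hlℤ, Submodule.inner_right_of_mem_orthogonal hl h,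
      AddChar.map_zero_eq_one, mul_one]

theorem isComplexSubmanifold_transformSupport (hS : IsClosedLagrangian S)
    (hclean : IsFibrewiseClean S) (hm : FibresAreSubtori S m) (L : LocalSystem S) :
    IsComplexSubmanifold (transformSupport L m) := by
  refine ⟨g - m, fun φ p hp => ?_⟩
  obtain ⟨hx₀, hp⟩ : reVec p ∈ φ.1.target ∧
    XHat.param φ (reVec p, imVec p) ∈ transformSupport L m := hp
  obtain ⟨y₀, hy₀⟩ := exists_param_mem_of_mem_transformSupport hS.isClosed hx₀ hp
  obtain ⟨D⟩ := exists_localModel hS hclean hm φ hx₀ hy₀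
  obtain ⟨E⟩ := exists_flatFrame D L
  obtain ⟨l, -, hlℤ, -, hspan⟩ := D.rational.exists_basis D.finrank_eq
  have hw₀ := ((mem_transformSupport_iff hS.isClosed E (Metric.mem_ball_self D.r_pos)).1 hp).2
  let O : Set (Fin g → ℂ) := reVec ⁻¹' Metric.ball (reVec p) D.r ∩
    ⋂ j, {z | |inner ℝ (l j) (imVec z - imVec p)| < 1}
  have hO : IsOpen O := (Metric.isOpen_ball.preimage reVec.continuous).inter <|
    isOpen_iInter_of_finite fun j => isOpen_lt (by fun_prop) continuous_const
  have hpO : p ∈ O := ⟨Metric.mem_ball_self D.r_pos, by simp⟩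
  have hmem : ∀ z ∈ O, z ∈ inComplexChart (transformSupport L m) φ ↔ z - p ∈ complexify D.Wᗮ := by
    rintro z ⟨hz, hzl⟩
    have hw : ∀ j, |inner ℝ (l j) (imVec z - imVec p)| < 1 := fun j => mem_iInter.1 hzl j
    rw [mem_complexify, map_sub, map_sub,
      ← forall_holonomy_eq_one_iff_sub_mem E hw₀ hlℤ hspan hw,
      ← mem_transformSupport_iff hS.isClosed E hz]
    exact and_iff_right (D.ball_subset hz)
  obtain ⟨Φ, hpΦ, hΦ, hΦsymm, himage⟩ := exists_submanifoldChart_of_mem_iff_sub_mem ω hO hpO hmem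
  have hrank : Module.finrank ℂ (complexify D.Wᗮ) = g - m := by
    rw [finrank_complexify, finrank_orthogonal_eq D.finrank_eq]
  exact ⟨Φ, complexify D.Wᗮ, hpΦ, hΦ, hΦsymm, hrank, himage⟩

end Support

end TorusFibration

end

theorem mainTheorem2_general {g : ℕ} {B : Type*} [TopologicalSpace B]
    [ChartedSpace (Coord g) B] (Λ : LagrangianCovering g B) (S : Set (X Λ)) (m : ℕ)
    (hS : IsClosedLagrangian S) (hclean : IsFibrewiseClean S) (hm : FibresAreSubtori S m)
    (L : LocalSystem S) :
    VerticalTangentsParallel S ∧ IsComplexSubmanifold (transformSupport L m) :=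
  ⟨verticalTangentsParallel hS hclean hm, isComplexSubmanifold_transformSupport hS hclean hm L⟩

theorem mainTheorem2 {g : ℕ} {B : Type*} [TopologicalSpace B] [T2Space B]
    [SecondCountableTopology B] [ConnectedSpace B] [ChartedSpace (Coord g) B]
    [IsManifold (𝓡 g) ∞ B] (Λ : LagrangianCovering g B) (S : Set (X Λ)) (m : ℕ)
    (hS : IsClosedLagrangian S) (hclean : IsFibrewiseClean S) (hm : FibresAreSubtori S m)
    (L : LocalSystem S) :
    VerticalTangentsParallel S ↔ IsComplexSubmanifold (transformSupport L m) := by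
  obtain ⟨hparallel, hcomplex⟩ := mainTheorem2_general Λ S m hS hclean hm L
  exact iff_of_true hparallel hcomplex
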